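/- **Setting.** Let $d,n\ge 0$ and $M=\mathbb T^d\times\mathbb R^d\times\mathbb T^n$ with coordinates $(x,y,z)$, $\mathbb T=\mathbb R/\mathbb Z$. Maps into $M$, or into its complexification $M_{\mathbb C}=\mathbb C^{2d+n}/(\mathbb Z^d\times 0\times\mathbb Z^n)$, are identified with their lifts; vectors and matrices carry the maximum norm. Let $\Omega$ be a real analytic exact 2-form on $M$ whose kernel is the $\mathbb T^n$-direction, i.e. $\Omega_u(\xi,\eta)=\langle\xi,\operatorname{diag}(J(u),0)\,\eta\rangle$ with $J(u)$ a skew-symmetric invertible $2d\times 2d$ matrix. Let $f=f_\lambda:M\to M$ be a real analytic diffeomorphism with $f^*\Omega=\Omega$ (a member of a family, with the parameter $\lambda$ fixed). For $\rho>0$ let $U_\rho=\{\theta\in\mathbb C^{d+n}/\mathbb Z^{d+n}:|\operatorname{Im}\theta|\le\rho\}$, and let $\mathcal P_\rho$ be the set of maps $K:U_\rho\to M_{\mathbb C}$ that are continuous, holomorphic in the interior of $U_\rho$ and real for real $\theta$. Norms $\|\cdot\|_\rho$ are suprema over $U_\rho$ (for expressions with derivatives of $K$: over its interior). For $\gamma>0$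 and $\sigma\ge d+n$, $D(\gamma,\sigma)$ is the set of $\omega\in\mathbb R^{d+n}$ with $|l\cdot\omega-m|\ge\gamma(\sum_j|l_j|)^{-\sigma}$ for all $l\in\mathbb Z^{d+n}\setminus\{0\}$, $m\in\mathbb Z$. Put $T_\tau\theta=\theta+\tau$. For $K\in\mathcal P_\rho$ let $X$, $Z$ be the first $d$ and the last $n$ columns of $DK$. Subscripts $V$ and $N$ denote the components in the $(x,y)$- and the $z$-directions. Put $N=(X_V^\top X_V)^{-1}$, $Y_V=X_VN$, $Y=\begin{pmatrix}Y_V\\0\end{pmatrix}$, $J^{-1}Y=\begin{pmatrix}J(K)^{-1}Y_V\\0\end{pmatrix}$ (for short also its upper block), and $$M(\theta)=\begin{pmatrix}X_V&J^{-1}Y&Z_V\\X_N&0&Z_N\end{pmatrix},\qquad V(\theta)=\begin{pmatrix}0&I_d&0\\-I_d&-Y^\top J^{-1}Y&(J^{-1}Y)^\top J(K)Z_V\\X_N&0&Z_N\end{pmatrix}.$$ The torus $K$ is *non-degenerate* if $X_V^\top X_V$ and $V$ are invertible at every interior point of $U_\rho$. With $T_3$ the last $n$ rows of $M^{-1}$,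 put $$A(\theta)=T_3(\theta+\omega)\bigl[Df(K(\theta))\,(J^{-1}Y)(\theta)-(J^{-1}Y)(\theta+\omega)\bigr],$$ $$S_1(\theta)=\bigl[\,Y_V(\theta+\omega)^\top\ \ 0\,\bigr]\bigl[Df(K(\theta))\,(J^{-1}Y)(\theta)-(J^{-1}Y)(\theta+\omega)-Z(\theta+\omega)A(\theta)\bigr].$$ **Theorem (local uniqueness).** Let $\omega\in D(\gamma,\sigma)$ and let $K_1,K_2\in\mathcal P_\rho$ be two non-degenerate tori with $f(K_i(\theta))=K_i(\theta+\omega)$ on $U_\rho$. For some $r>0$ let $\mathcal B_r\subset M_{\mathbb C}$ be the $r$-neighbourhood of $K_1(U_\rho)$, and assume that $K_2(U_\rho)\subset\mathcal B_r$, that $f$ extends holomorphically to $\mathcal B_r$ with bounded first and second derivatives, that $J$ extends holomorphically to $\mathcal B_r$ with $J$ invertible and $J,J^{-1}$ bounded there, and that $\|DK_1\|_\rho,\|N_1\|_\rho<\infty$, where $N_1$ is the matrix $N$ of $K_1$. Assume that $$\Theta=\int_{\mathbb T^{d+n}}\begin{pmatrix}S_1(\theta)\\A(\theta)\end{pmatrix}d\theta,$$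 formed with $K=K_1$, has rank $d$. Then there is a constant $\tilde c>0$, depending only on $d$, $n$, $\sigma$, $\rho$, $r$ and on upper bounds for $|Df|_{C^1,\mathcal B_r}$, $|J|_{\mathcal B_r}$, $|J^{-1}|_{\mathcal B_r}$, $\|DK_1\|_\rho$, $\|N_1\|_\rho$ and $|(\Theta^\top\Theta)^{-1}\Theta^\top|$, such that the following holds. If $$\|K_1-K_2\|_\rho<\tilde c\,\gamma^2\delta^{2\sigma},\qquad \delta=\rho/8,$$ then there is $\tau\in\mathbb T^{d+n}$ with $K_1\circ T_\tau=K_2$ on $U_{\rho/2}$. -/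

import Mathlib

namespace PresymplecticKAM

open Matrix

/-- Coordinates `((x, y), z)` of the phase space `M = 𝕋^d × ℝ^d × 𝕋^n`. The index block `Sum.inl`
spans the subbundle `V`, and the block `Sum.inr` spans the kernel `N` of the presymplectic form.
Functions on these index types carry the maximum norm. -/
abbrev PhaseIdx (d n : ℕ) : Type := (Fin d ⊕ Fin d) ⊕ Fin n

/-- Coordinates of the angle `θ ∈ 𝕋^{d+n}`: the first `d` and the last `n` angles. -/
abbrev AngleIdx (d n : ℕ) : Type := Fin d ⊕ Fin n

/-- Two vectors of `𝕜^{2d+n}` (`𝕜 = ℝ` or `ℂ`) represent the same point of `M`, respectively of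
the complexification of `M`: they differ by an integer vector in the `x` and `z` coordinates.
All maps into, or defined on, the torus or `M` are described by lifts to the universal cover. -/
def SameInM {d n : ℕ} {𝕜 : Type*} [Ring 𝕜] (u v : PhaseIdx d n → 𝕜) : Prop :=
  ∃ k : PhaseIdx d n → ℤ, (∀ i : Fin d, k (Sum.inl (Sum.inr i)) = 0) ∧ ∀ j, u j = v j + (k j : 𝕜)

/-- The distance in (the complexification of) `M` between the points represented by `u` and `v`
is less than `ε`. -/
def CloseInM {d n : ℕ} (ε : ℝ) (u v : PhaseIdx d n → ℂ) : Prop :=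
  ∃ w, SameInM w v ∧ ‖u - w‖ < ε

/-- The complexification of a real vector. -/
def toC {ι : Type*} (u : ι → ℝ) : ι → ℂ := fun i => (u i : ℂ)

/-- The Jacobian matrix of `g` at `u`. -/
noncomputable def jac (𝕜 : Type*) [NontriviallyNormedField 𝕜] {ι κ : Type*} [Fintype ι]
    [DecidableEq ι] [Fintype κ] (g : (ι → 𝕜) → (κ → 𝕜)) (u : ι → 𝕜) : Matrix κ ι 𝕜 :=
  Matrix.of fun i j => fderiv 𝕜 g u (Pi.single j 1) i

/-- All entries of the matrix are bounded by `C`, i.e. its maximum norm is at most `C`. -/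
def EntriesLE {𝕜 : Type*} [Norm 𝕜] {κ ι : Type*} (A : Matrix κ ι 𝕜) (C : ℝ) : Prop :=
  ∀ i j, ‖A i j‖ ≤ C

/-- The set of Diophantine frequency vectors `D(γ, σ)`. -/
def Diophantine {d n : ℕ} (γ σ : ℝ) (ω : AngleIdx d n → ℝ) : Prop :=
  ∀ l : AngleIdx d n → ℤ, l ≠ 0 → ∀ m : ℤ,
    γ * (∑ j, |(l j : ℝ)|) ^ (-σ) ≤ |(∑ j, (l j : ℝ) * ω j) - (m : ℝ)|

/-- The closed complex strip `U_ρ` (in the universal cover). -/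
def strip (d n : ℕ) (ρ : ℝ) : Set (AngleIdx d n → ℂ) := {θ | ∀ j, |(θ j).im| ≤ ρ}

/-- The interior of the strip `U_ρ`. -/
def openStrip (d n : ℕ) (ρ : ℝ) : Set (AngleIdx d n → ℂ) := {θ | ∀ j, |(θ j).im| < ρ}

/-- `K` is (a lift of) an element of `𝒫_ρ`: a map from `U_ρ ⊆ ℂ^{d+n}/ℤ^{d+n}` to the
complexification of `M` that is continuous on `U_ρ`, holomorphic in its interior, and real for
real angles. -/
structure IsTorusMap {d n : ℕ} (ρ : ℝ) (K : (AngleIdx d n → ℂ) → (PhaseIdx d n → ℂ)) :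
    Prop where
  periodic : ∀ θ ∈ strip d n ρ, ∀ l : AngleIdx d n → ℤ, SameInM (K (fun j => θ j + l j)) (K θ)
  continuousOn : ContinuousOn K (strip d n ρ)
  holomorphic : DifferentiableOn ℂ K (openStrip d n ρ)
  real : ∀ θ : AngleIdx d n → ℝ, ∃ u : PhaseIdx d n → ℝ, K (toC θ) = toC u

/-- The set `ℬ_r` (its preimage in the universal cover): the `r`-neighbourhood of `K(U_ρ)` in the
complexification of `M`. -/
def nbhd {d n : ℕ} (ρ r : ℝ) (K : (AngleIdx d n → ℂ) → (PhaseIdx d n → ℂ)) :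
    Set (PhaseIdx d n → ℂ) :=
  {z | ∃ θ ∈ strip d n ρ, CloseInM r z (K θ)}

/-- The matrix `J̃ = diag(J, 0)`, so that `Ω_u(ξ, η) = ⟨ξ, J̃(u) η⟩`. -/
def tildeJ {d n : ℕ} {𝕜 : Type*} [Zero 𝕜] (J : Matrix (Fin d ⊕ Fin d) (Fin d ⊕ Fin d) 𝕜) :
    Matrix (PhaseIdx d n) (PhaseIdx d n) 𝕜 :=
  Matrix.fromBlocks J 0 0 0

/-- `J` is the matrix of a real analytic exact `2`-form `Ω` on `M` whose kernel is exactly the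
`𝕋^n`-direction: `J` is a function on `M` with values in the invertible skew-symmetric matrices,
and `Ω = dα` for a smooth `1`-form `α = ∑ aᵢ duᵢ` on `M`. -/
structure IsExactPresymplectic {d n : ℕ}
    (J : (PhaseIdx d n → ℝ) → Matrix (Fin d ⊕ Fin d) (Fin d ⊕ Fin d) ℝ) : Prop where
  periodic : ∀ u v, SameInM u v → J u = J v
  analytic : ∀ i j, AnalyticOnNhd ℝ (fun u => J u i j) Set.univ
  skew : ∀ u, (J u)ᵀ = -J u
  nondegenerate : ∀ u, IsUnit (J u)
  exact : ∃ a : (PhaseIdx d n → ℝ) → (PhaseIdx d n → ℝ),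
    ContDiff ℝ (⊤ : ℕ∞) a ∧ (∀ u v, SameInM u v → a u = a v) ∧
    ∀ u i j, (tildeJ (J u) : Matrix (PhaseIdx d n) (PhaseIdx d n) ℝ) i j
      = jac ℝ a u j i - jac ℝ a u i j

/-- `f` is (a lift of) a real analytic diffeomorphism of `M` with `f^*Ω = Ω`. -/
structure IsPresymplecticDiffeo {d n : ℕ}
    (J : (PhaseIdx d n → ℝ) → Matrix (Fin d ⊕ Fin d) (Fin d ⊕ Fin d) ℝ)
    (f : (PhaseIdx d n → ℝ) → (PhaseIdx d n → ℝ)) : Prop where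
  descends : ∀ u v, SameInM u v → SameInM (f u) (f v)
  analytic : AnalyticOnNhd ℝ f Set.univ
  inverse : ∃ g : (PhaseIdx d n → ℝ) → (PhaseIdx d n → ℝ),
    AnalyticOnNhd ℝ g Set.univ ∧ Function.LeftInverse g f ∧ Function.RightInverse g f ∧
    ∀ u v, SameInM u v → SameInM (g u) (g v)
  presymplectic : ∀ u, (jac ℝ f u)ᵀ * tildeJ (J (f u)) * jac ℝ f u = tildeJ (J u)

/-- `Jc` is a holomorphic extension of `J` to `B`, invertible there, with `|J|_B ≤ C` and
`|J⁻¹|_B ≤ C`. -/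
structure ExtendsForm {d n : ℕ}
    (J : (PhaseIdx d n → ℝ) → Matrix (Fin d ⊕ Fin d) (Fin d ⊕ Fin d) ℝ)
    (Jc : (PhaseIdx d n → ℂ) → Matrix (Fin d ⊕ Fin d) (Fin d ⊕ Fin d) ℂ)
    (B : Set (PhaseIdx d n → ℂ)) (C : ℝ) : Prop where
  periodic : ∀ z ∈ B, ∀ w ∈ B, SameInM z w → Jc z = Jc w
  holomorphic : ∀ i j, DifferentiableOn ℂ (fun z => Jc z i j) B
  extends_real : ∀ u, toC u ∈ B → Jc (toC u) = (J u).map (fun t => (t : ℂ))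
  nondegenerate : ∀ z ∈ B, IsUnit (Jc z)
  bound : ∀ z ∈ B, EntriesLE (Jc z) C
  bound_inv : ∀ z ∈ B, EntriesLE (Jc z)⁻¹ C

/-- `F` is (a lift of) a holomorphic extension of `f` to `B` with `|f|_{C², B} ≤ C`. The norm is
that of the first and second derivative; the values lie in a torus in the `x` and `z` directions
and are not restricted. -/
structure ExtendsMap {d n : ℕ} (f : (PhaseIdx d n → ℝ) → (PhaseIdx d n → ℝ))
    (F : (PhaseIdx d n → ℂ) → (PhaseIdx d n → ℂ)) (B : Set (PhaseIdx d n → ℂ)) (C : ℝ) :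
    Prop where
  descends : ∀ z ∈ B, ∀ w ∈ B, SameInM z w → SameInM (F z) (F w)
  holomorphic : DifferentiableOn ℂ F B
  extends_real : ∀ u, toC u ∈ B → SameInM (F (toC u)) (toC (f u))
  bound_one : ∀ z ∈ B, ‖iteratedFDeriv ℂ 1 F z‖ ≤ C
  bound_two : ∀ z ∈ B, ‖iteratedFDeriv ℂ 2 F z‖ ≤ C

section Torus

variable {d n : ℕ} (Jc : (PhaseIdx d n → ℂ) → Matrix (Fin d ⊕ Fin d) (Fin d ⊕ Fin d) ℂ)
  (F : (PhaseIdx d n → ℂ) → (PhaseIdx d n → ℂ))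
  (ω : AngleIdx d n → ℝ)
  (K : (AngleIdx d n → ℂ) → (PhaseIdx d n → ℂ)) (θ : AngleIdx d n → ℂ)

/-- `X_V`: the `V`-components of the first `d` columns of `DK`. -/
noncomputable def XV : Matrix (Fin d ⊕ Fin d) (Fin d) ℂ := (jac ℂ K θ).toBlocks₁₁

/-- `Z_V`: the `V`-components of the last `n` columns of `DK`. -/
noncomputable def ZV : Matrix (Fin d ⊕ Fin d) (Fin n) ℂ := (jac ℂ K θ).toBlocks₁₂

/-- `X_N`: the `N`-components of the first `d` columns of `DK`. -/
noncomputable def XN : Matrix (Fin n) (Fin d) ℂ := (jac ℂ K θ).toBlocks₂₁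

/-- `Z_N`: the `N`-components of the last `n` columns of `DK`. -/
noncomputable def ZN : Matrix (Fin n) (Fin n) ℂ := (jac ℂ K θ).toBlocks₂₂

/-- `N(θ)`, the matrix with `N(θ) X_V(θ)ᵀ X_V(θ) = Id`. -/
noncomputable def matN : Matrix (Fin d) (Fin d) ℂ := ((XV K θ)ᵀ * XV K θ)⁻¹

/-- `Y_V = X_V N`. -/
noncomputable def YV : Matrix (Fin d ⊕ Fin d) (Fin d) ℂ := XV K θ * matN K θ

/-- The `V`-components of `J⁻¹(K(θ)) Y(θ)`. -/
noncomputable def JY : Matrix (Fin d ⊕ Fin d) (Fin d) ℂ := (Jc (K θ))⁻¹ * YV K θ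

/-- `J⁻¹(K(θ)) Y(θ)`, with vanishing `N`-components. -/
noncomputable def fullJY : Matrix (PhaseIdx d n) (Fin d) ℂ := Matrix.fromRows (JY Jc K θ) 0

/-- `Z`: the last `n` columns of `DK`. -/
noncomputable def fullZ : Matrix (PhaseIdx d n) (Fin n) ℂ := Matrix.fromRows (ZV K θ) (ZN K θ)

/-- The matrix `M(θ)` with columns `X`, `J⁻¹(K) Y`, `Z`. -/
noncomputable def matM : Matrix (PhaseIdx d n) (PhaseIdx d n) ℂ :=
  Matrix.fromBlocks (Matrix.fromCols (XV K θ) (JY Jc K θ)) (ZV K θ)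
    (Matrix.fromCols (XN K θ) 0) (ZN K θ)

/-- The matrix `V(θ)` with rows `(0, Id, 0)`, `(-Id, -Yᵀ J⁻¹ Y, (J⁻¹ Y)ᵀ J Z_V)` and
`(X_N, 0, Z_N)`. -/
noncomputable def matV : Matrix (PhaseIdx d n) (PhaseIdx d n) ℂ :=
  Matrix.fromBlocks
    (Matrix.fromBlocks 0 1 (-1) (-((YV K θ)ᵀ * JY Jc K θ)))
    (Matrix.fromRows 0 ((JY Jc K θ)ᵀ * Jc (K θ) * ZV K θ))
    (Matrix.fromCols (XN K θ) 0) (ZN K θ)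

/-- The rotation `T_τ θ = θ + τ`. -/
def shift (τ : AngleIdx d n → ℝ) (θ : AngleIdx d n → ℂ) : AngleIdx d n → ℂ := θ + toC τ

/-- `T₃`: the last `n` rows of `M⁻¹`. -/
noncomputable def matT3 : Matrix (Fin n) (PhaseIdx d n) ℂ := ((matM Jc K θ)⁻¹).toRows₂

/-- `A(θ) = T₃(θ+ω) [Df(K(θ)) J⁻¹(K(θ)) Y(θ) - J⁻¹(K(θ+ω)) Y(θ+ω)]`. -/
noncomputable def matA : Matrix (Fin n) (Fin d) ℂ :=
  matT3 Jc K (shift ω θ) *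
    (jac ℂ F (K θ) * fullJY Jc K θ - fullJY Jc K (shift ω θ))

/-- `S₁(θ) = [Y_V(θ+ω)ᵀ 0] [Df(K(θ)) J⁻¹(K(θ)) Y(θ) - J⁻¹(K(θ+ω)) Y(θ+ω) - Z(θ+ω) A(θ)]`. -/
noncomputable def matS1 : Matrix (Fin d) (Fin d) ℂ :=
  Matrix.fromCols ((YV K (shift ω θ))ᵀ) (0 : Matrix (Fin d) (Fin n) ℂ) *
    (jac ℂ F (K θ) * fullJY Jc K θ - fullJY Jc K (shift ω θ)
      - fullZ K (shift ω θ) * matA Jc F ω K θ)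

/-- `Θ = avg [S₁; A]`, the average over the real torus `𝕋^{d+n}`. For real `θ` the integrand is
real, so that taking real parts does not change it. -/
noncomputable def matTheta : Matrix (AngleIdx d n) (Fin d) ℝ :=
  Matrix.of fun i j => ∫ t in Set.Icc (0 : AngleIdx d n → ℝ) 1,
    (Matrix.fromRows (matS1 Jc F ω K (toC t)) (matA Jc F ω K (toC t)) i j).re

/-- `K` is a non-degenerate torus: `X_Vᵀ X_V` and `V` are invertible. (The derivative of an element
of `𝒫_ρ` is defined in the interior of `U_ρ`.) -/
def IsNondegenerate (ρ : ℝ) : Prop :=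
  ∀ θ ∈ openStrip d n ρ, IsUnit ((XV K θ)ᵀ * XV K θ) ∧ IsUnit (matV Jc K θ)

/-- `K` is an invariant torus with frequency `ω`: `f(K(θ)) = K(θ + ω)` in `M`, for `θ ∈ U_ρ`. -/
def IsInvariantTorus (ρ : ℝ) : Prop :=
  ∀ θ ∈ strip d n ρ, SameInM (F (K θ)) (K (shift ω θ))

end Torus

/-- The left inverse `(Θᵀ Θ)⁻¹ Θᵀ` of a real matrix `Θ` of full column rank. -/
noncomputable def leftInverse {κ ι : Type*} [Fintype κ] [Fintype ι] [DecidableEq ι]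
    (Θ : Matrix κ ι ℝ) : Matrix ι κ ℝ := (Θᵀ * Θ)⁻¹ * Θᵀ

end PresymplecticKAM

open PresymplecticKAM

/-!
The torus `K = K₁` is kept fixed, and `K₂` is moved towards it by translations of its angle. If `G`
is a translate of `K₂` with `‖G - K‖ ≤ ε`, then `Δ = G - K` satisfies `Δ(θ + ω) = DF(K(θ)) Δ(θ)` up
to an error `O(ε²)`. In the frame `M = (X, J⁻¹Y, Z)` the linear map `DF(K)` becomes unipotent
(`TorusHyp.P_mul_matM`), so for the coordinates `ξ = M⁻¹Δ` this is a triangular system: the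
coordinate `ξ_y` transverse to the torus is invariant under the rotation, and the tangential
coordinates change by `(S₁; A) ξ_y`, both up to `O(ε²)`. A function that is almost invariant under a
Diophantine rotation is almost equal to its mean value (`exists_cohomological_bound`), and the mean
value of the tangential equations is `Θ` times the mean value of `ξ_y`; as `Θ` has full column rank,
`ξ_y` is `O(ε²)`, and the tangential coordinates are constant up to `O(γ⁻²ε²)`
(`exists_reduced_bound`). A constant tangential displacement is a translation of the angle to first
order, so `G` is `O(γ⁻²ε²)`-close to a translate of `K` on a smaller strip (`exists_newton_step`).
Iterating, the translations converge, and `K₂` equals a translate of `K₁` (`exists_translate_eq`).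
Two divisions by small divisors per step account for the factor `γ²` in the smallness condition.

The structure of `DF(K)` in the frame rests on two facts. The torus is isotropic
(`TorusHyp.isotropic`): the pullback of the form is invariant under the rotation, hence constant,
and its mean value vanishes because the form is exact. And `F` preserves the form along `K`
(`TorusHyp.presymplectic`), which is true at real angles and extends by the identity theorem.

The constants may depend only on the listed bounds, and these do not include a bound for `M⁻¹`. Such
a bound holds automatically (`exists_entriesLE_matM_inv`). By isotropy `Z_V = X_V B`, and the slope
`B = Y_Vᵀ Z_V` is invariant, so it is a constant matrix. Up to a bounded factor, `det M` at a real
angle is the Jacobian determinant of the map `t ↦ (t_x + B t_z, K_N(t))`. This is an equivariant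
local diffeomorphism of `ℝ^{d+n}`, whose group of translations is discrete with a scale controlled
by the bounds; so it is onto, and comparing volumes its Jacobian cannot be small everywhere
(`exists_le_abs_det`). Since `det M` has no zeros on the strip, Harnack's inequality bounds it below
on every smaller strip (`exists_lower_bound_of_nonvanishing`).
-/

namespace PresymplecticKAM

open Set Filter Topology MeasureTheory Matrix

/-! ### Holomorphic functions of several complex variables -/

section

/-- Cauchy's estimate for the derivative of a holomorphic function on a ball, in a crude form. -/
theorem norm_fderiv_le_of_norm_le_on_ball {E : Type*} [NormedAddCommGroup E] [NormedSpace ℂ E]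
    {G : Type*} [NormedAddCommGroup G] [NormedSpace ℂ G]
    {g : E → G} {z : E} {R C : ℝ} (hR : 0 < R)
    (hg : DifferentiableOn ℂ g (Metric.ball z R)) (hC : ∀ w ∈ Metric.ball z R, ‖g w‖ ≤ C) :
    ‖fderiv ℂ g z‖ ≤ 2 * C / R := by
  have hC0 : 0 ≤ C := (norm_nonneg _).trans (hC z (Metric.mem_ball_self hR))
  have hz : DifferentiableAt ℂ g z := hg.differentiableAt (Metric.ball_mem_nhds z hR)
  refine ContinuousLinearMap.opNorm_le_bound _ (by positivity) fun v => ?_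
  by_cases hv : v = 0
  · simp [hv]
  have hv' : 0 < ‖v‖ := norm_pos_iff.mpr hv
  set ρ := R / (2 * ‖v‖) with hρ
  have hρ0 : 0 < ρ := by positivity
  have hmem : ∀ ζ ∈ Metric.closedBall (0 : ℂ) ρ, z + ζ • v ∈ Metric.ball z R := by
    intro ζ hζ
    rw [mem_closedBall_zero_iff] at hζ
    rw [mem_ball_iff_norm, add_sub_cancel_left, norm_smul]
    calc ‖ζ‖ * ‖v‖ ≤ ρ * ‖v‖ := by gcongr
      _ = R / 2 := by rw [hρ]; field_simp
      _ < R := by linarith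
  have hline : DifferentiableOn ℂ (fun ζ : ℂ => g (z + ζ • v)) (Metric.closedBall 0 ρ) := by
    intro ζ hζ
    have h1 : DifferentiableAt ℂ g (z + ζ • v) :=
      hg.differentiableAt (Metric.isOpen_ball.mem_nhds (hmem ζ hζ))
    have h2 : DifferentiableAt ℂ (fun ζ : ℂ => z + ζ • v) ζ := by fun_prop
    exact (h1.comp ζ h2).differentiableWithinAt
  have key := Complex.norm_deriv_le_of_forall_mem_sphere_norm_le (c := 0) hρ0
    (hline.diffContOnCl_ball subset_rfl)
    (fun ζ hζ => hC _ (hmem ζ (Metric.sphere_subset_closedBall hζ)))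
  have hd : HasDerivAt (fun ζ : ℂ => g (z + ζ • v)) (fderiv ℂ g z v) 0 := by
    have h2 : HasDerivAt (fun ζ : ℂ => z + ζ • v) v 0 := by
      simpa using ((hasDerivAt_id (0 : ℂ)).smul_const v).const_add z
    have h1 : HasFDerivAt g (fderiv ℂ g z) (z + (0 : ℂ) • v) := by simpa using hz.hasFDerivAt
    exact h1.comp_hasDerivAt 0 h2
  rw [hd.deriv] at key
  calc ‖fderiv ℂ g z v‖ ≤ C / ρ := key
    _ = 2 * C / R * ‖v‖ := by rw [hρ]; field_simp

/-- An integral of translates of a holomorphic function over a compact set of parameters is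
holomorphic. -/
theorem differentiableAt_integral_translates {ι : Type*} [Fintype ι] {g : (ι → ℂ) → ℂ}
    {U : Set (ι → ℂ)} (hU : IsOpen U) (hg : DifferentiableOn ℂ g U)
    {α : Type*} [TopologicalSpace α] [MeasurableSpace α] [OpensMeasurableSpace α]
    [SecondCountableTopology α] [T2Space α] {μ : Measure α} [IsFiniteMeasureOnCompacts μ]
    {T : Set α} (hT : IsCompact T)
    {φ : α → (ι → ℂ)} (hφ : Continuous φ) {k : α → ℂ} (hk : Continuous k)
    {w₀ : ι → ℂ} (hw : ∀ t ∈ T, w₀ + φ t ∈ U) :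
    DifferentiableAt ℂ (fun w => ∫ t in T, k t * g (w + φ t) ∂μ) w₀ := by
  have hcomp : IsCompact ((fun t => w₀ + φ t) '' T) := hT.image (by fun_prop)
  obtain ⟨δ, hδ, hδU⟩ := hcomp.exists_cthickening_subset_open hU (by
    rintro _ ⟨t, ht, rfl⟩; exact hw t ht)
  have hcT : IsCompact (Metric.cthickening δ ((fun t => w₀ + φ t) '' T)) := hcomp.cthickening
  obtain ⟨C, hC⟩ := hcT.exists_bound_of_continuousOn (hg.continuousOn.mono hδU)
  obtain ⟨Ck, hCk⟩ := hT.exists_bound_of_continuousOn hk.continuousOn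
  have hball : ∀ t ∈ T, ∀ w ∈ Metric.ball w₀ (δ / 2),
      Metric.ball (w + φ t) (δ / 2) ⊆ Metric.cthickening δ ((fun t => w₀ + φ t) '' T) := by
    intro t ht w hw z hz
    refine Metric.mem_cthickening_of_dist_le z (w₀ + φ t) δ _ ⟨t, ht, rfl⟩ ?_
    have h1 : dist z (w + φ t) < δ / 2 := hz
    have h2 : dist (w + φ t) (w₀ + φ t) < δ / 2 := by simpa using hw
    linarith [dist_triangle z (w + φ t) (w₀ + φ t)]
  have hmemU : ∀ t ∈ T, ∀ w ∈ Metric.ball w₀ (δ / 2), w + φ t ∈ U := fun t ht w hw =>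
    hδU (hball t ht w hw (Metric.mem_ball_self (by positivity)))
  have hcont : ∀ w ∈ Metric.ball w₀ (δ / 2), ContinuousOn (fun t => k t * g (w + φ t)) T := by
    intro w hw
    refine hk.continuousOn.mul (hg.continuousOn.comp (by fun_prop) fun t ht => hmemU t ht w hw)
  have hTm : MeasurableSet T := hT.isClosed.measurableSet
  have hδ2 : 0 < δ / 2 := by positivity
  refine (hasFDerivAt_integral_of_dominated_of_fderiv_le (𝕜 := ℂ) (s := Metric.ball w₀ (δ / 2))
    (F := fun w t => k t * g (w + φ t))
    (F' := fun w t => k t • fderiv ℂ g (w + φ t))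
    (bound := fun _ => |Ck| * (2 * C / (δ / 2)))
    (Metric.ball_mem_nhds w₀ hδ2) ?_ ?_ ?_ ?_ ?_ ?_).differentiableAt
  · filter_upwards [Metric.ball_mem_nhds w₀ hδ2] with w hw
    exact (hcont w hw).aestronglyMeasurable hTm
  · exact (hcont w₀ (Metric.mem_ball_self hδ2)).integrableOn_compact hT
  · refine AEStronglyMeasurable.smul hk.measurable.aestronglyMeasurable ?_
    refine Measurable.aestronglyMeasurable ?_
    exact (measurable_fderiv ℂ g).comp (by fun_prop)
  · refine (ae_restrict_iff' hTm).mpr (Eventually.of_forall fun t ht w hw => ?_)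
    rw [norm_smul]
    have h1 : ‖k t‖ ≤ |Ck| := (hCk t ht).trans (le_abs_self _)
    have h2 := norm_fderiv_le_of_norm_le_on_ball hδ2
      ((hg.mono hδU).mono (hball t ht w hw)) (fun z hz => hC z (hball t ht w hw hz))
    gcongr
  · have : IsFiniteMeasure (μ.restrict T) := ⟨by simpa using hT.measure_lt_top⟩
    exact integrable_const _
  · refine (ae_restrict_iff' hTm).mpr (Eventually.of_forall fun t ht w hw => ?_)
    have h1 : HasFDerivAt g (fderiv ℂ g (w + φ t)) (w + φ t) :=
      (hg.differentiableAt (hU.mem_nhds (hmemU t ht w hw))).hasFDerivAt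
    have h2 : HasFDerivAt (fun w => g (w + φ t)) (fderiv ℂ g (w + φ t)) w :=
      (hasFDerivAt_comp_add_right (φ t)).mpr h1
    exact h2.const_mul (k t)

/-- The directional derivative of a holomorphic function is holomorphic, by Cauchy's formula on
small circles in the given direction. -/
theorem differentiableOn_fderiv_apply {ι : Type*} [Fintype ι] {g : (ι → ℂ) → ℂ}
    {U : Set (ι → ℂ)} (hU : IsOpen U) (hg : DifferentiableOn ℂ g U) (v : ι → ℂ) :
    DifferentiableOn ℂ (fun z => fderiv ℂ g z v) U := by
  intro z₀ hz₀
  obtain ⟨ε, hε, hεU⟩ := Metric.isOpen_iff.mp hU z₀ hz₀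
  set r := ε / (2 * (‖v‖ + 1)) with hr
  have hv1 : 0 < ‖v‖ + 1 := by positivity
  have hr0 : 0 < r := by positivity
  have hrv : r * ‖v‖ ≤ ε / 2 := by
    have : r * (‖v‖ + 1) = ε / 2 := by rw [hr]; field_simp
    nlinarith
  have hmem : ∀ w ∈ Metric.ball z₀ (ε / 2), ∀ ζ ∈ Metric.closedBall (0 : ℂ) r,
      w + ζ • v ∈ U := by
    intro w hw ζ hζ
    apply hεU
    rw [mem_ball_iff_norm] at hw ⊢
    rw [mem_closedBall_zero_iff] at hζ
    calc ‖w + ζ • v - z₀‖ = ‖(w - z₀) + ζ • v‖ := by congr 1; abel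
      _ ≤ ‖w - z₀‖ + ‖ζ • v‖ := norm_add_le _ _
      _ < ε / 2 + ε / 2 := by
          rw [norm_smul]
          have : ‖ζ‖ * ‖v‖ ≤ r * ‖v‖ := by gcongr
          linarith
      _ = ε := by ring
  -- Cauchy's formula for the derivative along `v`.
  have hform : ∀ w ∈ Metric.ball z₀ (ε / 2), fderiv ℂ g w v =
      ∫ t in Icc (0 : ℝ) (2 * Real.pi), ((2 * Real.pi * Complex.I)⁻¹ *
        (deriv (circleMap 0 r) t * ((circleMap 0 r t) ^ 2)⁻¹)) * g (w + circleMap 0 r t • v) := by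
    intro w hw
    have hopen : IsOpen {ζ : ℂ | w + ζ • v ∈ U} := hU.preimage (by fun_prop)
    have hline : DifferentiableOn ℂ (fun ζ : ℂ => g (w + ζ • v)) {ζ : ℂ | w + ζ • v ∈ U} := by
      intro ζ hζ
      have h1 : DifferentiableAt ℂ g (w + ζ • v) := hg.differentiableAt (hU.mem_nhds hζ)
      have h2 : DifferentiableAt ℂ (fun ζ : ℂ => w + ζ • v) ζ := by fun_prop
      exact (h1.comp ζ h2).differentiableWithinAt
    have hw' : w ∈ U := by simpa using hmem w hw 0 (by simp [hr0.le])
    have hd : HasDerivAt (fun ζ : ℂ => g (w + ζ • v)) (fderiv ℂ g w v) 0 := by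
      have h2 : HasDerivAt (fun ζ : ℂ => w + ζ • v) v 0 := by
        simpa using ((hasDerivAt_id (0 : ℂ)).smul_const v).const_add w
      have h1 : HasFDerivAt g (fderiv ℂ g w) (w + (0 : ℂ) • v) := by
        simpa using (hg.differentiableAt (hU.mem_nhds hw')).hasFDerivAt
      exact h1.comp_hasDerivAt 0 h2
    have hc := Complex.two_pi_I_inv_smul_circleIntegral_sub_sq_inv_smul_of_differentiable
      hopen (hmem w hw) hline (Metric.mem_ball_self hr0)
    rw [hd.deriv] at hc
    rw [← hc, circleIntegral, intervalIntegral.integral_of_le (by positivity),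
      ← integral_Icc_eq_integral_Ioc, smul_eq_mul, ← integral_const_mul]
    refine integral_congr_ae (Eventually.of_forall fun t => ?_)
    simp only [smul_eq_mul, sub_zero]
    ring
  have hdiff : DifferentiableAt ℂ (fun w => ∫ t in Icc (0 : ℝ) (2 * Real.pi),
      ((2 * Real.pi * Complex.I)⁻¹ *
        (deriv (circleMap 0 r) t * ((circleMap 0 r t) ^ 2)⁻¹)) * g (w + circleMap 0 r t • v)) z₀ := by
    refine differentiableAt_integral_translates hU hg isCompact_Icc (by fun_prop) ?_ ?_
    · simp only [deriv_circleMap]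
      refine continuous_const.mul (Continuous.mul (by fun_prop) (Continuous.inv₀ (by fun_prop) ?_))
      intro t
      exact pow_ne_zero _ (circleMap_ne_center hr0.ne')
    · intro t _
      exact hmem z₀ (Metric.mem_ball_self (by positivity)) _ (circleMap_mem_closedBall 0 hr0.le t)
  refine (hdiff.congr_of_eventuallyEq ?_).differentiableWithinAt
  filter_upwards [Metric.ball_mem_nhds z₀ (half_pos hε)] with w hw
  exact hform w hw

/-- A function which is Fréchet holomorphic on an open set is smooth there. -/
theorem contDiffOn_of_differentiableOn {ι : Type*} [Fintype ι] {g : (ι → ℂ) → ℂ}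
    {U : Set (ι → ℂ)} (hU : IsOpen U) (hg : DifferentiableOn ℂ g U) (m : ℕ) :
    ContDiffOn ℂ m g U := by
  classical
  induction m generalizing g with
  | zero => exact contDiffOn_zero.mpr hg.continuousOn
  | succ m ih =>
    rw [Nat.cast_succ, contDiffOn_succ_iff_fderiv_of_isOpen hU]
    refine ⟨hg, fun h => absurd h (by simp), ?_⟩
    rw [contDiffOn_clm_apply]
    intro v
    exact ih (differentiableOn_fderiv_apply hU hg v)

theorem contDiffOn_pi_of_differentiableOn {ι κ : Type*} [Fintype ι] [Fintype κ]
    {g : (ι → ℂ) → (κ → ℂ)} {U : Set (ι → ℂ)} (hU : IsOpen U) (hg : DifferentiableOn ℂ g U)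
    (m : ℕ) : ContDiffOn ℂ m g U :=
  contDiffOn_pi.mpr fun i => contDiffOn_of_differentiableOn hU (differentiableOn_pi.mp hg i) m

section Strip

variable {d n : ℕ}

theorem isOpen_openStrip (ρ : ℝ) : IsOpen (openStrip d n ρ) := by
  have : openStrip d n ρ = ⋂ j, {θ | |(θ j).im| < ρ} := by ext; simp [openStrip]
  rw [this]
  exact isOpen_iInter_of_finite fun j => isOpen_lt (by fun_prop) continuous_const

theorem convex_openStrip (ρ : ℝ) : Convex ℝ (openStrip d n ρ) := by
  intro x hx y hy a b ha hb hab j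
  have h1 := abs_lt.mp (hx j)
  have h2 := abs_lt.mp (hy j)
  simp only [Pi.add_apply, Pi.smul_apply, Complex.add_im, Complex.smul_im, smul_eq_mul]
  rcases ha.eq_or_lt with rfl | ha'
  · obtain rfl : b = 1 := by linarith
    simpa using hy j
  · refine abs_lt.mpr ⟨?_, ?_⟩ <;> nlinarith

theorem convex_strip (ρ : ℝ) : Convex ℝ (strip d n ρ) := by
  intro x hx y hy a b ha hb hab j
  have h1 := abs_le.mp (hx j)
  have h2 := abs_le.mp (hy j)
  simp only [Pi.add_apply, Pi.smul_apply, Complex.add_im, Complex.smul_im, smul_eq_mul]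
  refine abs_le.mpr ⟨?_, ?_⟩ <;> nlinarith

theorem openStrip_subset_strip (ρ : ℝ) : openStrip d n ρ ⊆ strip d n ρ :=
  fun _ h j => (h j).le

theorem strip_subset_openStrip {ρ ρ' : ℝ} (h : ρ < ρ') : strip d n ρ ⊆ openStrip d n ρ' :=
  fun _ hθ j => (hθ j).trans_lt h

theorem openStrip_mono {ρ ρ' : ℝ} (h : ρ ≤ ρ') : openStrip d n ρ ⊆ openStrip d n ρ' :=
  fun _ hθ j => (hθ j).trans_le h

theorem toC_mem_openStrip {ρ : ℝ} (hρ : 0 < ρ) (t : AngleIdx d n → ℝ) :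
    toC t ∈ openStrip d n ρ := fun j => by simpa [toC] using hρ

theorem toC_mem_strip {ρ : ℝ} (hρ : 0 ≤ ρ) (t : AngleIdx d n → ℝ) :
    toC t ∈ strip d n ρ := fun j => by simpa [toC] using hρ

theorem toC_add {ι : Type*} (s t : ι → ℝ) : toC (s + t) = toC s + toC t := by
  ext j; simp [toC]

theorem continuous_toC {ι : Type*} : Continuous (toC : (ι → ℝ) → (ι → ℂ)) := by
  unfold toC; fun_prop

theorem norm_toC {ι : Type*} [Fintype ι] (t : ι → ℝ) : ‖toC t‖ = ‖t‖ := by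
  simp [Pi.norm_def, toC]

theorem add_toC_mem_openStrip {ρ : ℝ} {θ : AngleIdx d n → ℂ} (τ : AngleIdx d n → ℝ) :
    θ + toC τ ∈ openStrip d n ρ ↔ θ ∈ openStrip d n ρ := by
  simp [openStrip, toC]

theorem shift_mem_openStrip {ρ : ℝ} {θ : AngleIdx d n → ℂ} (τ : AngleIdx d n → ℝ) :
    shift τ θ ∈ openStrip d n ρ ↔ θ ∈ openStrip d n ρ := add_toC_mem_openStrip τ

theorem shift_mem_strip {ρ : ℝ} {θ : AngleIdx d n → ℂ} (τ : AngleIdx d n → ℝ) :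
    shift τ θ ∈ strip d n ρ ↔ θ ∈ strip d n ρ := by
  simp [strip, shift, toC]

theorem ball_subset_openStrip {ρ ρ' δ : ℝ} (h : ρ + δ ≤ ρ') {θ : AngleIdx d n → ℂ}
    (hθ : θ ∈ strip d n ρ) : Metric.ball θ δ ⊆ openStrip d n ρ' := by
  intro z hz j
  have h1 : ‖z j - θ j‖ < δ := (norm_le_pi_norm (z - θ) j).trans_lt (mem_ball_iff_norm.mp hz)
  have h2 : |(z j).im - (θ j).im| ≤ ‖z j - θ j‖ := by
    simpa using Complex.abs_im_le_norm (z j - θ j)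
  have h3 := abs_sub_abs_le_abs_sub (z j).im (θ j).im
  have := hθ j
  linarith

/-- The real torus is a set of uniqueness for holomorphic functions on the strip. -/
theorem eqOn_zero_of_real {ρ : ℝ} {g : (AngleIdx d n → ℂ) → ℂ}
    (hg : DifferentiableOn ℂ g (openStrip d n ρ)) (h0 : ∀ t : AngleIdx d n → ℝ, g (toC t) = 0)
    {θ : AngleIdx d n → ℂ} (hθ : θ ∈ openStrip d n ρ) : g θ = 0 := by
  set a : AngleIdx d n → ℝ := fun j => (θ j).re
  set b : AngleIdx d n → ℝ := fun j => (θ j).im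
  have hθab : θ = toC a + Complex.I • toC b := by
    ext j
    simp [a, b, toC, mul_comm Complex.I, Complex.re_add_im]
  set U : Set ℂ := {z | ∀ j, |z.im * b j| < ρ} with hU
  have hmap : ∀ z : ℂ, z ∈ U ↔ toC a + z • toC b ∈ openStrip d n ρ := by
    intro z; simp [hU, openStrip, toC]
  have hUo : IsOpen U := by
    have : U = (fun z : ℂ => toC a + z • toC b) ⁻¹' openStrip d n ρ := by
      ext z; exact hmap z
    rw [this]
    exact (isOpen_openStrip ρ).preimage (by fun_prop)
  have hUc : Convex ℝ U := by
    intro x hx y hy s t hs ht hst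
    rw [hmap] at hx hy ⊢
    convert! convex_openStrip ρ hx hy hs ht hst using 1
    rw [smul_add, smul_add, add_add_add_comm, ← add_smul, hst, one_smul, add_smul, smul_assoc,
      smul_assoc]
  have hd : DifferentiableOn ℂ (fun z : ℂ => g (toC a + z • toC b)) U := by
    intro z hz
    have h1 : DifferentiableAt ℂ g (toC a + z • toC b) :=
      hg.differentiableAt ((isOpen_openStrip ρ).mem_nhds ((hmap z).mp hz))
    have h2 : DifferentiableAt ℂ (fun z : ℂ => toC a + z • toC b) z := by fun_prop
    exact (h1.comp z h2).differentiableWithinAt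
  have hI : Complex.I ∈ U := by rw [hmap, ← hθab]; exact hθ
  have h0U : (0 : ℂ) ∈ U := by
    intro j
    have := hθ j
    simp only [Complex.zero_im, zero_mul, abs_zero]
    exact (abs_nonneg _).trans_lt this
  have hfreq : ∃ᶠ z : ℂ in 𝓝[≠] 0, g (toC a + z • toC b) = (0 : ℂ) := by
    have h1 : ∀ x : ℝ, g (toC a + (x : ℂ) • toC b) = 0 := by
      intro x
      have : toC a + (x : ℂ) • toC b = toC (a + x • b) := by ext j; simp [toC]
      rw [this, h0]
    have ht : Tendsto (fun x : ℝ => (x : ℂ)) (𝓝[≠] 0) (𝓝[≠] 0) := by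
      refine tendsto_nhdsWithin_iff.mpr ⟨?_, ?_⟩
      · have : Tendsto (fun x : ℝ => (x : ℂ)) (𝓝 0) (𝓝 ((0 : ℝ) : ℂ)) :=
          Complex.continuous_ofReal.tendsto 0
        simpa using this.mono_left nhdsWithin_le_nhds
      · filter_upwards [self_mem_nhdsWithin] with x hx
        simpa using hx
    exact ht.frequently (Frequently.of_forall h1)
  have := (hd.analyticOnNhd hUo).eqOn_of_preconnected_of_frequently_eq
    (g := fun _ => (0 : ℂ)) analyticOnNhd_const hUc.isPreconnected h0U hfreq hI
  simpa [← hθab] using this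

end Strip

end

/-! ### Fourier series on the torus and on complex strips -/

section

section Torus

variable {ι : Type*}

/-- The function on the torus induced by a `ℤ`-periodic function on the universal cover. -/
noncomputable def torusDescend (g : (ι → ℝ) → ℂ) (y : UnitAddTorus ι) : ℂ :=
  g fun i => Quotient.out (y i)

theorem torusDescend_coe {g : (ι → ℝ) → ℂ}
    (hg : ∀ t (l : ι → ℤ), g (fun j => t j + l j) = g t) (t : ι → ℝ) :
    torusDescend g (fun i => (t i : UnitAddCircle)) = g t := by
  have h : ∀ i, ∃ m : ℤ, Quotient.out (t i : UnitAddCircle) = t i + m := by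
    intro i
    have h1 : ((Quotient.out (t i : UnitAddCircle) : ℝ) : UnitAddCircle) = t i :=
      Quotient.out_eq _
    have h2 : ((Quotient.out (t i : UnitAddCircle) - t i : ℝ) : UnitAddCircle) = 0 := by
      rw [AddCircle.coe_sub, h1, sub_self]
    obtain ⟨m, hm⟩ := (AddCircle.coe_eq_zero_iff 1).mp h2
    refine ⟨m, ?_⟩
    simp at hm
    linarith
  choose m hm using h
  unfold torusDescend
  simp_rw [hm]
  exact hg t m

theorem continuous_torusDescend {g : (ι → ℝ) → ℂ} (hc : Continuous g)
    (hg : ∀ t (l : ι → ℤ), g (fun j => t j + l j) = g t) : Continuous (torusDescend g) := by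
  have hq : IsOpenQuotientMap (Pi.map fun (_ : ι) (x : ℝ) => (x : UnitAddCircle)) :=
    IsOpenQuotientMap.piMap fun _ => QuotientAddGroup.isOpenQuotientMap_mk
  rw [hq.isQuotientMap.continuous_iff]
  have : torusDescend g ∘ (Pi.map fun (_ : ι) (x : ℝ) => (x : UnitAddCircle)) = g := by
    ext t; exact torusDescend_coe hg t
  rwa [this]

variable [Fintype ι]

/-- The character `θ ↦ exp (2πi l·θ)` of the torus, extended to complex angles. -/
noncomputable def character (l : ι → ℤ) (θ : ι → ℂ) : ℂ :=
  Complex.exp (2 * Real.pi * Complex.I * ∑ j, (l j : ℂ) * θ j)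

theorem setIntegral_Ioc_eq_Icc (f : (ι → ℝ) → ℂ) (a : ι → ℝ) :
    ∫ x in {x : ι → ℝ | ∀ i, x i ∈ Ioc (a i) (a i + 1)}, f x = ∫ x in Icc a (a + 1), f x := by
  have h := Measure.univ_pi_Ioc_ae_eq_Icc (μ := fun _ : ι => (volume : Measure ℝ))
    (f := a) (g := a + 1)
  have h2 : {x : ι → ℝ | ∀ i, x i ∈ Ioc (a i) (a i + 1)} =
      (Set.univ.pi fun i => Set.Ioc (a i) ((a + 1) i)) := by
    ext x; simp [Set.mem_pi]
  rw [h2]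
  exact setIntegral_congr_set h

/-- The mean value of a periodic function over the torus is invariant under translations. -/
theorem integral_translate_of_periodic {g : (ι → ℝ) → ℂ}
    (hg : ∀ t (l : ι → ℤ), g (fun j => t j + l j) = g t) (a : ι → ℝ) :
    ∫ t in Icc (0 : ι → ℝ) 1, g (t + a) = ∫ t in Icc (0 : ι → ℝ) 1, g t := by
  have h1 := UnitAddTorus.mFourierCoeff_eq_integral (torusDescend g) 0 a
  have h0 := UnitAddTorus.mFourierCoeff_eq_integral (torusDescend g) 0 0
  rw [h1] at h0
  simp only [neg_zero, UnitAddTorus.mFourier_zero, ContinuousMap.one_apply, one_smul,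
    torusDescend_coe hg] at h0
  rw [setIntegral_Ioc_eq_Icc, setIntegral_Ioc_eq_Icc, zero_add] at h0
  rw [← h0]
  have hmp : MeasurePreserving (fun t : ι → ℝ => t + a) volume volume :=
    measurePreserving_add_right volume a
  have hpre := hmp.setIntegral_preimage_emb (MeasurableEquiv.addRight a).measurableEmbedding g
    (Icc a (a + 1))
  rw [← hpre]
  congr 2
  ext t
  simp [add_comm a 1]

theorem mFourier_coe (l : ι → ℤ) (t : ι → ℝ) :
    UnitAddTorus.mFourier l (fun i => (t i : UnitAddCircle)) = character l (toC t) := by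
  simp only [UnitAddTorus.mFourier, ContinuousMap.coe_mk, fourier_coe_apply, character, toC]
  rw [← Complex.exp_sum, Finset.mul_sum]
  congr 1
  refine Finset.sum_congr rfl fun i _ => ?_
  simp; ring

/-- Pointwise convergence of an absolutely convergent Fourier series, on the universal cover. -/
theorem hasSum_character {g : (ι → ℝ) → ℂ} (hc : Continuous g)
    (hg : ∀ t (l : ι → ℤ), g (fun j => t j + l j) = g t)
    (hs : Summable fun l : ι → ℤ => ∫ t in Icc (0 : ι → ℝ) 1, character (-l) (toC t) * g t)
    (t : ι → ℝ) :
    HasSum (fun l : ι → ℤ => (∫ t in Icc (0 : ι → ℝ) 1, character (-l) (toC t) * g t) *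
      character l (toC t)) (g t) := by
  set f : C(UnitAddTorus ι, ℂ) := ⟨torusDescend g, continuous_torusDescend hc hg⟩ with hf
  have hcoeff : ∀ l, UnitAddTorus.mFourierCoeff f l =
      ∫ t in Icc (0 : ι → ℝ) 1, character (-l) (toC t) * g t := by
    intro l
    rw [UnitAddTorus.mFourierCoeff_eq_integral f l 0, setIntegral_Ioc_eq_Icc, zero_add]
    simp only [mFourier_coe, smul_eq_mul, hf, ContinuousMap.coe_mk, torusDescend_coe hg]
  have := UnitAddTorus.hasSum_mFourier_series_apply_of_summable (f := f)
    (by simpa only [funext hcoeff] using hs) (fun i => (t i : UnitAddCircle))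
  convert this using 2 with l
  · rw [hcoeff, mFourier_coe, smul_eq_mul]
  · exact (torusDescend_coe hg t).symm

theorem character_add (l : ι → ℤ) (θ θ' : ι → ℂ) :
    character l (θ + θ') = character l θ * character l θ' := by
  rw [character, character, character, ← Complex.exp_add]
  congr 1
  simp only [Pi.add_apply, mul_add, Finset.sum_add_distrib]

theorem character_neg_mul (l : ι → ℤ) (θ : ι → ℂ) : character l θ * character (-l) θ = 1 := by
  rw [character, character, ← Complex.exp_add, ← Complex.exp_zero]
  congr 1
  simp

theorem character_int (l m : ι → ℤ) : character l (fun j => (m j : ℂ)) = 1 := by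
  rw [character]
  have : (2 * Real.pi * Complex.I * ∑ j, (l j : ℂ) * (m j : ℂ) : ℂ) =
      ((∑ j, l j * m j : ℤ) : ℂ) * (2 * Real.pi * Complex.I) := by push_cast; ring
  rw [this, Complex.exp_int_mul_two_pi_mul_I]

theorem differentiable_character (l : ι → ℤ) : Differentiable ℂ (character l) := by
  unfold character; fun_prop

theorem norm_character (l : ι → ℤ) (θ : ι → ℂ) :
    ‖character l θ‖ = Real.exp (-(2 * Real.pi * ∑ j, (l j : ℝ) * (θ j).im)) := by
  rw [character, Complex.norm_exp]
  congr 1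
  have : (2 * Real.pi * Complex.I * ∑ j, (l j : ℂ) * θ j : ℂ) =
    ((2 * Real.pi : ℝ) : ℂ) * (Complex.I * ∑ j, (l j : ℂ) * θ j) := by push_cast; ring
  rw [this, Complex.re_ofReal_mul, Complex.I_mul_re, Complex.im_sum]
  simp [Complex.mul_im]

/-- The small divisor `exp (2πi x) - 1` is bounded below by the distance of `x` to the integers. -/
theorem abs_sub_round_le_norm_exp_sub_one (x : ℝ) :
    |x - round x| ≤ ‖Complex.exp (2 * Real.pi * Complex.I * x) - 1‖ := by
  have h1 : Complex.exp (2 * Real.pi * Complex.I * x) =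
      Complex.exp (Complex.I * ((2 * Real.pi * (x - round x) : ℝ) : ℂ)) := by
    have : (2 * Real.pi * Complex.I * x : ℂ) =
        Complex.I * ((2 * Real.pi * (x - round x) : ℝ) : ℂ) +
          (round x : ℤ) * (2 * Real.pi * Complex.I) := by push_cast; ring
    rw [this, Complex.exp_add, Complex.exp_int_mul_two_pi_mul_I, mul_one]
  rw [h1, Complex.norm_exp_I_mul_ofReal_sub_one]
  have h2 : 2 * Real.pi * (x - round x) / 2 = Real.pi * (x - round x) := by ring
  rw [h2, Real.norm_eq_abs, abs_mul, abs_two]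
  have h3 : |Real.pi * (x - round x)| ≤ Real.pi / 2 := by
    rw [abs_mul, abs_of_pos Real.pi_pos]
    nlinarith [abs_sub_round x, Real.pi_pos]
  have h4 := Real.mul_abs_le_abs_sin h3
  rw [abs_mul, abs_of_pos Real.pi_pos] at h4
  have h5 : 2 / Real.pi * (Real.pi * |x - round x|) = 2 * |x - round x| := by
    field_simp
  rw [h5] at h4
  linarith [abs_nonneg (x - round x)]

theorem summable_norm_inv_pow_int [DecidableEq ι] :
    Summable fun l : ι → ℤ => ‖(fun j => (l j : ℝ))‖⁻¹ ^ (Fintype.card ι + 1) := by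
  set b := Pi.basisFun ℝ ι
  set L := Submodule.span ℤ (Set.range b) with hL
  have hrank : Module.finrank ℤ L = Fintype.card ι := by
    rw [ZLattice.rank ℝ L, Module.finrank_fintype_fun_eq_card]
  have hs := ZLattice.summable_norm_pow_inv L (Fintype.card ι + 1) (by omega)
  have hmem : ∀ l : ι → ℤ, (fun j => (l j : ℝ)) ∈ L := by
    intro l
    have : (fun j => (l j : ℝ)) = ∑ i, l i • b i := by
      ext j; simp [b, Pi.single_apply]
    rw [this]
    exact Submodule.sum_mem _ fun i _ =>
      Submodule.smul_mem _ _ (Submodule.subset_span ⟨i, rfl⟩)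
  have hinj : Function.Injective (fun l : ι → ℤ => (⟨fun j => (l j : ℝ), hmem l⟩ : L)) := by
    intro l l' h
    ext j
    have h' : (fun j => (l j : ℝ)) = fun j => (l' j : ℝ) := congrArg Subtype.val h
    exact_mod_cast congrFun h' j
  have h1 := hs.comp_injective hinj
  exact h1

end Torus

section Strip

variable {d n : ℕ}

/-- `g` is `ℤ`-periodic in all variables on the set `S`. -/
def PeriodicOn (g : (AngleIdx d n → ℂ) → ℂ) (S : Set (AngleIdx d n → ℂ)) : Prop :=
  ∀ θ ∈ S, ∀ l : AngleIdx d n → ℤ, g (fun j => θ j + l j) = g θ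

/-- The mean value of `g` over the real torus. -/
noncomputable def torusMean (g : (AngleIdx d n → ℂ) → ℂ) : ℂ :=
  ∫ t in Icc (0 : AngleIdx d n → ℝ) 1, g (toC t)

theorem mem_openStrip_add {ρ : ℝ} {w : AngleIdx d n → ℂ} (hw : w ∈ openStrip d n ρ)
    (t : AngleIdx d n → ℝ) : toC t + w ∈ openStrip d n ρ := by
  rw [add_comm]; exact (add_toC_mem_openStrip t).mpr hw

theorem toC_mem_openStrip_of_mem {ρ : ℝ} {w : AngleIdx d n → ℂ} (hw : w ∈ openStrip d n ρ)
    (t : AngleIdx d n → ℝ) : toC t ∈ openStrip d n ρ := fun j => by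
  simpa [toC] using (abs_nonneg _).trans_lt (hw j)

theorem PeriodicOn.real {g : (AngleIdx d n → ℂ) → ℂ} {S : Set (AngleIdx d n → ℂ)}
    (hg : PeriodicOn g S) {w : AngleIdx d n → ℂ} (hw : ∀ t, toC t + w ∈ S)
    (t : AngleIdx d n → ℝ) (l : AngleIdx d n → ℤ) :
    g (toC (fun j => t j + l j) + w) = g (toC t + w) := by
  rw [← hg _ (hw t) l]
  congr 1
  ext j
  simp [toC]; ring

theorem PeriodicOn.real_zero {g : (AngleIdx d n → ℂ) → ℂ} {S : Set (AngleIdx d n → ℂ)}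
    (hg : PeriodicOn g S) (hw : ∀ t, toC t ∈ S)
    (t : AngleIdx d n → ℝ) (l : AngleIdx d n → ℤ) :
    g (toC (fun j => t j + l j)) = g (toC t) := by
  simpa using hg.real (w := 0) (by simpa using hw) t l

/-- The contour of integration in the mean value of a periodic holomorphic function can be moved
into the complex domain. -/
theorem integral_shift_contour {ρ : ℝ} {g : (AngleIdx d n → ℂ) → ℂ}
    (hg : DifferentiableOn ℂ g (openStrip d n ρ)) (hper : PeriodicOn g (openStrip d n ρ))
    {w : AngleIdx d n → ℂ} (hw : w ∈ openStrip d n ρ) :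
    ∫ t in Icc (0 : AngleIdx d n → ℝ) 1, g (toC t + w) = torusMean g := by
  have hreal : ∀ t, toC t ∈ openStrip d n ρ := toC_mem_openStrip_of_mem hw
  have hd : DifferentiableOn ℂ (fun w => (∫ t in Icc (0 : AngleIdx d n → ℝ) 1, g (toC t + w)) -
      torusMean g) (openStrip d n ρ) := by
    intro w hw
    have := differentiableAt_integral_translates (isOpen_openStrip ρ) hg
      (μ := (volume : Measure (AngleIdx d n → ℝ))) (isCompact_Icc (a := 0) (b := 1))
      (φ := toC) continuous_toC (k := fun _ => 1) continuous_const (w₀ := w)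
      (fun t _ => by rw [add_comm]; exact mem_openStrip_add hw t)
    simp only [one_mul] at this
    refine (DifferentiableAt.sub_const ?_ _).differentiableWithinAt
    simpa only [add_comm] using this
  refine sub_eq_zero.mp (eqOn_zero_of_real hd (fun a => ?_) hw)
  rw [sub_eq_zero]
  simp_rw [← toC_add]
  exact integral_translate_of_periodic (g := fun t => g (toC t)) (hper.real_zero hreal) a

theorem torusMean_shift {ρ : ℝ} (hρ : ∀ t : AngleIdx d n → ℝ, toC t ∈ openStrip d n ρ)
    {g : (AngleIdx d n → ℂ) → ℂ} (hper : PeriodicOn g (openStrip d n ρ))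
    (ω : AngleIdx d n → ℝ) : torusMean (fun θ => g (shift ω θ)) = torusMean g := by
  unfold torusMean shift
  simp_rw [← toC_add]
  exact integral_translate_of_periodic (g := fun t => g (toC t)) (hper.real_zero hρ) ω

theorem PeriodicOn.mul {g h : (AngleIdx d n → ℂ) → ℂ} {S : Set (AngleIdx d n → ℂ)}
    (hg : PeriodicOn g S) (hh : PeriodicOn h S) : PeriodicOn (fun θ => g θ * h θ) S :=
  fun θ hθ l => by simp only [hg θ hθ l, hh θ hθ l]

theorem periodicOn_character (l : AngleIdx d n → ℤ) (S : Set (AngleIdx d n → ℂ)) :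
    PeriodicOn (character l) S := fun θ _ m => by
  have : (fun j => θ j + (m j : ℂ)) = θ + fun j => (m j : ℂ) := rfl
  rw [this, character_add, character_int, mul_one]

/-- The Fourier coefficients of a function on the real torus. -/
noncomputable def fourierCoeffAt (g : (AngleIdx d n → ℂ) → ℂ) (l : AngleIdx d n → ℤ) : ℂ :=
  torusMean fun θ => character (-l) θ * g θ

/-- Exponential decay of the Fourier coefficients of a bounded holomorphic function. -/
theorem norm_fourierCoeffAt_mul_le {ρ δ E : ℝ} (hδ : 0 < δ) {g : (AngleIdx d n → ℂ) → ℂ}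
    (hg : DifferentiableOn ℂ g (openStrip d n ρ)) (hper : PeriodicOn g (openStrip d n ρ))
    (hE : ∀ θ ∈ openStrip d n ρ, ‖g θ‖ ≤ E) (l : AngleIdx d n → ℤ)
    {θ : AngleIdx d n → ℂ} (hθ : θ ∈ openStrip d n (ρ - δ)) :
    ‖fourierCoeffAt g l * character l θ‖ ≤ E * Real.exp (-(2 * Real.pi * δ * ∑ j, |(l j : ℝ)|)) := by
  -- the contour is moved by `δ` against the sign of `l`, starting from `Im θ`
  set b : AngleIdx d n → ℝ := fun j => (θ j).im - δ * SignType.sign (l j : ℝ) with hb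
  set w : AngleIdx d n → ℂ := fun j => Complex.I * b j with hw
  have hwim : ∀ j, (w j).im = b j := fun j => by simp [hw]
  have hwS : w ∈ openStrip d n ρ := by
    intro j
    rw [hwim, hb]
    have h1 := hθ j
    have h2 : |(SignType.sign (l j : ℝ) : ℝ)| ≤ 1 := by
      rcases lt_trichotomy (l j : ℝ) 0 with h | h | h
      · simp [sign_neg h]
      · simp [h]
      · simp [sign_pos h]
    calc |(θ j).im - δ * SignType.sign (l j : ℝ)|
        ≤ |(θ j).im| + |δ * SignType.sign (l j : ℝ)| := abs_sub _ _
      _ ≤ |(θ j).im| + δ * 1 := by rw [abs_mul, abs_of_pos hδ]; gcongr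
      _ < ρ := by linarith
  have hE0 : 0 ≤ E := (norm_nonneg _).trans (hE w hwS)
  have hint := integral_shift_contour (g := fun θ => character (-l) θ * g θ)
    (((differentiable_character (-l)).differentiableOn).mul hg)
    ((periodicOn_character (-l) _).mul hper) hwS
  have hbound : ‖fourierCoeffAt g l‖ ≤ Real.exp (2 * Real.pi * ∑ j, (l j : ℝ) * b j) * E := by
    rw [fourierCoeffAt, ← hint]
    refine (norm_setIntegral_le_of_norm_le_const (C := Real.exp (2 * Real.pi * ∑ j, (l j : ℝ) * b j) * E)
      (isCompact_Icc.measure_lt_top) fun t _ => ?_).trans (le_of_eq ?_)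
    · rw [norm_mul, norm_character]
      have h1 : -(2 * Real.pi * ∑ j, (((-l) j : ℤ) : ℝ) * ((toC t + w) j).im) =
          2 * Real.pi * ∑ j, (l j : ℝ) * b j := by
        simp [toC, hwim]
        ring
      rw [h1]
      gcongr
      exact hE _ (mem_openStrip_add hwS t)
    · simp [Measure.real, Real.volume_Icc_pi]
  rw [norm_mul, norm_character]
  calc ‖fourierCoeffAt g l‖ * Real.exp (-(2 * Real.pi * ∑ j, (l j : ℝ) * (θ j).im))
      ≤ (Real.exp (2 * Real.pi * ∑ j, (l j : ℝ) * b j) * E) *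
        Real.exp (-(2 * Real.pi * ∑ j, (l j : ℝ) * (θ j).im)) := by gcongr
    _ = E * (Real.exp (2 * Real.pi * ∑ j, (l j : ℝ) * b j) *
        Real.exp (-(2 * Real.pi * ∑ j, (l j : ℝ) * (θ j).im))) := by ring
    _ = E * Real.exp (-(2 * Real.pi * δ * ∑ j, |(l j : ℝ)|)) := by
      rw [← Real.exp_add]
      congr 2
      have h1 : ∀ j, (l j : ℝ) * b j = (l j : ℝ) * (θ j).im - δ * |(l j : ℝ)| := by
        intro j
        rw [hb, ← self_mul_sign (l j : ℝ)]
        ring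
      simp_rw [h1]
      rw [Finset.sum_sub_distrib, ← Finset.mul_sum]
      ring

/-- The Fourier series of a periodic holomorphic function converges on the strip, provided that it
is dominated by a summable sequence. -/
theorem hasSum_fourier_strip {ρ : ℝ} {g : (AngleIdx d n → ℂ) → ℂ}
    (hg : DifferentiableOn ℂ g (openStrip d n ρ)) (hper : PeriodicOn g (openStrip d n ρ))
    {θ : AngleIdx d n → ℂ} (hθ : θ ∈ openStrip d n ρ)
    (hs : Summable fun l => ‖fourierCoeffAt g l * character l θ‖) :
    HasSum (fun l => fourierCoeffAt g l * character l θ) (g θ) := by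
  set a : AngleIdx d n → ℝ := fun j => (θ j).re
  set w : AngleIdx d n → ℂ := fun j => Complex.I * (θ j).im
  have hθw : θ = toC a + w := by
    ext j
    simp [a, w, toC, mul_comm Complex.I, Complex.re_add_im]
  have hwS : w ∈ openStrip d n ρ := fun j => by simpa [w] using hθ j
  have hcoef : ∀ l, ∫ t in Icc (0 : AngleIdx d n → ℝ) 1, character (-l) (toC t) * g (toC t + w) =
      fourierCoeffAt g l * character l w := by
    intro l
    have hint := integral_shift_contour (g := fun θ => character (-l) θ * g θ)
      (((differentiable_character (-l)).differentiableOn).mul hg)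
      ((periodicOn_character (-l) _).mul hper) hwS
    rw [fourierCoeffAt, ← hint, ← integral_mul_const]
    refine integral_congr_ae (Eventually.of_forall fun t => ?_)
    simp only [character_add]
    linear_combination (-(character (-l) (toC t) * g (toC t + w))) * character_neg_mul l w
  have hsum : Summable fun l : AngleIdx d n → ℤ =>
      ∫ t in Icc (0 : AngleIdx d n → ℝ) 1, character (-l) (toC t) * g (toC t + w) := by
    simp_rw [hcoef]
    refine Summable.of_norm ?_
    convert hs using 2 with l
    rw [hθw, character_add, norm_mul, norm_mul, norm_mul, norm_character l (toC a)]
    simp [toC]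
  have := hasSum_character (g := fun t => g (toC t + w))
    (by
      refine hg.continuousOn.comp_continuous (continuous_toC.add continuous_const) ?_
      exact fun t => mem_openStrip_add hwS t)
    (hper.real (mem_openStrip_add hwS)) hsum a
  simp_rw [hcoef] at this
  rw [← hθw] at this
  convert this using 2 with l
  rw [hθw, character_add]; ring

end Strip

end

section

section Cohomology

variable {d n : ℕ}

theorem one_le_sum_abs_int {l : AngleIdx d n → ℤ} (hl : l ≠ 0) : 1 ≤ ∑ j, |(l j : ℝ)| := by
  obtain ⟨j, hj⟩ := Function.ne_iff.mp hl
  have h1 : (1 : ℝ) ≤ |(l j : ℝ)| := by exact_mod_cast Int.one_le_abs hj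
  exact h1.trans (Finset.single_le_sum (f := fun j => |(l j : ℝ)|)
    (fun i _ => abs_nonneg _) (Finset.mem_univ j))

/-- Exponential decay beats the polynomial growth of the small divisors. -/
theorem exp_mul_rpow_le {σ δ S : ℝ} (hδ : 0 < δ) (hS : 1 ≤ S) {p D : ℕ} (hp : σ ≤ p) :
    Real.exp (-(2 * Real.pi * δ * S)) * S ^ σ ≤
      (p + D + 1).factorial / δ ^ (p + D + 1) * (S⁻¹) ^ (D + 1) := by
  have hS0 : 0 < S := by linarith
  have h1 : S ^ σ ≤ S ^ p := by
    rw [← Real.rpow_natCast]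
    exact Real.rpow_le_rpow_of_exponent_le hS hp
  have h2 : Real.exp (-(2 * Real.pi * δ * S)) ≤ (p + D + 1).factorial / (δ * S) ^ (p + D + 1) := by
    have h3 := Real.pow_div_factorial_le_exp (δ * S) (by positivity) (p + D + 1)
    have h4 : Real.exp (δ * S) ≤ Real.exp (2 * Real.pi * δ * S) := by
      apply Real.exp_le_exp.mpr
      have : 1 ≤ 2 * Real.pi := by linarith [Real.pi_gt_three]
      have h5 : 0 < δ * S := by positivity
      nlinarith
    rw [Real.exp_neg, ← inv_div]
    exact inv_anti₀ (by positivity) (h3.trans h4)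
  calc Real.exp (-(2 * Real.pi * δ * S)) * S ^ σ
      ≤ ((p + D + 1).factorial / (δ * S) ^ (p + D + 1)) * S ^ p := by gcongr
    _ = (p + D + 1).factorial / δ ^ (p + D + 1) * (S⁻¹) ^ (D + 1) := by
      rw [mul_pow, inv_pow, add_assoc p D 1, pow_add S p (D + 1)]
      field_simp

/-- A priori estimate for the cohomological equation `ξ(θ + ω) - ξ(θ) = η(θ)` on a complex strip,
for a Diophantine rotation vector `ω`. -/
theorem exists_cohomological_bound (d n : ℕ) (σ : ℝ) :
    ∃ (C : ℝ) (k : ℕ), 0 < C ∧ ∀ (γ : ℝ) (ω : AngleIdx d n → ℝ), 0 < γ → Diophantine γ σ ω →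
      ∀ (ρ δ E : ℝ) (ξ η : (AngleIdx d n → ℂ) → ℂ), 0 < δ →
        DifferentiableOn ℂ ξ (openStrip d n ρ) → DifferentiableOn ℂ η (openStrip d n ρ) →
        PeriodicOn ξ (openStrip d n ρ) →
        (∀ θ ∈ openStrip d n ρ, ξ (shift ω θ) = ξ θ + η θ) →
        (∀ θ ∈ openStrip d n ρ, ‖η θ‖ ≤ E) →
        ∀ θ ∈ openStrip d n (ρ - δ), ‖ξ θ - torusMean ξ‖ ≤ C / (γ * δ ^ k) * E := by
  classical
  set D := Fintype.card (AngleIdx d n) with hD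
  obtain ⟨p, hp⟩ := exists_nat_ge σ
  set B : (AngleIdx d n → ℤ) → ℝ := fun l => ‖(fun j => (l j : ℝ))‖⁻¹ ^ (D + 1) with hB
  have hBs : Summable B := summable_norm_inv_pow_int
  have hB0 : ∀ l, 0 ≤ B l := fun l => by positivity
  set k := p + D + 1 with hk
  refine ⟨k.factorial * (∑' l, B l + 1), k, ?_, ?_⟩
  · have : 0 ≤ ∑' l, B l := tsum_nonneg hB0
    positivity
  intro γ ω hγ hω ρ δ E ξ η hδ hξ hη hper heq hE θ hθ
  have hθ' : θ ∈ openStrip d n ρ := openStrip_mono (by linarith) hθ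
  have hreal : ∀ t, toC t ∈ openStrip d n ρ := toC_mem_openStrip_of_mem hθ'
  have hE0 : 0 ≤ E := (norm_nonneg _).trans (hE θ hθ')
  have hηper : PeriodicOn η (openStrip d n ρ) := by
    intro w hw l
    have hwl : (fun j => w j + (l j : ℂ)) ∈ openStrip d n ρ := fun j => by simpa using hw j
    have h1 := heq _ hwl
    have h2 : shift ω (fun j => w j + (l j : ℂ)) = fun j => shift ω w j + (l j : ℂ) := by
      ext j; simp [shift]; ring
    rw [h2, hper _ ((shift_mem_openStrip ω).mpr hw), hper w hw, heq w hw] at h1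
    exact (add_left_cancel h1).symm
  -- the equation for the Fourier coefficients
  have hcoef : ∀ l, fourierCoeffAt η l = (character l (toC ω) - 1) * fourierCoeffAt ξ l := by
    intro l
    have hcd : DifferentiableOn ℂ (fun θ => character (-l) θ * ξ θ) (openStrip d n ρ) :=
      ((differentiable_character (-l)).differentiableOn).mul hξ
    have h1 := torusMean_shift hreal ((periodicOn_character (-l) _).mul hper) ω
    have h2 : ∀ t : AngleIdx d n → ℝ, character (-l) (toC t) * η (toC t) =
        character l (toC ω) * (character (-l) (shift ω (toC t)) * ξ (shift ω (toC t)))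
          - character (-l) (toC t) * ξ (toC t) := by
      intro t
      rw [shift, character_add, ← shift, heq _ (hreal t)]
      linear_combination (-(character (-l) (toC t) * (ξ (toC t) + η (toC t)))) *
        character_neg_mul l (toC ω)
    have hci : IntegrableOn (fun t => character (-l) (toC t) * ξ (toC t))
        (Icc (0 : AngleIdx d n → ℝ) 1) :=
      ((hcd.continuousOn.comp_continuous continuous_toC hreal).continuousOn).integrableOn_compact
        isCompact_Icc
    have hci2 : IntegrableOn (fun t => character l (toC ω) *
        (character (-l) (shift ω (toC t)) * ξ (shift ω (toC t))))
        (Icc (0 : AngleIdx d n → ℝ) 1) := by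
      refine ContinuousOn.integrableOn_compact isCompact_Icc ?_
      refine (continuous_const.mul (hcd.continuousOn.comp_continuous (f := fun t => shift ω (toC t))
        ?_ ?_)).continuousOn
      · exact continuous_toC.add continuous_const
      · exact fun t => (shift_mem_openStrip ω).mpr (hreal t)
    unfold fourierCoeffAt
    rw [sub_mul, one_mul]
    nth_rewrite 1 [← h1]
    unfold torusMean
    simp_rw [h2]
    rw [integral_sub hci2 hci, integral_const_mul]
  have hterm : ∀ l, l ≠ 0 → ‖fourierCoeffAt ξ l * character l θ‖ ≤
      E * (k.factorial / (γ * δ ^ k)) * B l := by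
    intro l hl
    set S := ∑ j, |(l j : ℝ)| with hS
    have hS1 : 1 ≤ S := one_le_sum_abs_int hl
    have hS0 : 0 < S := by linarith
    have hdiv : γ * S ^ (-σ) ≤ ‖character l (toC ω) - 1‖ := by
      have h1 : character l (toC ω) =
          Complex.exp (2 * Real.pi * Complex.I * ((∑ j, (l j : ℝ) * ω j : ℝ) : ℂ)) := by
        rw [character]; congr 2; simp [toC]
      rw [h1]
      exact (hω l hl _).trans (abs_sub_round_le_norm_exp_sub_one _)
    have hpos : 0 < γ * S ^ (-σ) := by positivity
    have hη' := norm_fourierCoeffAt_mul_le hδ hη hηper hE l hθ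
    rw [hcoef l, mul_assoc, norm_mul] at hη'
    have h3 : γ * S ^ (-σ) * ‖fourierCoeffAt ξ l * character l θ‖ ≤
        E * Real.exp (-(2 * Real.pi * δ * S)) :=
      (mul_le_mul_of_nonneg_right hdiv (norm_nonneg _)).trans hη'
    have h4 : ‖fourierCoeffAt ξ l * character l θ‖ ≤
        E / γ * (Real.exp (-(2 * Real.pi * δ * S)) * S ^ σ) := by
      have h5 : E / γ * (Real.exp (-(2 * Real.pi * δ * S)) * S ^ σ) =
          (E * Real.exp (-(2 * Real.pi * δ * S))) / (γ * S ^ (-σ)) := by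
        rw [Real.rpow_neg hS0.le]; field_simp
      rw [h5, le_div_iff₀ hpos]
      linarith
    have hlS : ‖(fun j => (l j : ℝ))‖ ≤ S := by
      refine (pi_norm_le_iff_of_nonneg hS0.le).mpr fun j => ?_
      exact Finset.single_le_sum (f := fun j => |(l j : ℝ)|)
        (fun i _ => abs_nonneg _) (Finset.mem_univ j)
    have hl0 : 0 < ‖(fun j => (l j : ℝ))‖ := by
      rw [norm_pos_iff]
      intro h
      exact hl (by ext j; simpa using congrFun h j)
    calc ‖fourierCoeffAt ξ l * character l θ‖
        ≤ E / γ * (Real.exp (-(2 * Real.pi * δ * S)) * S ^ σ) := h4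
      _ ≤ E / γ * (k.factorial / δ ^ k * (S⁻¹) ^ (D + 1)) := by
          exact mul_le_mul_of_nonneg_left (exp_mul_rpow_le hδ hS1 hp) (by positivity)
      _ ≤ E / γ * (k.factorial / δ ^ k * B l) := by
          simp only [hB]
          gcongr
      _ = E * (k.factorial / (γ * δ ^ k)) * B l := by field_simp
  set f : (AngleIdx d n → ℤ) → ℂ := fun l => fourierCoeffAt ξ l * character l θ with hf
  have hupd : ∀ l, ‖Function.update f 0 0 l‖ ≤ E * (k.factorial / (γ * δ ^ k)) * B l := by
    intro l
    by_cases hl : l = 0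
    · subst hl
      simp only [Function.update_self, norm_zero]
      have := hB0 0
      positivity
    · rw [Function.update_of_ne hl]
      exact hterm l hl
  have hBs' := hBs.mul_left (E * (k.factorial / (γ * δ ^ k)))
  have hsum : Summable f := by
    have h1 : Summable (Function.update f 0 0) := Summable.of_norm_bounded hBs' hupd
    have h2 := h1.update 0 (f 0)
    simpa using h2
  have hhas := hasSum_fourier_strip hξ hper hθ' hsum.norm
  have h1 := (hhas.update 0 0).norm_le_of_bounded hBs'.hasSum hupd
  have h0 : fourierCoeffAt ξ 0 * character 0 θ = torusMean ξ := by
    simp [fourierCoeffAt, character]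
  rw [h0, zero_sub, neg_add_eq_sub, tsum_mul_left] at h1
  refine h1.trans ?_
  have h2 : k.factorial * (∑' l, B l + 1) / (γ * δ ^ k) * E =
    E * (k.factorial / (γ * δ ^ k)) * ∑' l, B l + E * (k.factorial / (γ * δ ^ k)) := by ring
  rw [h2]
  have : 0 ≤ E * (k.factorial / (γ * δ ^ k)) := by positivity
  linarith

/-- A holomorphic periodic function invariant under a Diophantine rotation is constant. -/
theorem eq_torusMean_of_invariant {γ σ ρ : ℝ} {ω : AngleIdx d n → ℝ} (hγ : 0 < γ)
    (hω : Diophantine γ σ ω) {ξ : (AngleIdx d n → ℂ) → ℂ}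
    (hξ : DifferentiableOn ℂ ξ (openStrip d n ρ)) (hper : PeriodicOn ξ (openStrip d n ρ))
    (hinv : ∀ θ ∈ openStrip d n ρ, ξ (shift ω θ) = ξ θ) (hρ : 0 < ρ) {θ : AngleIdx d n → ℂ}
    (hθ : θ ∈ openStrip d n ρ) : ξ θ = torusMean ξ := by
  obtain ⟨C, k, -, h⟩ := exists_cohomological_bound d n σ
  refine sub_eq_zero.mp (eqOn_zero_of_real (g := fun θ => ξ θ - torusMean ξ)
    (hξ.sub_const _) (fun t => ?_) hθ)
  have := h γ ω hγ hω ρ (ρ / 2) 0 ξ 0 (by positivity) hξ (differentiableOn_const 0) hper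
    (fun θ hθ => by simpa using hinv θ hθ) (fun θ _ => by simp) (toC t)
    (toC_mem_openStrip (by linarith) t)
  simpa using this

end Cohomology

/-! ### A Harnack inequality for nonvanishing holomorphic functions -/

/-- Harnack's inequality: if `h` has no zeros and `‖h‖ ≤ C` on a disc, then `log (C / ‖h‖)` is a
positive harmonic function, and so `h` cannot be much smaller than its value at the centre. -/
theorem harnack_disc {h : ℂ → ℂ} {R C : ℝ} (hR : 0 < R)
    (hh : DifferentiableOn ℂ h (Metric.ball 0 R)) (h0 : ∀ z ∈ Metric.ball (0 : ℂ) R, h z ≠ 0)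
    (hC : ∀ z ∈ Metric.ball (0 : ℂ) R, ‖h z‖ ≤ C) {z : ℂ} (hz : ‖z‖ ≤ R / 2) :
    ‖h 0‖ ^ 3 / (4 * C ^ 2) ≤ ‖h z‖ := by
  have h0R : (0 : ℂ) ∈ Metric.ball (0 : ℂ) R := Metric.mem_ball_self hR
  have hzR : z ∈ Metric.ball (0 : ℂ) R := by
    rw [mem_ball_zero_iff]; linarith
  have hh0 : 0 < ‖h 0‖ := norm_pos_iff.mpr (h0 0 h0R)
  have hCpos : 0 < C := hh0.trans_le (hC 0 h0R)
  -- a holomorphic logarithm of `h / h 0`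
  have hlog : DifferentiableOn ℂ (fun z => deriv h z / h z) (Metric.ball 0 R) :=
    (hh.deriv Metric.isOpen_ball).div hh h0
  obtain ⟨L, hL0, hL⟩ := (hlog.isExactOn_ball).with_val_at 0 0
  have hLd : DifferentiableOn ℂ L (Metric.ball 0 R) := fun z hz =>
    (hL z hz).differentiableAt.differentiableWithinAt
  have hexp : ∀ z ∈ Metric.ball (0 : ℂ) R, h z = h 0 * Complex.exp (L z) := by
    have hconst : ∀ z ∈ Metric.ball (0 : ℂ) R,
        HasDerivAt (fun z => h z * Complex.exp (-L z)) 0 z := by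
      intro z hz
      have h1 := (hh.differentiableAt (Metric.isOpen_ball.mem_nhds hz)).hasDerivAt
      have h2 := ((hL z hz).neg).cexp
      convert! h1.mul h2 using 1
      have := h0 z hz
      field_simp
      ring
    intro z hz
    have h1 := (convex_ball (0 : ℂ) R).is_const_of_fderivWithin_eq_zero (𝕜 := ℂ)
      (f := fun z => h z * Complex.exp (-L z))
      (fun z hz => (hconst z hz).differentiableAt.differentiableWithinAt)
      (fun z hz => by
        rw [fderivWithin_of_isOpen Metric.isOpen_ball hz]
        ext
        simpa using (hconst z hz).deriv) hz h0R
    simp only [hL0, neg_zero, Complex.exp_zero, mul_one] at h1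
    rw [← h1, mul_assoc, ← Complex.exp_add]
    simp
  set M := Real.log (2 * C / ‖h 0‖) with hM
  have hMpos : 0 < M := by
    apply Real.log_pos
    rw [lt_div_iff₀ hh0]
    linarith [hC 0 h0R]
  have hmaps : Set.MapsTo L (Metric.ball 0 R) {z | z.re ≤ M} := by
    intro z hz
    have h1 := hC z hz
    rw [hexp z hz, norm_mul, Complex.norm_exp] at h1
    show (L z).re ≤ M
    rw [hM, Real.le_log_iff_exp_le (by positivity), le_div_iff₀ hh0]
    linarith
  have key := Complex.borelCaratheodory_zero hMpos hLd hmaps hR hzR hL0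
  have hkey : ‖L z‖ ≤ 2 * M := by
    refine key.trans ?_
    rw [div_le_iff₀ (by linarith)]
    nlinarith [norm_nonneg z]
  have hre : -(2 * M) ≤ (L z).re := by
    have := (Complex.abs_re_le_norm (L z)).trans hkey
    exact (abs_le.mp this).1
  rw [hexp z hzR, norm_mul, Complex.norm_exp]
  calc ‖h 0‖ ^ 3 / (4 * C ^ 2) = ‖h 0‖ * Real.exp (-(2 * M)) := by
        rw [hM, Real.exp_neg, two_mul, Real.exp_add, Real.exp_log (by positivity)]
        field_simp
        ring
    _ ≤ ‖h 0‖ * Real.exp (L z).re := by gcongr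

/-- Harnack's inequality for holomorphic functions of several variables. -/
theorem harnack_ball {ι : Type*} [Fintype ι] {g : (ι → ℂ) → ℂ} {θ₀ θ : ι → ℂ} {R C : ℝ}
    (hR : 0 < R)
    (hg : DifferentiableOn ℂ g (Metric.ball θ₀ R)) (h0 : ∀ z ∈ Metric.ball θ₀ R, g z ≠ 0)
    (hC : ∀ z ∈ Metric.ball θ₀ R, ‖g z‖ ≤ C) (hθ : ‖θ - θ₀‖ ≤ R / 2) :
    ‖g θ₀‖ ^ 3 / (4 * C ^ 2) ≤ ‖g θ‖ := by
  set v := (2 / R : ℂ) • (θ - θ₀) with hv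
  have hRc : (R : ℂ) ≠ 0 := by exact_mod_cast hR.ne'
  have hvn : ‖v‖ ≤ 1 := by
    have h2 : ‖(2 / R : ℂ)‖ = 2 / R := by
      rw [norm_div, Complex.norm_real, Real.norm_of_nonneg hR.le]; simp
    rw [hv, norm_smul, h2]
    calc 2 / R * ‖θ - θ₀‖ ≤ 2 / R * (R / 2) := by gcongr
      _ = 1 := by field_simp
  have hmem : ∀ z ∈ Metric.ball (0 : ℂ) R, θ₀ + z • v ∈ Metric.ball θ₀ R := by
    intro z hz
    rw [mem_ball_zero_iff] at hz
    rw [mem_ball_iff_norm, add_sub_cancel_left, norm_smul]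
    nlinarith [norm_nonneg z]
  have hd : DifferentiableOn ℂ (fun z : ℂ => g (θ₀ + z • v)) (Metric.ball 0 R) := by
    intro z hz
    have h1 : DifferentiableAt ℂ g (θ₀ + z • v) :=
      hg.differentiableAt (Metric.isOpen_ball.mem_nhds (hmem z hz))
    have h2 : DifferentiableAt ℂ (fun z : ℂ => θ₀ + z • v) z := by fun_prop
    exact (h1.comp z h2).differentiableWithinAt
  have := harnack_disc hR hd (fun z hz => h0 _ (hmem z hz)) (fun z hz => hC _ (hmem z hz))
    (z := (R / 2 : ℂ)) (by
      rw [norm_div, Complex.norm_real, Real.norm_of_nonneg hR.le]; simp)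
  have h3 : θ₀ + (R / 2 : ℂ) • v = θ := by
    rw [hv, smul_smul]
    have : (R / 2 : ℂ) * (2 / R) = 1 := by field_simp
    rw [this, one_smul]; abel
  rw [h3] at this
  simpa using this

/-- Along a chain of balls Harnack's inequality gives a lower bound on the whole smaller strip. -/
theorem exists_lower_bound_of_nonvanishing (d n : ℕ) {ρ ρ' C c₀ : ℝ} (hρ' : 0 ≤ ρ') (hρ : ρ' < ρ)
    (hC : 0 < C) (hc₀ : 0 < c₀) :
    ∃ c : ℝ, 0 < c ∧ ∀ g : (AngleIdx d n → ℂ) → ℂ, DifferentiableOn ℂ g (openStrip d n ρ) →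
      PeriodicOn g (openStrip d n ρ) → (∀ θ ∈ openStrip d n ρ, g θ ≠ 0) →
      (∀ θ ∈ openStrip d n ρ, ‖g θ‖ ≤ C) → (∃ t : AngleIdx d n → ℝ, c₀ ≤ ‖g (toC t)‖) →
      ∀ θ ∈ strip d n ρ', c ≤ ‖g θ‖ := by
  set R := ρ - ρ' with hR
  have hR0 : 0 < R := by linarith
  obtain ⟨N, hN⟩ := exists_nat_ge (2 * (2 + ρ') / R)
  set b : ℕ → ℝ := fun k => (fun x => x ^ 3 / (4 * C ^ 2))^[k] c₀ with hb
  have hb0 : ∀ k, 0 < b k := by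
    intro k
    induction k with
    | zero => simpa [hb] using hc₀
    | succ k ih =>
      simp only [hb, Function.iterate_succ_apply']
      simp only [hb] at ih
      positivity
  refine ⟨b (N + 1), hb0 _, ?_⟩
  rintro g hg hper h0 hgC ⟨t, ht⟩ θ hθ
  -- move `θ` by an integer vector close to `t`
  set l : AngleIdx d n → ℤ := fun j => round (t j - (θ j).re) with hl
  set θ' : AngleIdx d n → ℂ := fun j => θ j + l j with hθ'
  have hθ'S : θ' ∈ strip d n ρ' := fun j => by simpa [hθ'] using hθ j
  rw [← hper θ (strip_subset_openStrip hρ hθ) l]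
  have hdist : ‖θ' - toC t‖ ≤ 2 + ρ' := by
    refine (pi_norm_le_iff_of_nonneg (by linarith)).mpr fun j => ?_
    refine (Complex.norm_le_abs_re_add_abs_im _).trans ?_
    have h1 : |((θ' - toC t) j).re| ≤ 2 := by
      have h2 := abs_sub_round (t j - (θ j).re)
      simp only [hθ', hl, toC, Pi.sub_apply, Complex.sub_re, Complex.add_re, Complex.intCast_re,
        Complex.ofReal_re]
      rw [abs_le] at h2 ⊢
      constructor <;> linarith
    have h2 : |((θ' - toC t) j).im| ≤ ρ' := by simpa [hθ', toC] using hθ j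
    linarith
  have hmain : ∀ k : ℕ, k ≤ N + 1 →
      b k ≤ ‖g (toC t + ((k : ℝ) / (N + 1 : ℝ)) • (θ' - toC t))‖ := by
    intro k
    induction k with
    | zero => intro _; simpa [hb] using ht
    | succ k ih =>
      intro hk
      have ihk := ih (by omega)
      set x := toC t + ((k : ℝ) / (N + 1 : ℝ)) • (θ' - toC t) with hx
      set y := toC t + (((k + 1 : ℕ) : ℝ) / (N + 1 : ℝ)) • (θ' - toC t) with hy
      have hxS : x ∈ strip d n ρ' := by
        refine (convex_strip ρ').add_smul_sub_mem (toC_mem_strip hρ' t) hθ'S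
          ⟨by positivity, ?_⟩
        rw [div_le_one (by positivity)]
        exact_mod_cast (by omega : k ≤ N + 1)
      have hball : Metric.ball x R ⊆ openStrip d n ρ :=
        ball_subset_openStrip (by rw [hR]; linarith) hxS
      have hxy : ‖y - x‖ ≤ R / 2 := by
        have h1 : y - x = (1 / (N + 1 : ℝ)) • (θ' - toC t) := by
          rw [hx, hy, add_sub_add_left_eq_sub, ← sub_smul]
          congr 1
          push_cast; ring
        rw [h1, norm_smul, Real.norm_of_nonneg (by positivity)]
        calc 1 / (N + 1 : ℝ) * ‖θ' - toC t‖ ≤ 1 / (N + 1 : ℝ) * (2 + ρ') := by gcongr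
          _ ≤ R / 2 := by
            rw [div_le_iff₀ hR0] at hN
            rw [div_mul_eq_mul_div, div_le_iff₀ (by positivity)]
            nlinarith
      have h3 := harnack_ball hR0 (hg.mono hball) (fun z hz => h0 z (hball hz))
        (fun z hz => hgC z (hball hz)) hxy
      refine le_trans ?_ h3
      simp only [hb, Function.iterate_succ_apply']
      have := (hb0 k).le
      simp only [hb] at ihk this
      gcongr
  have := hmain (N + 1) le_rfl
  have h1 : (((N + 1 : ℕ) : ℝ) / (N + 1 : ℝ)) = 1 := by
    push_cast; field_simp
  rw [h1, one_smul, add_sub_cancel] at this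
  exact this

end

/-! ### Integer translations and Jacobian matrices -/

section

/-- Integer vectors which stay close to a continuous function on a connected set are constant. -/
theorem int_eq_of_norm_sub_lt {X κ : Type*} [TopologicalSpace X] [Fintype κ] {S : Set X}
    (hS : IsPreconnected S) {g : X → κ → ℂ} (hg : ContinuousOn g S) {k : X → κ → ℤ}
    (hk : ∀ x ∈ S, ‖g x - fun j => (k x j : ℂ)‖ < 1 / 4) {x y : X} (hx : x ∈ S) (hy : y ∈ S) :
    k x = k y := by
  have hcont : ContinuousOn k S := by
    intro x hx
    have h1 : ∀ᶠ y in 𝓝[S] x, ‖g y - g x‖ < 1 / 4 := by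
      have := (hg x hx).sub (continuousWithinAt_const (b := g x))
      have h2 := this.norm
      exact h2.eventually (gt_mem_nhds (by simp))
    refine (tendsto_const_nhds (x := k x)).congr' ?_
    filter_upwards [h1, self_mem_nhdsWithin] with y hy hyS
    ext j
    have h3 := (norm_le_pi_norm (g y - fun j => (k y j : ℂ)) j).trans_lt (hk y hyS)
    have h4 := (norm_le_pi_norm (g x - fun j => (k x j : ℂ)) j).trans_lt (hk x hx)
    have h5 := (norm_le_pi_norm (g y - g x) j).trans_lt hy
    simp only [Pi.sub_apply] at h3 h4 h5
    have h6 : ‖((k x j - k y j : ℤ) : ℂ)‖ < 1 := by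
      have : ((k x j - k y j : ℤ) : ℂ) =
          (g y j - k y j) - (g x j - k x j) - (g y j - g x j) := by push_cast; ring
      rw [this]
      calc _ ≤ ‖g y j - k y j‖ + ‖g x j - k x j‖ + ‖g y j - g x j‖ :=
            (norm_sub_le _ _).trans (by gcongr; exact norm_sub_le _ _)
        _ < 1 := by linarith
    rw [Complex.norm_intCast] at h6
    have h7 : |k x j - k y j| < 1 := by exact_mod_cast h6
    have := Int.abs_lt_one_iff.mp h7
    omega
  exact hS.constant_of_mapsTo (T := Set.univ) (isDiscrete_univ_iff.mpr inferInstance) hcont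
    (mapsTo_univ _ _) hx hy

theorem eq_of_int_norm_lt_one {κ : Type*} [Fintype κ] {k : κ → ℤ}
    (h : ‖(fun j => (k j : ℂ))‖ < 1) : k = 0 := by
  ext j
  have h6 := (norm_le_pi_norm (fun j => (k j : ℂ)) j).trans_lt h
  simp only [Complex.norm_intCast] at h6
  exact Int.abs_lt_one_iff.mp (by exact_mod_cast h6)

section Jac

variable {𝕜 : Type*} [NontriviallyNormedField 𝕜] {ι κ μ : Type*} [Fintype ι] [DecidableEq ι]
  [Fintype κ] [Fintype μ]

theorem jac_apply (g : (ι → 𝕜) → (κ → 𝕜)) (u : ι → 𝕜) (i : κ) (j : ι) :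
    jac 𝕜 g u i j = fderiv 𝕜 g u (Pi.single j 1) i := rfl

theorem jac_mulVec (g : (ι → 𝕜) → (κ → 𝕜)) (u v : ι → 𝕜) :
    jac 𝕜 g u *ᵥ v = fderiv 𝕜 g u v := by
  ext i
  have h : v = ∑ j, v j • Pi.single j (1 : 𝕜) := by
    ext k; simp [Finset.sum_apply, Pi.single_apply]
  conv_rhs => rw [h]
  simp only [map_sum, map_smul, Finset.sum_apply, Pi.smul_apply, smul_eq_mul, mulVec, dotProduct,
    jac_apply]
  exact Finset.sum_congr rfl fun j _ => mul_comm _ _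

theorem jac_comp [DecidableEq κ] {g : (κ → 𝕜) → (μ → 𝕜)} {f : (ι → 𝕜) → (κ → 𝕜)} {u : ι → 𝕜}
    (hg : DifferentiableAt 𝕜 g (f u)) (hf : DifferentiableAt 𝕜 f u) :
    jac 𝕜 (fun x => g (f x)) u = jac 𝕜 g (f u) * jac 𝕜 f u := by
  ext i j
  have h := fderiv_comp u hg hf
  rw [jac_apply]
  have h2 : (fun x => g (f x)) = g ∘ f := rfl
  rw [h2, h, ContinuousLinearMap.comp_apply, ← jac_mulVec]
  rfl

theorem jac_congr_of_eventuallyEq_add {g h : (ι → 𝕜) → (κ → 𝕜)} {u : ι → 𝕜} {c : κ → 𝕜}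
    (hgh : g =ᶠ[𝓝 u] fun x => h x + c) : jac 𝕜 g u = jac 𝕜 h u := by
  ext i j
  rw [jac_apply, jac_apply, hgh.fderiv_eq, fderiv_add_const]

theorem jac_comp_add (g : (ι → 𝕜) → (κ → 𝕜)) (u a : ι → 𝕜) :
    jac 𝕜 (fun x => g (x + a)) u = jac 𝕜 g (u + a) := by
  ext i j
  rw [jac_apply, jac_apply, fderiv_comp_add_right]

end Jac

section RealPoints

variable {ι κ : Type*} [Fintype ι] [Fintype κ]

/-- If a holomorphic map restricts, up to a constant, to a real map `h` near a real point, then `h`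
is differentiable and has the same derivative. -/
theorem hasFDerivAt_of_toC {g : (ι → ℂ) → (κ → ℂ)} {h : (ι → ℝ) → (κ → ℝ)} {t : ι → ℝ}
    {c : κ → ℝ} (hg : DifferentiableAt ℂ g (toC t))
    (hgh : ∀ᶠ s in 𝓝 t, g (toC s) = toC (h s) + toC c) :
    DifferentiableAt ℝ h t ∧ ∀ v, fderiv ℂ g (toC t) (toC v) = toC (fderiv ℝ h t v) := by
  set T : (ι → ℝ) →L[ℝ] (ι → ℂ) :=
    ContinuousLinearMap.pi fun i => Complex.ofRealCLM.comp (ContinuousLinearMap.proj i) with hT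
  set Re : (κ → ℂ) →L[ℝ] (κ → ℝ) :=
    ContinuousLinearMap.pi fun i => Complex.reCLM.comp (ContinuousLinearMap.proj i) with hRe
  have hTt : ∀ s, T s = toC s := fun s => rfl
  have hcomp : HasFDerivAt (fun s => g (toC s)) ((fderiv ℂ g (toC t)).restrictScalars ℝ ∘L T) t := by
    have h1 : HasFDerivAt g ((fderiv ℂ g (toC t)).restrictScalars ℝ) (T t) :=
      (hg.hasFDerivAt).restrictScalars ℝ
    exact h1.comp t T.hasFDerivAt
  have hh : HasFDerivAt h (Re ∘L ((fderiv ℂ g (toC t)).restrictScalars ℝ ∘L T)) t := by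
    have h2 := (Re.hasFDerivAt.comp t hcomp).sub_const c
    refine h2.congr_of_eventuallyEq ?_
    filter_upwards [hgh] with s hs
    ext i
    simp [hRe, hs, toC]
  refine ⟨hh.differentiableAt, fun v => ?_⟩
  set T' : (κ → ℝ) →L[ℝ] (κ → ℂ) :=
    ContinuousLinearMap.pi fun i => Complex.ofRealCLM.comp (ContinuousLinearMap.proj i) with hT'
  have h3 : HasFDerivAt (fun s => g (toC s)) (T' ∘L fderiv ℝ h t) t := by
    have h4 := (T'.hasFDerivAt.comp t hh.differentiableAt.hasFDerivAt).add_const (toC c)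
    exact h4.congr_of_eventuallyEq hgh
  exact congrArg (fun A : (ι → ℝ) →L[ℝ] (κ → ℂ) => A v) (hcomp.unique h3)

/-- Under the same hypotheses the complex Jacobian matrix is the complexified real one. -/
theorem jac_toC [DecidableEq ι] {g : (ι → ℂ) → (κ → ℂ)} {h : (ι → ℝ) → (κ → ℝ)} {t : ι → ℝ}
    {c : κ → ℝ} (hg : DifferentiableAt ℂ g (toC t))
    (hgh : ∀ᶠ s in 𝓝 t, g (toC s) = toC (h s) + toC c) :
    jac ℂ g (toC t) = (jac ℝ h t).map (fun x => (x : ℂ)) := by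
  ext i j
  have h1 := (hasFDerivAt_of_toC hg hgh).2 (Pi.single j 1)
  have h2 : (toC (Pi.single j 1) : ι → ℂ) = Pi.single j 1 := by
    ext k; simp only [toC, Pi.single_apply]; split_ifs <;> simp
  rw [h2] at h1
  rw [jac_apply, h1]
  rfl

end RealPoints

/-! ### Matrix functions on the torus -/

/-- A matrix function on the complex strip whose entries are holomorphic, periodic and real at real
angles. -/
structure TorusMat {d n : ℕ} (ρ : ℝ) {κ μ : Type*} (A : (AngleIdx d n → ℂ) → Matrix κ μ ℂ) :
    Prop where
  holo : ∀ i j, DifferentiableOn ℂ (fun θ => A θ i j) (openStrip d n ρ)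
  per : ∀ θ ∈ openStrip d n ρ, ∀ l : AngleIdx d n → ℤ, A (fun j => θ j + l j) = A θ
  real : ∀ t, (A (toC t)).map (starRingEnd ℂ) = A (toC t)

section TorusMat

variable {d n : ℕ} {ρ : ℝ} {κ μ ν κ' μ' : Type*}

/-- Equality of matrix functions need only be checked over the real torus. -/
theorem TorusMat.eq_of_real {A B : (AngleIdx d n → ℂ) → Matrix κ μ ℂ} (hA : TorusMat ρ A)
    (hB : TorusMat ρ B) (h : ∀ t, A (toC t) = B (toC t)) {θ : AngleIdx d n → ℂ}
    (hθ : θ ∈ openStrip d n ρ) : A θ = B θ := by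
  ext i j
  exact sub_eq_zero.mp (eqOn_zero_of_real (g := fun θ => A θ i j - B θ i j)
    ((hA.holo i j).sub (hB.holo i j)) (fun t => by simp [h t]) hθ)

theorem TorusMat.const {A : Matrix κ μ ℂ} (h : A.map (starRingEnd ℂ) = A) :
    TorusMat (d := d) (n := n) ρ fun _ => A where
  holo _ _ := differentiableOn_const _
  per _ _ _ := rfl
  real _ := h

theorem TorusMat.zero : TorusMat (d := d) (n := n) ρ fun _ => (0 : Matrix κ μ ℂ) :=
  .const (by ext; simp)

theorem TorusMat.add {A B : (AngleIdx d n → ℂ) → Matrix κ μ ℂ} (hA : TorusMat ρ A)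
    (hB : TorusMat ρ B) : TorusMat ρ fun θ => A θ + B θ where
  holo i j := (hA.holo i j).add (hB.holo i j)
  per θ hθ l := by rw [hA.per θ hθ l, hB.per θ hθ l]
  real t := by
    rw [Matrix.map_add _ (map_add _), hA.real, hB.real]

theorem TorusMat.sub {A B : (AngleIdx d n → ℂ) → Matrix κ μ ℂ} (hA : TorusMat ρ A)
    (hB : TorusMat ρ B) : TorusMat ρ fun θ => A θ - B θ where
  holo i j := (hA.holo i j).sub (hB.holo i j)
  per θ hθ l := by rw [hA.per θ hθ l, hB.per θ hθ l]
  real t := by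
    rw [Matrix.map_sub _ (map_sub _), hA.real, hB.real]

theorem TorusMat.neg {A : (AngleIdx d n → ℂ) → Matrix κ μ ℂ} (hA : TorusMat ρ A) :
    TorusMat ρ fun θ => -A θ := by
  simpa using (TorusMat.zero (κ := κ) (μ := μ)).sub hA

theorem TorusMat.mul [Fintype μ] {A : (AngleIdx d n → ℂ) → Matrix κ μ ℂ}
    {B : (AngleIdx d n → ℂ) → Matrix μ ν ℂ} (hA : TorusMat ρ A) (hB : TorusMat ρ B) :
    TorusMat ρ fun θ => A θ * B θ where
  holo i j := by
    simp only [Matrix.mul_apply]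
    exact DifferentiableOn.fun_sum fun k _ => (hA.holo i k).mul (hB.holo k j)
  per θ hθ l := by rw [hA.per θ hθ l, hB.per θ hθ l]
  real t := by rw [Matrix.map_mul, hA.real, hB.real]

theorem TorusMat.transpose {A : (AngleIdx d n → ℂ) → Matrix κ μ ℂ} (hA : TorusMat ρ A) :
    TorusMat ρ fun θ => (A θ)ᵀ where
  holo i j := hA.holo j i
  per θ hθ l := by rw [hA.per θ hθ l]
  real t := by rw [Matrix.transpose_map, hA.real]

theorem TorusMat.submatrix {A : (AngleIdx d n → ℂ) → Matrix κ μ ℂ} (hA : TorusMat ρ A)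
    (e : κ' → κ) (e' : μ' → μ) : TorusMat ρ fun θ => (A θ).submatrix e e' where
  holo i j := hA.holo (e i) (e' j)
  per θ hθ l := by rw [hA.per θ hθ l]
  real t := by rw [← Matrix.submatrix_map, hA.real]

theorem TorusMat.fromRows {A : (AngleIdx d n → ℂ) → Matrix κ μ ℂ}
    {B : (AngleIdx d n → ℂ) → Matrix κ' μ ℂ} (hA : TorusMat ρ A) (hB : TorusMat ρ B) :
    TorusMat ρ fun θ => Matrix.fromRows (A θ) (B θ) where
  holo i j := by
    rcases i with i | i
    · exact hA.holo i j
    · exact hB.holo i j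
  per θ hθ l := by rw [hA.per θ hθ l, hB.per θ hθ l]
  real t := by
    ext i j
    rcases i with i | i
    · exact congrFun (congrFun (hA.real t) i) j
    · exact congrFun (congrFun (hB.real t) i) j

theorem TorusMat.fromCols {A : (AngleIdx d n → ℂ) → Matrix κ μ ℂ}
    {B : (AngleIdx d n → ℂ) → Matrix κ μ' ℂ} (hA : TorusMat ρ A) (hB : TorusMat ρ B) :
    TorusMat ρ fun θ => Matrix.fromCols (A θ) (B θ) where
  holo i j := by
    rcases j with j | j
    · exact hA.holo i j
    · exact hB.holo i j
  per θ hθ l := by rw [hA.per θ hθ l, hB.per θ hθ l]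
  real t := by
    ext i j
    rcases j with j | j
    · exact congrFun (congrFun (hA.real t) i) j
    · exact congrFun (congrFun (hB.real t) i) j

theorem TorusMat.fromBlocks {A : (AngleIdx d n → ℂ) → Matrix κ μ ℂ}
    {B : (AngleIdx d n → ℂ) → Matrix κ μ' ℂ} {C : (AngleIdx d n → ℂ) → Matrix κ' μ ℂ}
    {D : (AngleIdx d n → ℂ) → Matrix κ' μ' ℂ} (hA : TorusMat ρ A) (hB : TorusMat ρ B)
    (hC : TorusMat ρ C) (hD : TorusMat ρ D) :
    TorusMat ρ fun θ => Matrix.fromBlocks (A θ) (B θ) (C θ) (D θ) := by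
  have := (hA.fromCols hB).fromRows (hC.fromCols hD)
  simpa only [Matrix.fromRows_fromCols_eq_fromBlocks] using this

theorem TorusMat.shift {A : (AngleIdx d n → ℂ) → Matrix κ μ ℂ} (hA : TorusMat ρ A)
    (ω : AngleIdx d n → ℝ) : TorusMat ρ fun θ => A (shift ω θ) where
  holo i j := by
    refine (hA.holo i j).comp (g := fun θ => A θ i j) (f := PresymplecticKAM.shift ω) ?_
      fun θ hθ => (shift_mem_openStrip ω).mpr hθ
    unfold PresymplecticKAM.shift; fun_prop
  per θ hθ l := by
    have h2 : PresymplecticKAM.shift ω (fun j => θ j + (l j : ℂ)) =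
        fun j => PresymplecticKAM.shift ω θ j + l j := by
      ext j; simp [PresymplecticKAM.shift]; ring
    rw [h2, hA.per _ ((shift_mem_openStrip ω).mpr hθ)]
  real t := by
    rw [PresymplecticKAM.shift, ← toC_add, hA.real]

theorem differentiableOn_det {ι : Type*} [Fintype ι] [Fintype κ] [DecidableEq κ]
    {S : Set (ι → ℂ)}
    {A : (ι → ℂ) → Matrix κ κ ℂ} (hA : ∀ i j, DifferentiableOn ℂ (fun θ => A θ i j) S) :
    DifferentiableOn ℂ (fun θ => (A θ).det) S := by
  simp only [Matrix.det_apply]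
  refine DifferentiableOn.fun_sum fun p _ => ?_
  have h : DifferentiableOn ℂ (fun θ => ∏ i, A θ (p i) i) S := fun θ hθ =>
    (HasFDerivWithinAt.finsetProd (u := Finset.univ)
      fun i _ => (hA (p i) i θ hθ).hasFDerivWithinAt).differentiableWithinAt
  exact h.const_smul _

theorem TorusMat.inv [Fintype κ] [DecidableEq κ] {A : (AngleIdx d n → ℂ) → Matrix κ κ ℂ}
    (hA : TorusMat ρ A) (hunit : ∀ θ ∈ openStrip d n ρ, IsUnit (A θ)) :
    TorusMat ρ fun θ => (A θ)⁻¹ where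
  holo i j := by
    have h1 : ∀ θ, (A θ)⁻¹ i j = ((A θ).det)⁻¹ * ((A θ).updateRow j (Pi.single i 1)).det := by
      intro θ
      rw [Matrix.inv_def, Ring.inverse_eq_inv, Matrix.smul_apply, Matrix.adjugate_apply,
        smul_eq_mul]
    simp only [h1]
    refine (DifferentiableOn.inv (differentiableOn_det hA.holo) fun θ hθ => ?_).mul
      (differentiableOn_det fun a b => ?_)
    · exact ((Matrix.isUnit_iff_isUnit_det _).mp (hunit θ hθ)).ne_zero
    · simp only [Matrix.updateRow_apply]
      split_ifs
      · exact differentiableOn_const _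
      · exact hA.holo a b
  per θ hθ l := by rw [hA.per θ hθ l]
  real t := by
    have h1 : ∀ B : Matrix κ κ ℂ, B.map (starRingEnd ℂ) = (Bᴴ)ᵀ := fun B => by
      ext; simp
    have h2 := hA.real t
    rw [h1] at h2
    rw [h1, Matrix.conjTranspose_nonsing_inv, Matrix.transpose_nonsing_inv, h2]

theorem TorusMat.periodicOn {A : (AngleIdx d n → ℂ) → Matrix κ μ ℂ} (hA : TorusMat ρ A) (i : κ)
    (j : μ) : PeriodicOn (fun θ => A θ i j) (openStrip d n ρ) :=
  fun θ hθ l => by simp only [hA.per θ hθ l]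

theorem TorusMat.ofReal_re {A : (AngleIdx d n → ℂ) → Matrix κ μ ℂ} (hA : TorusMat ρ A) (i : κ)
    (j : μ) (t : AngleIdx d n → ℝ) : ((A (toC t) i j).re : ℂ) = A (toC t) i j :=
  Complex.conj_eq_iff_re.mp (congrFun (congrFun (hA.real t) i) j)

end TorusMat

/-! ### Entrywise bounds for matrices -/

section EntriesLE

variable {κ μ ν : Type*} {A : Matrix κ μ ℂ} {a : ℝ}

theorem EntriesLE.mono {b : ℝ} (hA : EntriesLE A a) (hab : a ≤ b) : EntriesLE A b :=
  fun i j => (hA i j).trans hab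

theorem EntriesLE.abs (hA : EntriesLE A a) : EntriesLE A |a| := hA.mono (le_abs_self a)

theorem EntriesLE.mul [Fintype μ] {B : Matrix μ ν ℂ} {b : ℝ} (hA : EntriesLE A a)
    (hB : EntriesLE B b) : EntriesLE (A * B) (Fintype.card μ * (|a| * |b|)) := by
  intro i j
  rw [Matrix.mul_apply]
  refine (norm_sum_le _ _).trans ?_
  refine (Finset.sum_le_card_nsmul _ _ (|a| * |b|) fun k _ => ?_).trans (by simp)
  rw [norm_mul]
  exact mul_le_mul (hA.abs i k) (hB.abs k j) (norm_nonneg _) (abs_nonneg _)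

theorem EntriesLE.norm_mulVec_le [Fintype κ] [Fintype μ] {v : μ → ℂ} (hA : EntriesLE A a) :
    ‖A *ᵥ v‖ ≤ Fintype.card μ * |a| * ‖v‖ := by
  refine (pi_norm_le_iff_of_nonneg (by positivity)).mpr fun i => ?_
  refine (norm_sum_le _ _).trans ?_
  refine (Finset.sum_le_card_nsmul _ _ (|a| * ‖v‖) fun k _ => ?_).trans
    (by simp [mul_assoc])
  rw [norm_mul]
  exact mul_le_mul (hA.abs i k) (norm_le_pi_norm v k) (norm_nonneg _) (abs_nonneg _)

theorem EntriesLE.transpose (hA : EntriesLE A a) : EntriesLE Aᵀ a := fun i j => hA j i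

theorem EntriesLE.sub {B : Matrix κ μ ℂ} {b : ℝ} (hA : EntriesLE A a) (hB : EntriesLE B b) :
    EntriesLE (A - B) (a + b) := fun i j =>
  (norm_sub_le _ _).trans (add_le_add (hA i j) (hB i j))

theorem EntriesLE.neg (hA : EntriesLE A a) : EntriesLE (-A) a := fun i j => by
  simpa using hA i j

theorem EntriesLE.submatrix {κ' μ' : Type*} (hA : EntriesLE A a) (e : κ' → κ) (e' : μ' → μ) :
    EntriesLE (A.submatrix e e') a := fun i j => hA (e i) (e' j)

theorem EntriesLE.zero : EntriesLE (0 : Matrix κ μ ℂ) 0 := fun i j => by simp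

theorem EntriesLE.fromRows {κ' : Type*} {B : Matrix κ' μ ℂ} {b : ℝ} (hA : EntriesLE A a)
    (hB : EntriesLE B b) : EntriesLE (Matrix.fromRows A B) (max a b) := by
  rintro (i | i) j
  · exact (hA i j).trans (le_max_left _ _)
  · exact (hB i j).trans (le_max_right _ _)

theorem EntriesLE.fromCols {μ' : Type*} {B : Matrix κ μ' ℂ} {b : ℝ} (hA : EntriesLE A a)
    (hB : EntriesLE B b) : EntriesLE (Matrix.fromCols A B) (max a b) := by
  rintro i (j | j)
  · exact (hA i j).trans (le_max_left _ _)
  · exact (hB i j).trans (le_max_right _ _)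

theorem EntriesLE.fromBlocks {κ' μ' : Type*} {B : Matrix κ μ' ℂ} {C : Matrix κ' μ ℂ}
    {D : Matrix κ' μ' ℂ} {b c e : ℝ} (hA : EntriesLE A a)
    (hB : EntriesLE B b) (hC : EntriesLE C c) (hD : EntriesLE D e) :
    EntriesLE (Matrix.fromBlocks A B C D) (max (max a b) (max c e)) := by
  rw [← Matrix.fromRows_fromCols_eq_fromBlocks]
  exact (hA.fromCols hB).fromRows (hC.fromCols hD)

theorem EntriesLE.norm_det_le [Fintype κ] [DecidableEq κ] {A : Matrix κ κ ℂ}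
    (hA : EntriesLE A a) : ‖A.det‖ ≤ (Fintype.card κ).factorial * |a| ^ Fintype.card κ := by
  have := Matrix.det_le (A := A) (abv := (IsAbsoluteValue.toAbsoluteValue (norm : ℂ → ℝ)))
    (x := |a|) (fun i j => hA.abs i j)
  simpa [nsmul_eq_mul] using this

/-- Cramer's rule: a matrix with bounded entries and determinant bounded below has a bounded
inverse. -/
theorem EntriesLE.inv [Fintype κ] [DecidableEq κ] {A : Matrix κ κ ℂ} {c : ℝ}
    (hA : EntriesLE A a) (hc : 0 < c) (hdet : c ≤ ‖A.det‖) :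
    EntriesLE A⁻¹ (c⁻¹ * ((Fintype.card κ).factorial * (max |a| 1) ^ Fintype.card κ)) := by
  intro i j
  rw [Matrix.inv_def, Ring.inverse_eq_inv, Matrix.smul_apply, Matrix.adjugate_apply,
    smul_eq_mul, norm_mul, norm_inv]
  have h1 : EntriesLE (A.updateRow j (Pi.single i 1)) (max |a| 1) := by
    intro p q
    rw [Matrix.updateRow_apply]
    split_ifs
    · refine le_trans ?_ (le_max_right _ _)
      rw [Pi.single_apply]; split_ifs <;> simp
    · exact (hA.abs p q).trans (le_max_left _ _)
  have h2 := h1.norm_det_le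
  rw [abs_of_nonneg (le_trans (abs_nonneg a) (le_max_left _ _))] at h2
  gcongr

end EntriesLE

end

/-! ### Invariant tori: periodicity, reality and the conjugated dynamics -/

section

section SameInM

variable {d n : ℕ} {𝕜 : Type*} [Ring 𝕜] {u v w : PhaseIdx d n → 𝕜}

theorem SameInM.refl (u : PhaseIdx d n → 𝕜) : SameInM u u := ⟨0, by simp, by simp⟩

theorem SameInM.symm (h : SameInM u v) : SameInM v u := by
  obtain ⟨k, hk, h⟩ := h
  exact ⟨-k, by simpa using hk, fun j => by simp [h j]⟩

theorem SameInM.trans (h : SameInM u v) (h' : SameInM v w) : SameInM u w := by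
  obtain ⟨k, hk, h⟩ := h
  obtain ⟨k', hk', h'⟩ := h'
  exact ⟨k + k', fun i => by simp [hk i, hk' i], fun j => by simp [h j, h' j]; abel⟩

theorem SameInM.add_right (h : SameInM u v) (w : PhaseIdx d n → 𝕜) :
    SameInM (u + w) (v + w) := by
  obtain ⟨k, hk, h⟩ := h
  exact ⟨k, hk, fun j => by simp [h j]; abel⟩

/-- If the values of two continuous maps on a connected set represent the same points of `M`, then
the maps differ by a constant integer vector. -/
theorem exists_int_const {X : Type*} [TopologicalSpace X] {S : Set X} (hS : IsPreconnected S)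
    {g h : X → PhaseIdx d n → ℂ} (hg : ContinuousOn g S) (hh : ContinuousOn h S)
    (hgh : ∀ x ∈ S, SameInM (g x) (h x)) :
    ∃ k : PhaseIdx d n → ℤ, (∀ i : Fin d, k (Sum.inl (Sum.inr i)) = 0) ∧
      ∀ x ∈ S, g x = h x + fun j => (k j : ℂ) := by
  rcases S.eq_empty_or_nonempty with rfl | ⟨x₀, hx₀⟩
  · exact ⟨0, by simp, by simp⟩
  choose! k hk hk' using hgh
  refine ⟨k x₀, hk x₀ hx₀, fun x hx => ?_⟩
  have : k x = k x₀ := int_eq_of_norm_sub_lt hS (hg.sub hh) (k := k) (fun x hx => by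
    have : ((g - h) x - fun j => (k x j : ℂ)) = 0 := by
      ext j; simp [hk' x hx j]
    rw [this]; norm_num) hx hx₀
  ext j
  rw [hk' x hx j, this]
  rfl

end SameInM

section Jacobians

variable {ι κ : Type*} [Fintype ι] [Fintype κ] [DecidableEq ι]

theorem differentiableOn_jac {g : (ι → ℂ) → (κ → ℂ)} {U : Set (ι → ℂ)} (hU : IsOpen U)
    (hg : DifferentiableOn ℂ g U) (i : κ) (j : ι) :
    DifferentiableOn ℂ (fun z => jac ℂ g z i j) U := by
  have h1 := differentiableOn_fderiv_apply hU (differentiableOn_pi.mp hg i) (Pi.single j 1)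
  refine h1.congr fun z hz => ?_
  have h2 : DifferentiableAt ℂ g z := hg.differentiableAt (hU.mem_nhds hz)
  rw [jac_apply]
  have h3 := (hasFDerivAt_pi'.mp h2.hasFDerivAt i).fderiv
  rw [h3]; rfl

end Jacobians

variable {d n : ℕ}

/-- The part of the hypotheses that concerns a single non-degenerate invariant torus `K`. -/
structure TorusHyp (γ σ ρ r Cf CDK CN CJ : ℝ) (ω : AngleIdx d n → ℝ)
    (J : (PhaseIdx d n → ℝ) → Matrix (Fin d ⊕ Fin d) (Fin d ⊕ Fin d) ℝ)
    (Jc : (PhaseIdx d n → ℂ) → Matrix (Fin d ⊕ Fin d) (Fin d ⊕ Fin d) ℂ)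
    (f : (PhaseIdx d n → ℝ) → (PhaseIdx d n → ℝ))
    (F : (PhaseIdx d n → ℂ) → (PhaseIdx d n → ℂ))
    (K : (AngleIdx d n → ℂ) → (PhaseIdx d n → ℂ)) : Prop where
  ρ_pos : 0 < ρ
  r_pos : 0 < r
  γ_pos : 0 < γ
  dioph : Diophantine γ σ ω
  form : IsExactPresymplectic J
  map : IsPresymplecticDiffeo J f
  torus : IsTorusMap ρ K
  extJ : ExtendsForm J Jc (nbhd ρ r K) CJ
  extF : ExtendsMap f F (nbhd ρ r K) Cf
  nondeg : IsNondegenerate Jc K ρ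
  inv : IsInvariantTorus F ω K ρ
  DK_le : ∀ θ ∈ openStrip d n ρ, EntriesLE (jac ℂ K θ) CDK
  N_le : ∀ θ ∈ openStrip d n ρ, EntriesLE (matN K θ) CN

section Nbhd

variable {ρ r : ℝ} {K : (AngleIdx d n → ℂ) → (PhaseIdx d n → ℂ)}

theorem ball_subset_nbhd {θ : AngleIdx d n → ℂ} (hθ : θ ∈ strip d n ρ)
    {w : PhaseIdx d n → ℂ} (hw : SameInM w (K θ)) : Metric.ball w r ⊆ nbhd ρ r K :=
  fun _ hz => ⟨θ, hθ, w, hw, mem_ball_iff_norm.mp hz⟩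

theorem isOpen_nbhd : IsOpen (nbhd ρ r K) := by
  rw [Metric.isOpen_iff]
  rintro z ⟨θ, hθ, w, hw, hzw⟩
  refine ⟨r - ‖z - w‖, by linarith, fun z' hz' => ⟨θ, hθ, w, hw, ?_⟩⟩
  rw [mem_ball_iff_norm] at hz'
  calc ‖z' - w‖ = ‖(z' - z) + (z - w)‖ := by congr 1; abel
    _ ≤ ‖z' - z‖ + ‖z - w‖ := norm_add_le _ _
    _ < r := by linarith

theorem SameInM.mem_nbhd {z z' : PhaseIdx d n → ℂ} (h : SameInM z' z) (hz : z ∈ nbhd ρ r K) :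
    z' ∈ nbhd ρ r K := by
  obtain ⟨θ, hθ, w, hw, hzw⟩ := hz
  refine ⟨θ, hθ, w + (z' - z), ?_, ?_⟩
  · refine SameInM.trans ?_ hw
    have h1 := h.add_right (w - z)
    convert h1 using 1 <;> abel
  · convert hzw using 2; abel

theorem mem_nbhd_self (hr : 0 < r) {θ : AngleIdx d n → ℂ} (hθ : θ ∈ strip d n ρ) :
    K θ ∈ nbhd ρ r K :=
  ball_subset_nbhd hθ (SameInM.refl _) (Metric.mem_ball_self hr)

end Nbhd

theorem tildeJ_map (A : Matrix (Fin d ⊕ Fin d) (Fin d ⊕ Fin d) ℝ) :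
    (tildeJ (A.map fun t => (t : ℂ)) : Matrix (PhaseIdx d n) (PhaseIdx d n) ℂ) =
      (tildeJ A : Matrix (PhaseIdx d n) (PhaseIdx d n) ℝ).map fun t => (t : ℂ) := by
  unfold tildeJ
  rw [Matrix.fromBlocks_map]
  simp

theorem add_int_mem_strip {ρ : ℝ} {θ : AngleIdx d n → ℂ} (hθ : θ ∈ strip d n ρ)
    (l : AngleIdx d n → ℤ) : (fun j => θ j + (l j : ℂ)) ∈ strip d n ρ :=
  fun j => by simpa using hθ j

theorem add_int_mem_openStrip {ρ : ℝ} {θ : AngleIdx d n → ℂ} (hθ : θ ∈ openStrip d n ρ)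
    (l : AngleIdx d n → ℤ) : (fun j => θ j + (l j : ℂ)) ∈ openStrip d n ρ :=
  fun j => by simpa using hθ j

/-- The displacement of a torus under a deck transformation is a constant integer vector. -/
theorem IsTorusMap.exists_period {ρ : ℝ} {K : (AngleIdx d n → ℂ) → (PhaseIdx d n → ℂ)}
    (hK : IsTorusMap ρ K) (l : AngleIdx d n → ℤ) :
    ∃ k : PhaseIdx d n → ℤ, (∀ i : Fin d, k (Sum.inl (Sum.inr i)) = 0) ∧
      ∀ θ ∈ strip d n ρ, K (fun j => θ j + (l j : ℂ)) = K θ + fun j => (k j : ℂ) := by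
  refine exists_int_const (convex_strip ρ).isPreconnected
    (g := fun θ => K (fun j => θ j + (l j : ℂ))) ?_ hK.continuousOn
    fun θ hθ => hK.periodic θ hθ l
  exact hK.continuousOn.comp (by fun_prop) fun θ hθ => add_int_mem_strip hθ l

/-- The real torus as a map between real spaces. -/
noncomputable def realTorus (K : (AngleIdx d n → ℂ) → (PhaseIdx d n → ℂ))
    (t : AngleIdx d n → ℝ) : PhaseIdx d n → ℝ := fun j => (K (toC t) j).re

theorem IsTorusMap.toC_realTorus {ρ : ℝ} {K : (AngleIdx d n → ℂ) → (PhaseIdx d n → ℂ)}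
    (hK : IsTorusMap ρ K) (t : AngleIdx d n → ℝ) : toC (realTorus K t) = K (toC t) := by
  obtain ⟨u, hu⟩ := hK.real t
  ext j
  simp [realTorus, hu, toC]

theorem map_ofReal_map_conj {κ μ : Type*} (A : Matrix κ μ ℝ) :
    ((A.map fun t => (t : ℂ)).map (starRingEnd ℂ)) = A.map fun t => (t : ℂ) := by
  ext; simp

namespace TorusHyp

variable {γ σ ρ r Cf CDK CN CJ : ℝ} {ω : AngleIdx d n → ℝ}
  {J : (PhaseIdx d n → ℝ) → Matrix (Fin d ⊕ Fin d) (Fin d ⊕ Fin d) ℝ}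
  {Jc : (PhaseIdx d n → ℂ) → Matrix (Fin d ⊕ Fin d) (Fin d ⊕ Fin d) ℂ}
  {f : (PhaseIdx d n → ℝ) → (PhaseIdx d n → ℝ)}
  {F : (PhaseIdx d n → ℂ) → (PhaseIdx d n → ℂ)}
  {K : (AngleIdx d n → ℂ) → (PhaseIdx d n → ℂ)}

theorem differentiableAt_K (H : TorusHyp γ σ ρ r Cf CDK CN CJ ω J Jc f F K)
    {θ : AngleIdx d n → ℂ} (hθ : θ ∈ openStrip d n ρ) : DifferentiableAt ℂ K θ :=
  H.torus.holomorphic.differentiableAt ((isOpen_openStrip ρ).mem_nhds hθ)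

theorem K_mem (H : TorusHyp γ σ ρ r Cf CDK CN CJ ω J Jc f F K)
    {θ : AngleIdx d n → ℂ} (hθ : θ ∈ openStrip d n ρ) : K θ ∈ nbhd ρ r K :=
  mem_nbhd_self H.r_pos (openStrip_subset_strip ρ hθ)

theorem differentiableAt_F (H : TorusHyp γ σ ρ r Cf CDK CN CJ ω J Jc f F K)
    {z : PhaseIdx d n → ℂ} (hz : z ∈ nbhd ρ r K) : DifferentiableAt ℂ F z :=
  H.extF.holomorphic.differentiableAt (isOpen_nbhd.mem_nhds hz)

theorem jac_K_map (H : TorusHyp γ σ ρ r Cf CDK CN CJ ω J Jc f F K) (t : AngleIdx d n → ℝ) :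
    jac ℂ K (toC t) = (jac ℝ (realTorus K) t).map fun x => (x : ℂ) := by
  refine jac_toC (c := 0) (H.differentiableAt_K (toC_mem_openStrip H.ρ_pos t))
    (Eventually.of_forall fun s => ?_)
  rw [H.torus.toC_realTorus]
  ext; simp [toC]

theorem torusMat_DK (H : TorusHyp γ σ ρ r Cf CDK CN CJ ω J Jc f F K) :
    TorusMat ρ (jac ℂ K) where
  holo i j := differentiableOn_jac (isOpen_openStrip ρ) H.torus.holomorphic i j
  per θ hθ l := by
    obtain ⟨k, -, hk⟩ := H.torus.exists_period l
    have h1 := jac_comp_add (𝕜 := ℂ) K θ (fun j => (l j : ℂ))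
    have h2 : (fun j => θ j + (l j : ℂ)) = θ + fun j => (l j : ℂ) := rfl
    rw [h2, ← h1]
    refine jac_congr_of_eventuallyEq_add (c := fun j => (k j : ℂ)) ?_
    filter_upwards [(isOpen_openStrip ρ).mem_nhds hθ] with x hx
    exact hk x (openStrip_subset_strip ρ hx)
  real t := by rw [H.jac_K_map, map_ofReal_map_conj]

/-- The derivative of the extended map is invariant under integer translations. -/
theorem jac_F_eq_of_sameInM (H : TorusHyp γ σ ρ r Cf CDK CN CJ ω J Jc f F K)
    {z z' : PhaseIdx d n → ℂ} (hz : z ∈ nbhd ρ r K) (h : SameInM z' z) :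
    jac ℂ F z' = jac ℂ F z := by
  obtain ⟨ε, hε, hεU⟩ := Metric.isOpen_iff.mp isOpen_nbhd z hz
  have hsame : ∀ x, SameInM (x + (z' - z)) x := by
    intro x
    have h1 := h.add_right (x - z)
    convert h1 using 1 <;> abel
  have hFc : ContinuousOn F (nbhd ρ r K) := H.extF.holomorphic.continuousOn
  obtain ⟨k, -, hk⟩ := exists_int_const (convex_ball z ε).isPreconnected
    (g := fun x => F (x + (z' - z))) (h := F)
    (hFc.comp (by fun_prop) fun x hx => (hsame x).mem_nbhd (hεU hx)) (hFc.mono hεU)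
    (fun x hx => H.extF.descends _ ((hsame x).mem_nbhd (hεU hx)) _ (hεU hx) (hsame x))
  have h1 := jac_comp_add (𝕜 := ℂ) F z (z' - z)
  rw [add_sub_cancel] at h1
  rw [← h1]
  refine jac_congr_of_eventuallyEq_add (c := fun j => (k j : ℂ)) ?_
  filter_upwards [Metric.ball_mem_nhds z hε] with x hx
  exact hk x hx

theorem jac_F_map (H : TorusHyp γ σ ρ r Cf CDK CN CJ ω J Jc f F K) {u : PhaseIdx d n → ℝ}
    (hu : toC u ∈ nbhd ρ r K) : jac ℂ F (toC u) = (jac ℝ f u).map fun x => (x : ℂ) := by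
  have hopen : IsOpen (toC ⁻¹' nbhd ρ r K : Set (PhaseIdx d n → ℝ)) :=
    isOpen_nbhd.preimage continuous_toC
  obtain ⟨ε, hε, hεU⟩ := Metric.isOpen_iff.mp hopen u hu
  have hFc : ContinuousOn F (nbhd ρ r K) := H.extF.holomorphic.continuousOn
  have hfc : Continuous f := continuousOn_univ.mp H.map.analytic.continuousOn
  obtain ⟨k, -, hk⟩ := exists_int_const (convex_ball u ε).isPreconnected
    (g := fun x => F (toC x)) (h := fun x => toC (f x))
    (hFc.comp continuous_toC.continuousOn fun x hx => hεU hx)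
    ((continuous_toC.comp hfc).continuousOn) (fun x hx => H.extF.extends_real x (hεU hx))
  refine jac_toC (c := fun j => (k j : ℝ)) (H.differentiableAt_F hu) ?_
  filter_upwards [Metric.ball_mem_nhds u hε] with x hx
  rw [hk x hx]
  ext j; simp [toC]

theorem torusMat_P (H : TorusHyp γ σ ρ r Cf CDK CN CJ ω J Jc f F K) :
    TorusMat ρ fun θ => jac ℂ F (K θ) where
  holo i j := (differentiableOn_jac isOpen_nbhd H.extF.holomorphic i j).comp H.torus.holomorphic
    fun θ hθ => H.K_mem hθ
  per θ hθ l := H.jac_F_eq_of_sameInM (H.K_mem hθ)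
    (H.torus.periodic θ (openStrip_subset_strip ρ hθ) l)
  real t := by
    have h1 := H.K_mem (toC_mem_openStrip H.ρ_pos t)
    rw [← H.torus.toC_realTorus] at h1 ⊢
    rw [H.jac_F_map h1, map_ofReal_map_conj]

theorem Jc_map (H : TorusHyp γ σ ρ r Cf CDK CN CJ ω J Jc f F K) (t : AngleIdx d n → ℝ) :
    Jc (K (toC t)) = (J (realTorus K t)).map fun x => (x : ℂ) := by
  have h1 := H.K_mem (toC_mem_openStrip H.ρ_pos t)
  rw [← H.torus.toC_realTorus] at h1 ⊢
  exact H.extJ.extends_real _ h1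

theorem torusMat_J (H : TorusHyp γ σ ρ r Cf CDK CN CJ ω J Jc f F K) :
    TorusMat ρ fun θ => Jc (K θ) where
  holo i j := (H.extJ.holomorphic i j).comp H.torus.holomorphic fun θ hθ => H.K_mem hθ
  per θ hθ l := H.extJ.periodic _ (H.K_mem (add_int_mem_openStrip hθ l)) _ (H.K_mem hθ)
    (H.torus.periodic θ (openStrip_subset_strip ρ hθ) l)
  real t := by rw [H.Jc_map, map_ofReal_map_conj]

theorem torusMat_tildeJ (H : TorusHyp γ σ ρ r Cf CDK CN CJ ω J Jc f F K) :
    TorusMat ρ fun θ => (tildeJ (Jc (K θ)) : Matrix (PhaseIdx d n) (PhaseIdx d n) ℂ) :=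
  H.torusMat_J.fromBlocks .zero .zero .zero

theorem skew (H : TorusHyp γ σ ρ r Cf CDK CN CJ ω J Jc f F K) {θ : AngleIdx d n → ℂ}
    (hθ : θ ∈ openStrip d n ρ) : (Jc (K θ))ᵀ = -Jc (K θ) := by
  refine H.torusMat_J.transpose.eq_of_real H.torusMat_J.neg (fun t => ?_) hθ
  rw [H.Jc_map, ← Matrix.transpose_map, H.form.skew]
  ext; simp

/-- `F ∘ K` and the rotated torus differ by a constant integer vector. -/
theorem exists_conj (H : TorusHyp γ σ ρ r Cf CDK CN CJ ω J Jc f F K) :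
    ∃ k : PhaseIdx d n → ℤ, ∀ θ ∈ strip d n ρ,
      F (K θ) = K (shift ω θ) + fun j => (k j : ℂ) := by
  have h1 : ContinuousOn (fun θ => F (K θ)) (strip d n ρ) :=
    H.extF.holomorphic.continuousOn.comp H.torus.continuousOn
      fun θ hθ => mem_nbhd_self H.r_pos hθ
  have h2 : ContinuousOn (fun θ => K (shift ω θ)) (strip d n ρ) := by
    refine H.torus.continuousOn.comp ?_ fun θ hθ => (shift_mem_strip ω).mpr hθ
    unfold shift; fun_prop
  obtain ⟨k, -, hk⟩ := exists_int_const (convex_strip ρ).isPreconnected h1 h2 H.inv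
  exact ⟨k, hk⟩

theorem jac_F_mul_DK (H : TorusHyp γ σ ρ r Cf CDK CN CJ ω J Jc f F K) {θ : AngleIdx d n → ℂ}
    (hθ : θ ∈ openStrip d n ρ) : jac ℂ F (K θ) * jac ℂ K θ = jac ℂ K (shift ω θ) := by
  obtain ⟨k, hk⟩ := H.exists_conj
  rw [← jac_comp (H.differentiableAt_F (H.K_mem hθ)) (H.differentiableAt_K hθ), shift,
    ← jac_comp_add]
  refine jac_congr_of_eventuallyEq_add (c := fun j => (k j : ℂ)) ?_
  filter_upwards [(isOpen_openStrip ρ).mem_nhds hθ] with x hx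
  exact hk x (openStrip_subset_strip ρ hx)

/-- The derivative of `F` along the torus preserves the presymplectic form. -/
theorem presymplectic (H : TorusHyp γ σ ρ r Cf CDK CN CJ ω J Jc f F K) {θ : AngleIdx d n → ℂ}
    (hθ : θ ∈ openStrip d n ρ) :
    (jac ℂ F (K θ))ᵀ * tildeJ (Jc (K (shift ω θ))) * jac ℂ F (K θ) = tildeJ (Jc (K θ)) := by
  refine ((H.torusMat_P.transpose.mul (H.torusMat_tildeJ.shift ω)).mul H.torusMat_P).eq_of_real
    H.torusMat_tildeJ (fun t => ?_) hθ
  have h1 := H.K_mem (toC_mem_openStrip H.ρ_pos t)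
  rw [← H.torus.toC_realTorus] at h1
  have hsame : SameInM (realTorus K (t + ω)) (f (realTorus K t)) := by
    have h2 := H.inv (toC t) (toC_mem_strip H.ρ_pos.le t)
    have h3 := H.extF.extends_real _ h1
    rw [H.torus.toC_realTorus] at h3
    obtain ⟨k, hk, hk'⟩ := h2.symm.trans h3
    refine ⟨k, hk, fun j => ?_⟩
    have h4 := hk' j
    rw [shift, ← toC_add, ← H.torus.toC_realTorus] at h4
    simp only [toC] at h4
    exact_mod_cast h4
  rw [shift, ← toC_add, H.Jc_map, H.Jc_map, ← H.torus.toC_realTorus, H.jac_F_map h1,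
    H.form.periodic _ _ hsame, tildeJ_map, tildeJ_map, ← H.map.presymplectic (realTorus K t),
    ← Matrix.transpose_map]
  have hmap : ∀ {κ μ ν : Type} [Fintype μ] (A : Matrix κ μ ℝ) (B : Matrix μ ν ℝ),
      (A * B).map (fun x => (x : ℂ)) = A.map (fun x => (x : ℂ)) * B.map (fun x => (x : ℂ)) :=
    fun A B => Matrix.map_mul (f := Complex.ofRealHom)
  rw [hmap, hmap]

end TorusHyp

end

/-! ### Isotropy of invariant tori -/

section

/-- The derivative of a periodic function has mean value zero. -/
theorem integral_fderiv_eq_zero {ι : Type*} [Fintype ι] {g : (ι → ℝ) → ℂ} (hg : ContDiff ℝ 1 g)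
    (hper : ∀ t (l : ι → ℤ), g (fun j => t j + l j) = g t) (v : ι → ℝ) :
    ∫ t in Icc (0 : ι → ℝ) 1, fderiv ℝ g t v = 0 := by
  have hconst : (fun s : ℝ => ∫ t in Icc (0 : ι → ℝ) 1, g (t + s • v)) =
      fun _ => ∫ t in Icc (0 : ι → ℝ) 1, g t :=
    funext fun s => integral_translate_of_periodic hper (s • v)
  have hdc : Continuous fun p : (ι → ℝ) × ℝ => fderiv ℝ g (p.1 + p.2 • v) v :=
    ((hg.continuous_fderiv one_ne_zero).comp (by fun_prop)).clm_apply continuous_const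
  obtain ⟨C, hC⟩ := ((isCompact_Icc (a := (0 : ι → ℝ)) (b := 1)).prod
    (isCompact_closedBall (0 : ℝ) 1)).exists_bound_of_continuousOn hdc.continuousOn
  have hder : HasDerivAt (fun s : ℝ => ∫ t in Icc (0 : ι → ℝ) 1, g (t + s • v))
      (∫ t in Icc (0 : ι → ℝ) 1, fderiv ℝ g (t + (0 : ℝ) • v) v) 0 := by
    refine (hasDerivAt_integral_of_dominated_loc_of_deriv_le (𝕜 := ℝ)
      (F := fun s t => g (t + s • v))
      (F' := fun s t => fderiv ℝ g (t + s • v) v) (s := Metric.ball 0 1) (bound := fun _ => C)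
      (Metric.ball_mem_nhds 0 one_pos) ?_ ?_ ?_ ?_ ?_ ?_).2
    · refine Eventually.of_forall fun s => ?_
      exact (hg.continuous.comp (by fun_prop)).aestronglyMeasurable
    · exact (hg.continuous.comp (by fun_prop)).continuousOn.integrableOn_compact isCompact_Icc
    · exact (hdc.comp (by fun_prop : Continuous fun t : ι → ℝ => (t, (0 : ℝ)))).aestronglyMeasurable
    · refine (ae_restrict_iff' measurableSet_Icc).mpr (Eventually.of_forall fun t ht s hs => ?_)
      exact hC (t, s) ⟨ht, Metric.ball_subset_closedBall hs⟩
    · have : IsFiniteMeasure ((volume : Measure (ι → ℝ)).restrict (Icc 0 1)) :=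
        ⟨by simpa using isCompact_Icc.measure_lt_top⟩
      exact integrable_const _
    · refine Eventually.of_forall fun t s _ => ?_
      have h1 : HasFDerivAt g (fderiv ℝ g (t + s • v)) (t + s • v) :=
        (hg.differentiable one_ne_zero _).hasFDerivAt
      have h2 : HasDerivAt (fun s : ℝ => t + s • v) v s := by
        simpa using ((hasDerivAt_id s).smul_const v).const_add t
      exact h1.comp_hasDerivAt s h2
  rw [hconst] at hder
  have := hder.unique (hasDerivAt_const _ _)
  simpa using this

variable {d n : ℕ}

/-- Restriction of a holomorphic function to the real torus: smoothness and derivative. -/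
theorem restrict_real {ρ : ℝ} (hρ : 0 < ρ) {g : (AngleIdx d n → ℂ) → ℂ}
    (hg : DifferentiableOn ℂ g (openStrip d n ρ)) (m : ℕ) :
    ContDiff ℝ m (fun t => g (toC t)) ∧ ∀ t v, fderiv ℝ (fun t => g (toC t)) t v =
      fderiv ℂ g (toC t) (toC v) := by
  set T : (AngleIdx d n → ℝ) →L[ℝ] (AngleIdx d n → ℂ) :=
    ContinuousLinearMap.pi fun i => Complex.ofRealCLM.comp (ContinuousLinearMap.proj i) with hT
  constructor
  · have h1 : ContDiffOn ℝ m g (openStrip d n ρ) :=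
      (contDiffOn_of_differentiableOn (isOpen_openStrip ρ) hg m).restrict_scalars ℝ
    have h2 := h1.comp (T.contDiff.contDiffOn (s := univ))
      fun t _ => toC_mem_openStrip hρ t
    exact contDiffOn_univ.mp h2
  · intro t v
    have h1 : HasFDerivAt g ((fderiv ℂ g (toC t)).restrictScalars ℝ) (T t) :=
      ((hg.differentiableAt ((isOpen_openStrip ρ).mem_nhds
        (toC_mem_openStrip hρ t))).hasFDerivAt).restrictScalars ℝ
    have h2 : HasFDerivAt (fun t => g (toC t)) ((fderiv ℂ g (toC t)).restrictScalars ℝ ∘L T) t :=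
      h1.comp t T.hasFDerivAt
    rw [h2.fderiv]
    rfl

theorem toC_single {ι : Type*} [DecidableEq ι] (i : ι) :
    (toC (Pi.single i 1) : ι → ℂ) = Pi.single i 1 := by
  ext k; simp only [toC, Pi.single_apply]; split_ifs <;> simp

/-- Symmetry of the second derivatives of a holomorphic map. -/
theorem fderiv_jac_symm {ρ : ℝ} {K : (AngleIdx d n → ℂ) → (PhaseIdx d n → ℂ)}
    (hK : DifferentiableOn ℂ K (openStrip d n ρ)) {θ : AngleIdx d n → ℂ}
    (hθ : θ ∈ openStrip d n ρ) (m : PhaseIdx d n) (i j : AngleIdx d n) :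
    fderiv ℂ (fun z => jac ℂ K z m j) θ (Pi.single i 1) =
      fderiv ℂ (fun z => jac ℂ K z m i) θ (Pi.single j 1) := by
  have hKm : ContDiffOn ℂ 2 (fun z => K z m) (openStrip d n ρ) :=
    contDiffOn_of_differentiableOn (isOpen_openStrip ρ) (differentiableOn_pi.mp hK m) 2
  have hKa : ContDiffAt ℂ 2 (fun z => K z m) θ :=
    hKm.contDiffAt ((isOpen_openStrip ρ).mem_nhds hθ)
  have hsymm := hKa.isSymmSndFDerivAt (by simp)
  have hdd : DifferentiableAt ℂ (fderiv ℂ (fun z => K z m)) θ :=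
    (hKa.fderiv_right (m := 1) (by norm_num)).differentiableAt one_ne_zero
  have key : ∀ a b : AngleIdx d n, fderiv ℂ (fun z => jac ℂ K z m b) θ (Pi.single a 1) =
      fderiv ℂ (fderiv ℂ (fun z => K z m)) θ (Pi.single a 1) (Pi.single b 1) := by
    intro a b
    have h1 : (fun z => jac ℂ K z m b) =ᶠ[𝓝 θ]
        fun z => fderiv ℂ (fun z => K z m) z (Pi.single b 1) := by
      filter_upwards [(isOpen_openStrip ρ).mem_nhds hθ] with z hz
      have h2 : DifferentiableAt ℂ K z := hK.differentiableAt ((isOpen_openStrip ρ).mem_nhds hz)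
      rw [jac_apply, (hasFDerivAt_pi'.mp h2.hasFDerivAt m).fderiv]
      rfl
    rw [h1.fderiv_eq, fderiv_clm_apply hdd (differentiableAt_const _)]
    simp
  rw [key, key]
  exact hsymm _ _

namespace TorusHyp

variable {γ σ ρ r Cf CDK CN CJ : ℝ} {ω : AngleIdx d n → ℝ}
  {J : (PhaseIdx d n → ℝ) → Matrix (Fin d ⊕ Fin d) (Fin d ⊕ Fin d) ℝ}
  {Jc : (PhaseIdx d n → ℂ) → Matrix (Fin d ⊕ Fin d) (Fin d ⊕ Fin d) ℂ}
  {f : (PhaseIdx d n → ℝ) → (PhaseIdx d n → ℝ)}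
  {F : (PhaseIdx d n → ℂ) → (PhaseIdx d n → ℂ)}
  {K : (AngleIdx d n → ℂ) → (PhaseIdx d n → ℂ)}

/-- The pullback `DKᵀ J̃(K) DK` of the presymplectic form to the torus has mean value zero, because
the form is exact. -/
theorem torusMean_pullback (H : TorusHyp γ σ ρ r Cf CDK CN CJ ω J Jc f F K)
    (i j : AngleIdx d n) :
    torusMean (fun θ => ((jac ℂ K θ)ᵀ *
      (tildeJ (Jc (K θ)) : Matrix (PhaseIdx d n) (PhaseIdx d n) ℂ) * jac ℂ K θ) i j) = 0 := by
  obtain ⟨a, ha, haper, haJ⟩ := H.form.exact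
  have hDK := H.torusMat_DK
  have hkr : ContDiff ℝ 1 (realTorus K) := by
    rw [contDiff_pi]
    intro m
    have h1 := (restrict_real H.ρ_pos (differentiableOn_pi.mp H.torus.holomorphic m) 1).1
    exact Complex.reCLM.contDiff.comp h1
  have hau : ContDiff ℝ 1 fun t => a (realTorus K t) := (ha.of_le (by exact_mod_cast le_top)).comp hkr
  -- the pullback `∑ₘ aₘ(K) ∂ⱼKₘ` of the primitive
  set B : AngleIdx d n → (AngleIdx d n → ℝ) → ℂ := fun j t =>
    ∑ m, (a (realTorus K t) m : ℂ) * jac ℂ K (toC t) m j with hB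
  have hv := fun m j => restrict_real H.ρ_pos (hDK.holo m j) 1
  have hu : ∀ m, ContDiff ℝ 1 fun t => (a (realTorus K t) m : ℂ) := fun m =>
    Complex.ofRealCLM.contDiff.comp (contDiff_pi.mp hau m)
  have hBc : ∀ j, ContDiff ℝ 1 (B j) := fun j =>
    ContDiff.sum fun m _ => (hu m).mul (hv m j).1
  have hBper : ∀ j t (l : AngleIdx d n → ℤ), B j (fun q => t q + l q) = B j t := by
    intro j t l
    have h1 : toC (fun q => t q + (l q : ℝ)) = fun q => toC t q + (l q : ℂ) := by
      ext q; simp [toC]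
    have h2 : SameInM (realTorus K (fun q => t q + l q)) (realTorus K t) := by
      obtain ⟨k, hk, hk'⟩ := H.torus.periodic (toC t) (toC_mem_strip H.ρ_pos.le t) l
      refine ⟨k, hk, fun q => ?_⟩
      rw [realTorus, realTorus, h1, hk' q]
      simp
    simp only [hB]
    rw [haper _ _ h2, h1, hDK.per _ (toC_mem_openStrip H.ρ_pos t)]
  have hderu : ∀ m t i, fderiv ℝ (fun t => (a (realTorus K t) m : ℂ)) t (Pi.single i 1) =
      ∑ p, (jac ℝ a (realTorus K t) m p : ℂ) * jac ℂ K (toC t) p i := by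
    intro m t i
    have hda : DifferentiableAt ℝ a (realTorus K t) := (ha.differentiable (by simp)) _
    have hdk : DifferentiableAt ℝ (realTorus K) t := hkr.differentiable one_ne_zero t
    have h1 : HasFDerivAt (fun t => (a (realTorus K t) m : ℂ)) (Complex.ofRealCLM ∘L
        ((ContinuousLinearMap.proj m) ∘L (fderiv ℝ (fun t => a (realTorus K t)) t))) t := by
      have h2 := (hau.differentiable one_ne_zero t).hasFDerivAt
      exact Complex.ofRealCLM.hasFDerivAt.comp t (hasFDerivAt_pi'.mp h2 m)
    rw [h1.fderiv]
    have h3 : fderiv ℝ (fun t => a (realTorus K t)) t (Pi.single i 1) m =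
        (jac ℝ a (realTorus K t) * jac ℝ (realTorus K) t) m i := by
      rw [← jac_comp hda hdk]; rfl
    simp only [ContinuousLinearMap.comp_apply, ContinuousLinearMap.proj_apply, h3, mul_apply,
      Complex.ofRealCLM_apply, H.jac_K_map, map_apply]
    push_cast
    rfl
  have hder : ∀ j t i, fderiv ℝ (B j) t (Pi.single i 1) =
      ∑ m, ((∑ p, (jac ℝ a (realTorus K t) m p : ℂ) * jac ℂ K (toC t) p i) *
        jac ℂ K (toC t) m j + (a (realTorus K t) m : ℂ) *
          fderiv ℂ (fun z => jac ℂ K z m j) (toC t) (Pi.single i 1)) := by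
    intro j t i
    have h1 : HasFDerivAt (B j) (∑ m, ((a (realTorus K t) m : ℂ) •
        fderiv ℝ (fun t => jac ℂ K (toC t) m j) t + jac ℂ K (toC t) m j •
          fderiv ℝ (fun t => (a (realTorus K t) m : ℂ)) t)) t :=
      HasFDerivAt.fun_sum fun m _ =>
        ((hu m).differentiable one_ne_zero t).hasFDerivAt.mul
          ((hv m j).1.differentiable one_ne_zero t).hasFDerivAt
    rw [h1.fderiv, _root_.sum_apply]
    refine Finset.sum_congr rfl fun m _ => ?_
    rw [_root_.add_apply, _root_.smul_apply,
      _root_.smul_apply, hderu, (hv m j).2, toC_single, smul_eq_mul, smul_eq_mul]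
    ring
  have hpt : ∀ t, ((jac ℂ K (toC t))ᵀ *
      (tildeJ (Jc (K (toC t))) : Matrix (PhaseIdx d n) (PhaseIdx d n) ℂ) * jac ℂ K (toC t)) i j =
      fderiv ℝ (B j) t (Pi.single i 1) - fderiv ℝ (B i) t (Pi.single j 1) := by
    intro t
    rw [hder, hder, H.Jc_map, tildeJ_map]
    have hJ : ∀ p m, (tildeJ (J (realTorus K t)) : Matrix (PhaseIdx d n) (PhaseIdx d n) ℝ) p m =
      jac ℝ a (realTorus K t) m p - jac ℝ a (realTorus K t) p m := fun p m => haJ _ p m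
    simp only [mul_apply, transpose_apply, map_apply, hJ, Finset.sum_add_distrib,
      fderiv_jac_symm H.torus.holomorphic (toC_mem_openStrip H.ρ_pos t) _ i j]
    rw [add_sub_add_right_eq_sub]
    simp only [Complex.ofReal_sub, Finset.sum_mul, mul_sub, sub_mul, Finset.sum_sub_distrib]
    congr 1
    · refine Finset.sum_congr rfl fun m _ => Finset.sum_congr rfl fun p _ => ?_
      ring
    · rw [Finset.sum_comm]
      refine Finset.sum_congr rfl fun m _ => Finset.sum_congr rfl fun p _ => ?_
      ring
  unfold torusMean
  simp_rw [hpt]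
  have hint : ∀ i j, IntegrableOn (fun t => fderiv ℝ (B j) t (Pi.single i 1))
      (Icc (0 : AngleIdx d n → ℝ) 1) := fun i j =>
    (((hBc j).continuous_fderiv one_ne_zero).clm_apply
      continuous_const).continuousOn.integrableOn_compact isCompact_Icc
  rw [integral_sub (hint i j) (hint j i), integral_fderiv_eq_zero (hBc j) (hBper j),
    integral_fderiv_eq_zero (hBc i) (hBper i), sub_zero]

/-- An invariant torus is isotropic: the pullback of the form is invariant under the rotation, hence
constant, and its mean value vanishes. -/
theorem isotropic (H : TorusHyp γ σ ρ r Cf CDK CN CJ ω J Jc f F K) {θ : AngleIdx d n → ℂ}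
    (hθ : θ ∈ openStrip d n ρ) :
    (jac ℂ K θ)ᵀ *
      (tildeJ (Jc (K θ)) : Matrix (PhaseIdx d n) (PhaseIdx d n) ℂ) * jac ℂ K θ = 0 := by
  have hL := (H.torusMat_DK.transpose.mul H.torusMat_tildeJ).mul H.torusMat_DK
  ext i j
  rw [eq_torusMean_of_invariant H.γ_pos H.dioph (hL.holo i j) (hL.periodicOn i j) ?_ H.ρ_pos hθ,
    H.torusMean_pullback i j]
  · rfl
  · intro θ hθ
    rw [← H.jac_F_mul_DK hθ, ← H.presymplectic hθ]
    simp only [transpose_mul, Matrix.mul_assoc]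

end TorusHyp

end

/-! ### The adapted frame of an invariant torus -/

section

variable {d n : ℕ}

/-- `X`: the first `d` columns of `DK`. -/
noncomputable def fullX (K : (AngleIdx d n → ℂ) → (PhaseIdx d n → ℂ)) (θ : AngleIdx d n → ℂ) :
    Matrix (PhaseIdx d n) (Fin d) ℂ := Matrix.fromRows (XV K θ) (XN K θ)

theorem jac_eq_fromBlocks (K : (AngleIdx d n → ℂ) → (PhaseIdx d n → ℂ)) (θ : AngleIdx d n → ℂ) :
    jac ℂ K θ = Matrix.fromBlocks (XV K θ) (ZV K θ) (XN K θ) (ZN K θ) :=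
  (Matrix.fromBlocks_toBlocks _).symm

theorem jac_eq_fromCols (K : (AngleIdx d n → ℂ) → (PhaseIdx d n → ℂ)) (θ : AngleIdx d n → ℂ) :
    jac ℂ K θ = Matrix.fromCols (fullX K θ) (fullZ K θ) := by
  rw [jac_eq_fromBlocks, fullX, fullZ, Matrix.fromCols_fromRows_eq_fromBlocks]

theorem matM_eq_fromCols (Jc : (PhaseIdx d n → ℂ) → Matrix (Fin d ⊕ Fin d) (Fin d ⊕ Fin d) ℂ)
    (K : (AngleIdx d n → ℂ) → (PhaseIdx d n → ℂ)) (θ : AngleIdx d n → ℂ) :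
    matM Jc K θ = Matrix.fromCols (Matrix.fromCols (fullX K θ) (fullJY Jc K θ)) (fullZ K θ) := by
  ext i j
  rcases i with i | i <;> rcases j with (j | j) | j <;> rfl

namespace TorusHyp

variable {γ σ ρ r Cf CDK CN CJ : ℝ} {ω : AngleIdx d n → ℝ}
  {J : (PhaseIdx d n → ℝ) → Matrix (Fin d ⊕ Fin d) (Fin d ⊕ Fin d) ℝ}
  {Jc : (PhaseIdx d n → ℂ) → Matrix (Fin d ⊕ Fin d) (Fin d ⊕ Fin d) ℂ}
  {f : (PhaseIdx d n → ℝ) → (PhaseIdx d n → ℝ)}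
  {F : (PhaseIdx d n → ℂ) → (PhaseIdx d n → ℂ)}
  {K : (AngleIdx d n → ℂ) → (PhaseIdx d n → ℂ)} {θ : AngleIdx d n → ℂ}

theorem isotropic_blocks (H : TorusHyp γ σ ρ r Cf CDK CN CJ ω J Jc f F K)
    (hθ : θ ∈ openStrip d n ρ) :
    (XV K θ)ᵀ * Jc (K θ) * XV K θ = 0 ∧ (XV K θ)ᵀ * Jc (K θ) * ZV K θ = 0 := by
  have h := H.isotropic hθ
  rw [jac_eq_fromBlocks, tildeJ, Matrix.fromBlocks_transpose, Matrix.fromBlocks_multiply,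
    Matrix.fromBlocks_multiply, ← Matrix.fromBlocks_zero, Matrix.fromBlocks_inj] at h
  obtain ⟨h1, h2, -, -⟩ := h
  constructor
  · simpa using h1
  · simpa using h2

theorem XV_transpose_mul_YV (H : TorusHyp γ σ ρ r Cf CDK CN CJ ω J Jc f F K)
    (hθ : θ ∈ openStrip d n ρ) : (XV K θ)ᵀ * YV K θ = 1 := by
  have h := (H.nondeg θ hθ).1
  rw [YV, ← Matrix.mul_assoc, matN, Matrix.mul_nonsing_inv _ ((Matrix.isUnit_iff_isUnit_det _).mp h)]

theorem YV_transpose_mul_XV (H : TorusHyp γ σ ρ r Cf CDK CN CJ ω J Jc f F K)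
    (hθ : θ ∈ openStrip d n ρ) : (YV K θ)ᵀ * XV K θ = 1 := by
  have h := congrArg Matrix.transpose (H.XV_transpose_mul_YV hθ)
  simpa using h

theorem isUnit_J (H : TorusHyp γ σ ρ r Cf CDK CN CJ ω J Jc f F K)
    (hθ : θ ∈ openStrip d n ρ) : IsUnit (Jc (K θ)).det :=
  (Matrix.isUnit_iff_isUnit_det _).mp (H.extJ.nondegenerate _ (H.K_mem hθ))

theorem J_mul_JY (H : TorusHyp γ σ ρ r Cf CDK CN CJ ω J Jc f F K)
    (hθ : θ ∈ openStrip d n ρ) : Jc (K θ) * JY Jc K θ = YV K θ := by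
  rw [JY, ← Matrix.mul_assoc, Matrix.mul_nonsing_inv _ (H.isUnit_J hθ), Matrix.one_mul]

theorem JY_transpose_mul_J (H : TorusHyp γ σ ρ r Cf CDK CN CJ ω J Jc f F K)
    (hθ : θ ∈ openStrip d n ρ) : (JY Jc K θ)ᵀ * Jc (K θ) = -(YV K θ)ᵀ := by
  have h := congrArg Matrix.transpose (H.J_mul_JY hθ)
  rw [Matrix.transpose_mul, H.skew hθ, Matrix.mul_neg] at h
  rw [← h, neg_neg]

theorem matV_eq (H : TorusHyp γ σ ρ r Cf CDK CN CJ ω J Jc f F K) (hθ : θ ∈ openStrip d n ρ) :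
    Matrix.fromBlocks (Matrix.fromRows ((XV K θ)ᵀ * Jc (K θ)) ((JY Jc K θ)ᵀ * Jc (K θ))) 0 0 1 *
      matM Jc K θ = matV Jc K θ := by
  obtain ⟨h1, h2⟩ := H.isotropic_blocks hθ
  rw [matM, matV, Matrix.fromBlocks_multiply]
  simp only [Matrix.zero_mul, Matrix.one_mul, add_zero, zero_add]
  rw [Matrix.fromRows_mul_fromCols, Matrix.fromRows_mul _ _ (ZV K θ), h1, h2,
    Matrix.mul_assoc _ _ (JY Jc K θ), H.J_mul_JY hθ, H.XV_transpose_mul_YV hθ,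
    H.JY_transpose_mul_J hθ, Matrix.neg_mul, Matrix.neg_mul, H.YV_transpose_mul_XV hθ]

theorem isUnit_matM (H : TorusHyp γ σ ρ r Cf CDK CN CJ ω J Jc f F K)
    (hθ : θ ∈ openStrip d n ρ) : IsUnit (matM Jc K θ).det := by
  have h := (Matrix.isUnit_iff_isUnit_det _).mp (H.nondeg θ hθ).2
  rw [← H.matV_eq hθ, Matrix.det_mul] at h
  exact isUnit_of_mul_isUnit_right h

/-- A left inverse of the `V`-part `(X_V, J⁻¹Y_V)` of the frame. -/
noncomputable def frameV (Jc : (PhaseIdx d n → ℂ) → Matrix (Fin d ⊕ Fin d) (Fin d ⊕ Fin d) ℂ)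
    (K : (AngleIdx d n → ℂ) → (PhaseIdx d n → ℂ)) (θ : AngleIdx d n → ℂ) :
    Matrix (Fin d ⊕ Fin d) (Fin d ⊕ Fin d) ℂ :=
  Matrix.fromRows ((YV K θ)ᵀ - (YV K θ)ᵀ * JY Jc K θ * ((XV K θ)ᵀ * Jc (K θ)))
    ((XV K θ)ᵀ * Jc (K θ))

theorem frameV_mul (H : TorusHyp γ σ ρ r Cf CDK CN CJ ω J Jc f F K)
    (hθ : θ ∈ openStrip d n ρ) :
    frameV Jc K θ * Matrix.fromCols (XV K θ) (JY Jc K θ) = 1 := by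
  obtain ⟨h1, -⟩ := H.isotropic_blocks hθ
  have h3 : (XV K θ)ᵀ * Jc (K θ) * JY Jc K θ = 1 := by
    rw [Matrix.mul_assoc, H.J_mul_JY hθ, H.XV_transpose_mul_YV hθ]
  rw [frameV, Matrix.fromRows_mul_fromCols, ← Matrix.fromBlocks_one]
  congr 1
  · rw [Matrix.sub_mul, H.YV_transpose_mul_XV hθ, Matrix.mul_assoc _ _ (XV K θ), h1, Matrix.mul_zero,
      sub_zero]
  · rw [Matrix.sub_mul, Matrix.mul_assoc _ _ (JY Jc K θ), h3, Matrix.mul_one, sub_self]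

theorem frameV_mul_ZV (H : TorusHyp γ σ ρ r Cf CDK CN CJ ω J Jc f F K)
    (hθ : θ ∈ openStrip d n ρ) :
    frameV Jc K θ * ZV K θ = Matrix.fromRows ((YV K θ)ᵀ * ZV K θ) 0 := by
  obtain ⟨-, h2⟩ := H.isotropic_blocks hθ
  rw [frameV, Matrix.fromRows_mul, h2, Matrix.sub_mul, Matrix.mul_assoc _ _ (ZV K θ), h2,
    Matrix.mul_zero, sub_zero]

/-- The `V`-projection of the tangent space of the torus is spanned by the columns of `X_V`. -/
theorem ZV_eq (H : TorusHyp γ σ ρ r Cf CDK CN CJ ω J Jc f F K)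
    (hθ : θ ∈ openStrip d n ρ) : ZV K θ = XV K θ * ((YV K θ)ᵀ * ZV K θ) := by
  have h1 := mul_eq_one_comm.mp (H.frameV_mul hθ)
  calc ZV K θ = Matrix.fromCols (XV K θ) (JY Jc K θ) * (frameV Jc K θ * ZV K θ) := by
        rw [← Matrix.mul_assoc, h1, Matrix.one_mul]
    _ = XV K θ * ((YV K θ)ᵀ * ZV K θ) := by
        rw [H.frameV_mul_ZV hθ, Matrix.fromCols_mul_fromRows, Matrix.mul_zero, add_zero]

/-- The determinant of the frame is that of the tangent directions of the torus in the kernel of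
the form, up to a bounded factor. -/
theorem det_frameV_mul_det_matM (H : TorusHyp γ σ ρ r Cf CDK CN CJ ω J Jc f F K)
    (hθ : θ ∈ openStrip d n ρ) :
    (frameV Jc K θ).det * (matM Jc K θ).det =
      (ZN K θ - XN K θ * ((YV K θ)ᵀ * ZV K θ)).det := by
  have h : Matrix.fromBlocks (frameV Jc K θ) 0 0 (1 : Matrix (Fin n) (Fin n) ℂ) * matM Jc K θ =
      Matrix.fromBlocks 1 (Matrix.fromRows ((YV K θ)ᵀ * ZV K θ) 0)
        (Matrix.fromCols (XN K θ) 0) (ZN K θ) := by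
    rw [matM, Matrix.fromBlocks_multiply]
    simp only [Matrix.zero_mul, Matrix.one_mul, add_zero, zero_add, H.frameV_mul hθ,
      H.frameV_mul_ZV hθ]
  have h2 := congrArg Matrix.det h
  rw [Matrix.det_mul, Matrix.det_fromBlocks_zero₂₁, Matrix.det_one, mul_one,
    Matrix.det_fromBlocks_one₁₁, Matrix.fromCols_mul_fromRows, Matrix.zero_mul, add_zero] at h2
  exact h2

theorem P_mul_fullX (H : TorusHyp γ σ ρ r Cf CDK CN CJ ω J Jc f F K) (hθ : θ ∈ openStrip d n ρ) :
    jac ℂ F (K θ) * fullX K θ = fullX K (shift ω θ) ∧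
      jac ℂ F (K θ) * fullZ K θ = fullZ K (shift ω θ) := by
  have h := H.jac_F_mul_DK hθ
  rw [jac_eq_fromCols, jac_eq_fromCols, Matrix.mul_fromCols] at h
  exact Matrix.fromCols_inj h

theorem fullX_transpose_mul_tildeJ :
    (fullX K θ)ᵀ * (tildeJ (Jc (K θ)) : Matrix (PhaseIdx d n) (PhaseIdx d n) ℂ) =
      Matrix.fromCols ((XV K θ)ᵀ * Jc (K θ)) 0 := by
  have h : (tildeJ (Jc (K θ)) : Matrix (PhaseIdx d n) (PhaseIdx d n) ℂ) =
      Matrix.fromCols (Matrix.fromRows (Jc (K θ)) 0) 0 := by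
    ext i j
    rcases i with i | i <;> rcases j with j | j <;> rfl
  rw [h, fullX, Matrix.transpose_fromRows, Matrix.mul_fromCols, Matrix.fromCols_mul_fromRows,
    Matrix.mul_zero, Matrix.mul_zero, add_zero]

/-- The derivative of `F` in the direction `J⁻¹Y` transverse to the torus. -/
theorem P_mul_fullJY (H : TorusHyp γ σ ρ r Cf CDK CN CJ ω J Jc f F K) (hθ : θ ∈ openStrip d n ρ) :
    jac ℂ F (K θ) * fullJY Jc K θ = fullX K (shift ω θ) * matS1 Jc F ω K θ +
      fullJY Jc K (shift ω θ) + fullZ K (shift ω θ) * matA Jc F ω K θ := by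
  have hθ' := (shift_mem_openStrip ω).mpr hθ
  set θ' := shift ω θ with hθ'def
  set Q := jac ℂ F (K θ) * fullJY Jc K θ - fullJY Jc K θ' with hQ
  set q := (matM Jc K θ')⁻¹ * Q with hq
  have hMq : matM Jc K θ' * q = Q := by
    rw [hq, ← Matrix.mul_assoc, Matrix.mul_nonsing_inv _ (H.isUnit_matM hθ'), Matrix.one_mul]
  have hqA : q.toRows₂ = matA Jc F ω K θ := by
    rw [matA, ← hθ'def, ← hQ, matT3, hq]
    rfl
  have hqsplit : q = Matrix.fromRows (Matrix.fromRows q.toRows₁.toRows₁ q.toRows₁.toRows₂)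
      q.toRows₂ := by
    rw [Matrix.fromRows_toRows, Matrix.fromRows_toRows]
  have hexp : fullX K θ' * q.toRows₁.toRows₁ + fullJY Jc K θ' * q.toRows₁.toRows₂ +
      fullZ K θ' * q.toRows₂ = Q := by
    rw [← hMq]
    conv_rhs => rw [hqsplit]
    rw [matM_eq_fromCols, Matrix.fromCols_mul_fromRows, Matrix.fromCols_mul_fromRows]
  have hXJJY : ∀ φ ∈ openStrip d n ρ, (fullX K φ)ᵀ *
      (tildeJ (Jc (K φ)) : Matrix (PhaseIdx d n) (PhaseIdx d n) ℂ) * fullJY Jc K φ = 1 := by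
    intro φ hφ
    rw [fullX_transpose_mul_tildeJ, fullJY, Matrix.fromCols_mul_fromRows, Matrix.mul_zero, add_zero,
      Matrix.mul_assoc, H.J_mul_JY hφ, H.XV_transpose_mul_YV hφ]
  -- the transverse component of `Q` vanishes since `F` preserves the form
  have hy : q.toRows₁.toRows₂ = 0 := by
    have h1 : (fullX K θ')ᵀ * (tildeJ (Jc (K θ')) : Matrix (PhaseIdx d n) (PhaseIdx d n) ℂ) * Q
        = 0 := by
      rw [hQ, Matrix.mul_sub, hXJJY θ' hθ']
      have h2 : (fullX K θ')ᵀ * (tildeJ (Jc (K θ')) : Matrix (PhaseIdx d n) (PhaseIdx d n) ℂ) *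
          (jac ℂ F (K θ) * fullJY Jc K θ) = 1 := by
        rw [← hXJJY θ hθ, ← H.presymplectic hθ, ← (H.P_mul_fullX hθ).1, Matrix.transpose_mul]
        simp only [Matrix.mul_assoc]
        rfl
      rw [h2, sub_self]
    have h3 : (fullX K θ')ᵀ * (tildeJ (Jc (K θ')) : Matrix (PhaseIdx d n) (PhaseIdx d n) ℂ) *
        fullX K θ' = 0 := by
      rw [fullX_transpose_mul_tildeJ, fullX, Matrix.fromCols_mul_fromRows, Matrix.zero_mul,
        (H.isotropic_blocks hθ').1, add_zero]
    have h4 : (fullX K θ')ᵀ * (tildeJ (Jc (K θ')) : Matrix (PhaseIdx d n) (PhaseIdx d n) ℂ) *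
        fullZ K θ' = 0 := by
      rw [fullX_transpose_mul_tildeJ, fullZ, Matrix.fromCols_mul_fromRows, Matrix.zero_mul,
        (H.isotropic_blocks hθ').2, add_zero]
    rw [← hexp, Matrix.mul_add, Matrix.mul_add, ← Matrix.mul_assoc, h3, ← Matrix.mul_assoc,
      hXJJY θ' hθ', ← Matrix.mul_assoc, h4, Matrix.zero_mul, Matrix.zero_mul, Matrix.one_mul,
      zero_add, add_zero] at h1
    exact h1
  rw [hy, Matrix.mul_zero, add_zero, hqA] at hexp
  have hx : q.toRows₁.toRows₁ = matS1 Jc F ω K θ := by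
    have h1 : Q - fullZ K θ' * matA Jc F ω K θ = fullX K θ' * q.toRows₁.toRows₁ := by
      rw [← hexp, add_sub_cancel_right]
    rw [matS1, ← hθ'def, ← hQ, h1, ← Matrix.mul_assoc, fullX, Matrix.fromCols_mul_fromRows,
      H.YV_transpose_mul_XV hθ', Matrix.zero_mul, add_zero, Matrix.one_mul]
  rw [← hx, add_right_comm, hexp, hQ, sub_add_cancel]

/-- In the adapted frame the linearized dynamics is unipotent. -/
theorem P_mul_matM (H : TorusHyp γ σ ρ r Cf CDK CN CJ ω J Jc f F K) (hθ : θ ∈ openStrip d n ρ) :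
    jac ℂ F (K θ) * matM Jc K θ = matM Jc K (shift ω θ) *
      Matrix.fromBlocks (Matrix.fromBlocks 1 (matS1 Jc F ω K θ) 0 1) 0
        (Matrix.fromCols 0 (matA Jc F ω K θ)) 1 := by
  have hU : Matrix.fromBlocks (Matrix.fromBlocks 1 (matS1 Jc F ω K θ) 0 1) 0
        (Matrix.fromCols 0 (matA Jc F ω K θ)) (1 : Matrix (Fin n) (Fin n) ℂ) =
      Matrix.fromCols (Matrix.fromCols
        (Matrix.fromRows (Matrix.fromRows (1 : Matrix (Fin d) (Fin d) ℂ) 0) 0)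
        (Matrix.fromRows (Matrix.fromRows (matS1 Jc F ω K θ) (1 : Matrix (Fin d) (Fin d) ℂ))
          (matA Jc F ω K θ)))
        (Matrix.fromRows (Matrix.fromRows 0 0) (1 : Matrix (Fin n) (Fin n) ℂ)) := by
    ext i j
    rcases i with (i | i) | i <;> rcases j with (j | j) | j <;> rfl
  rw [hU, matM_eq_fromCols, matM_eq_fromCols]
  simp only [Matrix.mul_fromCols, Matrix.fromCols_mul_fromRows, Matrix.mul_zero, Matrix.mul_one,
    add_zero, zero_add, (H.P_mul_fullX hθ).1, (H.P_mul_fullX hθ).2, H.P_mul_fullJY hθ]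

/-! ### Regularity of the frame -/

theorem torusMat_XV (H : TorusHyp γ σ ρ r Cf CDK CN CJ ω J Jc f F K) : TorusMat ρ (XV K) :=
  H.torusMat_DK.submatrix Sum.inl Sum.inl

theorem torusMat_ZV (H : TorusHyp γ σ ρ r Cf CDK CN CJ ω J Jc f F K) : TorusMat ρ (ZV K) :=
  H.torusMat_DK.submatrix Sum.inl Sum.inr

theorem torusMat_XN (H : TorusHyp γ σ ρ r Cf CDK CN CJ ω J Jc f F K) : TorusMat ρ (XN K) :=
  H.torusMat_DK.submatrix Sum.inr Sum.inl

theorem torusMat_ZN (H : TorusHyp γ σ ρ r Cf CDK CN CJ ω J Jc f F K) : TorusMat ρ (ZN K) :=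
  H.torusMat_DK.submatrix Sum.inr Sum.inr

theorem torusMat_YV (H : TorusHyp γ σ ρ r Cf CDK CN CJ ω J Jc f F K) : TorusMat ρ (YV K) :=
  H.torusMat_XV.mul ((H.torusMat_XV.transpose.mul H.torusMat_XV).inv
    fun θ hθ => (H.nondeg θ hθ).1)

theorem torusMat_JY (H : TorusHyp γ σ ρ r Cf CDK CN CJ ω J Jc f F K) : TorusMat ρ (JY Jc K) :=
  (H.torusMat_J.inv fun _ hθ => H.extJ.nondegenerate _ (H.K_mem hθ)).mul H.torusMat_YV

theorem torusMat_fullJY (H : TorusHyp γ σ ρ r Cf CDK CN CJ ω J Jc f F K) :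
    TorusMat ρ (fullJY Jc K) := H.torusMat_JY.fromRows .zero

theorem torusMat_fullZ (H : TorusHyp γ σ ρ r Cf CDK CN CJ ω J Jc f F K) :
    TorusMat ρ (fullZ K) := H.torusMat_ZV.fromRows H.torusMat_ZN

theorem torusMat_matM (H : TorusHyp γ σ ρ r Cf CDK CN CJ ω J Jc f F K) :
    TorusMat ρ (matM Jc K) :=
  (H.torusMat_XV.fromCols H.torusMat_JY).fromBlocks H.torusMat_ZV
    (H.torusMat_XN.fromCols .zero) H.torusMat_ZN

theorem torusMat_matM_inv (H : TorusHyp γ σ ρ r Cf CDK CN CJ ω J Jc f F K) :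
    TorusMat ρ fun θ => (matM Jc K θ)⁻¹ :=
  H.torusMat_matM.inv fun _ hθ => (Matrix.isUnit_iff_isUnit_det _).mpr (H.isUnit_matM hθ)

theorem torusMat_matA (H : TorusHyp γ σ ρ r Cf CDK CN CJ ω J Jc f F K) :
    TorusMat ρ (matA Jc F ω K) :=
  ((H.torusMat_matM_inv.submatrix Sum.inr id).shift ω).mul
    ((H.torusMat_P.mul H.torusMat_fullJY).sub (H.torusMat_fullJY.shift ω))

theorem torusMat_matS1 (H : TorusHyp γ σ ρ r Cf CDK CN CJ ω J Jc f F K) :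
    TorusMat ρ (matS1 Jc F ω K) :=
  ((H.torusMat_YV.shift ω).transpose.fromCols .zero).mul
    (((H.torusMat_P.mul H.torusMat_fullJY).sub (H.torusMat_fullJY.shift ω)).sub
      ((H.torusMat_fullZ.shift ω).mul H.torusMat_matA))

end TorusHyp

end

/-! ### A lower bound for the Jacobian of an equivariant local diffeomorphism -/

section

open scoped Pointwise

theorem exists_int_add_mem_Icc {ι : Type*} (t : ι → ℝ) :
    ∃ s ∈ Icc (0 : ι → ℝ) 1, ∃ l : ι → ℤ, t = fun j => s j + l j :=
  ⟨fun j => Int.fract (t j), ⟨fun _ => Int.fract_nonneg _, fun _ => (Int.fract_lt_one _).le⟩,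
    fun j => ⌊t j⌋, funext fun _ => (Int.fract_add_floor _).symm⟩

/-- A local diffeomorphism of `ℝ^D` that is equivariant with respect to `ℤ^D` and a subgroup of
translations whose nonzero elements have norm at least `η` is onto, its image being open and closed.
So the image of the unit cube has volume at least `η^D`, and the Jacobian determinant cannot be
small everywhere. -/
theorem exists_le_abs_det {ι : Type*} [Fintype ι] [DecidableEq ι] {η : ℝ} (hη : 0 < η)
    {Ψ : (ι → ℝ) → (ι → ℝ)} {W : (ι → ℝ) → Matrix ι ι ℝ} (hΨ : ContDiff ℝ 1 Ψ)
    (hder : ∀ t, HasFDerivAt Ψ (LinearMap.toContinuousLinearMap (Matrix.toLin' (W t))) t)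
    (hdet : ∀ t, (W t).det ≠ 0) {lam : (ι → ℤ) → (ι → ℝ)}
    (hlam : ∀ t (l : ι → ℤ), Ψ (fun j => t j + l j) = Ψ t + lam l)
    (hsep : ∀ l, lam l ≠ 0 → η ≤ ‖lam l‖) :
    ∃ t, η ^ Fintype.card ι / 2 ≤ |(W t).det| := by
  -- the translations form a subgroup
  have hadd : ∀ l l', lam (l + l') = lam l + lam l' := by
    intro l l'
    have h1 := hlam 0 (l + l')
    have h2 := hlam (fun j => (0 : ι → ℝ) j + l j) l'
    rw [hlam 0 l] at h2
    have h3 : (fun j => (fun j => (0 : ι → ℝ) j + (l j : ℝ)) j + (l' j : ℝ)) =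
        fun j => (0 : ι → ℝ) j + ((l + l') j : ℤ) := by ext j; simp
    rw [h3, h1, add_assoc] at h2
    exact add_left_cancel h2
  let L : AddSubgroup (ι → ℝ) := (AddMonoidHom.mk' lam hadd).range
  have hLsep : ∀ v ∈ L, v ≠ 0 → η ≤ ‖v‖ := by
    rintro _ ⟨l, rfl⟩ h
    exact hsep l h
  have hLclosed : IsClosed (L : Set (ι → ℝ)) := by
    refine Metric.isClosed_of_pairwise_le_dist hη fun x hx y hy hxy => ?_
    show η ≤ dist x y
    rw [dist_eq_norm]
    exact hLsep _ (L.sub_mem hx hy) (sub_ne_zero.mpr hxy)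
  set Fd := Ψ '' Icc (0 : ι → ℝ) 1 with hFd
  have hFc : IsCompact Fd := isCompact_Icc.image hΨ.continuous
  have hrange : Set.range Ψ = Fd + (L : Set (ι → ℝ)) := by
    ext x
    constructor
    · rintro ⟨t, rfl⟩
      obtain ⟨s, hs, l, rfl⟩ := exists_int_add_mem_Icc t
      rw [hlam]
      exact Set.add_mem_add ⟨s, hs, rfl⟩ ⟨l, rfl⟩
    · rintro ⟨_, ⟨s, -, rfl⟩, _, ⟨l, rfl⟩, rfl⟩
      exact ⟨_, hlam s l⟩
  have hclosed : IsClosed (Set.range Ψ) := by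
    rw [hrange]
    exact hLclosed.add_left_of_isCompact hFc
  have hopen : IsOpen (Set.range Ψ) := by
    have hmap : IsOpenMap Ψ := by
      refine IsOpenMap.of_nhds_le fun t => ?_
      have hs : HasStrictFDerivAt Ψ (LinearMap.toContinuousLinearMap (Matrix.toLin' (W t))) t :=
        hΨ.contDiffAt.hasStrictFDerivAt' (hder t) one_ne_zero
      refine (hs.map_nhds_eq_of_surj ?_).ge
      rw [LinearMap.range_eq_top]
      have hu : IsUnit (W t) := (Matrix.isUnit_iff_isUnit_det _).mpr (hdet t).isUnit
      have h2 : Function.Surjective (W t).mulVec := Matrix.mulVec_surjective_iff_isUnit.mpr hu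
      exact h2
    exact hmap.isOpen_range
  have huniv : Set.range Ψ = Set.univ :=
    (show IsClopen (Set.range Ψ) from ⟨hclosed, hopen⟩).eq_univ (Set.range_nonempty Ψ)
  by_contra! hcon
  have hvol1 : volume Fd ≤ ENNReal.ofReal (η ^ Fintype.card ι / 2) := by
    refine (addHaar_image_le_lintegral_abs_det_fderiv volume measurableSet_Icc
      fun t _ => (hder t).hasFDerivWithinAt).trans ?_
    refine (setLIntegral_mono (g := fun _ => ENNReal.ofReal (η ^ Fintype.card ι / 2))
      measurable_const fun t _ => ENNReal.ofReal_le_ofReal ?_).trans ?_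
    · rw [ContinuousLinearMap.det, LinearMap.coe_toContinuousLinearMap, LinearMap.det_toLin']
      exact (hcon t).le
    · simp [Real.volume_Icc_pi]
  have hcount : Countable L := by
    have : (Set.range lam).Countable := Set.countable_range lam
    exact this.to_subtype
  have hvol2 : volume (Metric.ball (0 : ι → ℝ) (η / 2)) ≤ volume Fd := by
    have hcover : Metric.ball (0 : ι → ℝ) (η / 2) ⊆
        ⋃ v : L, (Metric.ball (0 : ι → ℝ) (η / 2) ∩ (fun x => x + -(v : ι → ℝ)) ⁻¹' Fd) := by
      intro x hx
      have : x ∈ Fd + (L : Set (ι → ℝ)) := by rw [← hrange, huniv]; trivial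
      obtain ⟨y, hy, v, hv, rfl⟩ := this
      exact Set.mem_iUnion.mpr ⟨⟨v, hv⟩, hx, by simpa using hy⟩
    calc volume (Metric.ball (0 : ι → ℝ) (η / 2))
        ≤ ∑' v : L, volume (Metric.ball (0 : ι → ℝ) (η / 2) ∩
            (fun x => x + -(v : ι → ℝ)) ⁻¹' Fd) :=
          (measure_mono hcover).trans (measure_iUnion_le _)
      _ = ∑' v : L, volume (Metric.ball (-(v : ι → ℝ)) (η / 2) ∩ Fd) := by
          refine tsum_congr fun v => ?_
          rw [← measure_preimage_add_right volume (-(v : ι → ℝ))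
            (Metric.ball (-(v : ι → ℝ)) (η / 2) ∩ Fd), Set.preimage_inter]
          congr 2
          ext x
          simp [Metric.mem_ball]
      _ = volume (⋃ v : L, (Metric.ball (-(v : ι → ℝ)) (η / 2) ∩ Fd)) := by
          refine (measure_iUnion ?_ fun v => Metric.isOpen_ball.measurableSet.inter
            hFc.measurableSet).symm
          intro v w hvw
          refine Set.disjoint_left.mpr fun x hx hx' => ?_
          have h1 := Metric.mem_ball.mp hx.1
          have h2 := Metric.mem_ball.mp hx'.1
          have hne : (v : ι → ℝ) - w ≠ 0 := sub_ne_zero.mpr fun h => hvw (Subtype.ext h)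
          have h3 := hLsep _ (L.sub_mem v.2 w.2) hne
          have h4 := dist_triangle_left (-(v : ι → ℝ)) (-(w : ι → ℝ)) x
          rw [dist_neg_neg, dist_eq_norm (v : ι → ℝ)] at h4
          linarith
      _ ≤ volume Fd := measure_mono (Set.iUnion_subset fun v => Set.inter_subset_right)
  have hball : volume (Metric.ball (0 : ι → ℝ) (η / 2)) =
      ENNReal.ofReal (η ^ Fintype.card ι) := by
    rw [Real.volume_pi_ball _ (by positivity)]
    congr 2; ring
  have h := hvol2.trans hvol1
  rw [hball, ENNReal.ofReal_le_ofReal_iff (by positivity)] at h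
  have : 0 < η ^ Fintype.card ι := by positivity
  linarith

end

/-! ### Uniform bounds for the frame -/

section

variable {d n : ℕ}

theorem norm_fderiv_le_of_entriesLE {K : (AngleIdx d n → ℂ) → (PhaseIdx d n → ℂ)} {θ : AngleIdx d n → ℂ}
    {C : ℝ} (h : EntriesLE (jac ℂ K θ) C) :
    ‖fderiv ℂ K θ‖ ≤ Fintype.card (AngleIdx d n) * |C| :=
  ContinuousLinearMap.opNorm_le_bound _ (by positivity) fun v => by
    rw [← jac_mulVec]; exact h.norm_mulVec_le

namespace TorusHyp

variable {γ σ ρ r Cf CDK CN CJ : ℝ} {ω : AngleIdx d n → ℝ}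
  {J : (PhaseIdx d n → ℝ) → Matrix (Fin d ⊕ Fin d) (Fin d ⊕ Fin d) ℝ}
  {Jc : (PhaseIdx d n → ℂ) → Matrix (Fin d ⊕ Fin d) (Fin d ⊕ Fin d) ℂ}
  {f : (PhaseIdx d n → ℝ) → (PhaseIdx d n → ℝ)}
  {F : (PhaseIdx d n → ℂ) → (PhaseIdx d n → ℂ)}
  {K : (AngleIdx d n → ℂ) → (PhaseIdx d n → ℂ)} {θ : AngleIdx d n → ℂ}

theorem norm_K_sub_le (H : TorusHyp γ σ ρ r Cf CDK CN CJ ω J Jc f F K) {θ' : AngleIdx d n → ℂ}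
    (hθ : θ ∈ openStrip d n ρ) (hθ' : θ' ∈ openStrip d n ρ) :
    ‖K θ' - K θ‖ ≤ Fintype.card (AngleIdx d n) * |CDK| * ‖θ' - θ‖ :=
  (convex_openStrip ρ).norm_image_sub_le_of_norm_fderiv_le (𝕜 := ℂ)
    (fun _ hx => H.differentiableAt_K hx) (fun x hx => norm_fderiv_le_of_entriesLE (H.DK_le x hx)) hθ hθ'

/-- Second order Taylor estimate for the torus, with a Cauchy estimate for the second derivative. -/
theorem norm_taylor_le (H : TorusHyp γ σ ρ r Cf CDK CN CJ ω J Jc f F K)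
    (hθ : θ ∈ strip d n (7 * ρ / 8)) (v : AngleIdx d n → ℝ) :
    ‖K (shift v θ) - K θ - jac ℂ K θ *ᵥ toC v‖ ≤
      Fintype.card (AngleIdx d n) * (16 * |CDK| / ρ) * ‖v‖ ^ 2 := by
  have hρ := H.ρ_pos
  have hsub : strip d n (7 * ρ / 8) ⊆ openStrip d n ρ := strip_subset_openStrip (by linarith)
  have hθ' : shift v θ ∈ strip d n (7 * ρ / 8) := (shift_mem_strip v).mpr hθ
  have hseg : segment ℝ θ (shift v θ) ⊆ strip d n (7 * ρ / 8) :=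
    (convex_strip _).segment_subset hθ hθ'
  have hlip : ∀ z ∈ segment ℝ θ (shift v θ),
      EntriesLE (jac ℂ K z - jac ℂ K θ) (16 * |CDK| / ρ * ‖v‖) := by
    intro z hz i j
    have h1 := (convex_strip (d := d) (n := n) (7 * ρ / 8)).norm_image_sub_le_of_norm_fderiv_le
      (𝕜 := ℂ) (f := fun z => jac ℂ K z i j) (C := 16 * |CDK| / ρ) (x := θ) (y := z)
      (fun x hx => (H.torusMat_DK.holo i j).differentiableAt
        ((isOpen_openStrip ρ).mem_nhds (hsub hx))) (fun x hx => ?_) hθ (hseg hz)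
    · refine h1.trans ?_
      have h2 := norm_sub_le_of_mem_segment hz
      rw [shift, add_sub_cancel_left, norm_toC] at h2
      gcongr
    · have h3 : Metric.ball x (ρ / 8) ⊆ openStrip d n ρ :=
        ball_subset_openStrip (by linarith) hx
      refine (norm_fderiv_le_of_norm_le_on_ball (R := ρ / 8) (by positivity)
        ((H.torusMat_DK.holo i j).mono h3) fun w hw => (H.DK_le w (h3 hw)).abs i j).trans (le_of_eq ?_)
      field_simp; ring
  have h := (convex_segment θ (shift v θ)).norm_image_sub_le_of_norm_fderiv_le' (𝕜 := ℂ) (f := K)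
    (φ := fderiv ℂ K θ) (C := Fintype.card (AngleIdx d n) * (16 * |CDK| / ρ * ‖v‖))
    (fun x hx => H.differentiableAt_K (hsub (hseg hx))) (fun x hx => ?_)
    (left_mem_segment ℝ _ _) (right_mem_segment ℝ _ _)
  · rw [← jac_mulVec] at h
    simp only [shift, add_sub_cancel_left, norm_toC] at h ⊢
    refine h.trans (le_of_eq (by ring))
  · refine ContinuousLinearMap.opNorm_le_bound _ (by positivity) fun w => ?_
    rw [_root_.sub_apply, ← jac_mulVec, ← jac_mulVec, ← Matrix.sub_mulVec]
    refine (hlip x hx).norm_mulVec_le.trans (le_of_eq ?_)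
    rw [abs_of_nonneg (by positivity)]

theorem entriesLE_XV (H : TorusHyp γ σ ρ r Cf CDK CN CJ ω J Jc f F K)
    (hθ : θ ∈ openStrip d n ρ) : EntriesLE (XV K θ) CDK := fun _ _ => H.DK_le θ hθ _ _

theorem entriesLE_YV (H : TorusHyp γ σ ρ r Cf CDK CN CJ ω J Jc f F K)
    (hθ : θ ∈ openStrip d n ρ) :
    EntriesLE (YV K θ) (Fintype.card (Fin d) * (|CDK| * |CN|)) :=
  (H.entriesLE_XV hθ).mul (H.N_le θ hθ)

end TorusHyp

/-- The frame `M` and the left inverse of its `V`-part are bounded in terms of the bounds for the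
torus. -/
theorem exists_entriesLE_matM (d n : ℕ) (ρ r Cf CDK CN CJ : ℝ) :
    ∃ C : ℝ, 0 < C ∧ ∀ {γ σ : ℝ} {ω : AngleIdx d n → ℝ}
      {J : (PhaseIdx d n → ℝ) → Matrix (Fin d ⊕ Fin d) (Fin d ⊕ Fin d) ℝ}
      {Jc : (PhaseIdx d n → ℂ) → Matrix (Fin d ⊕ Fin d) (Fin d ⊕ Fin d) ℂ}
      {f : (PhaseIdx d n → ℝ) → (PhaseIdx d n → ℝ)}
      {F : (PhaseIdx d n → ℂ) → (PhaseIdx d n → ℂ)}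
      {K : (AngleIdx d n → ℂ) → (PhaseIdx d n → ℂ)},
      TorusHyp γ σ ρ r Cf CDK CN CJ ω J Jc f F K → ∀ θ ∈ openStrip d n ρ,
        EntriesLE (matM Jc K θ) C ∧ EntriesLE (TorusHyp.frameV Jc K θ) C := by
  have h : ∃ C₂ C₃ : ℝ, ∀ {γ σ : ℝ} {ω : AngleIdx d n → ℝ}
      {J : (PhaseIdx d n → ℝ) → Matrix (Fin d ⊕ Fin d) (Fin d ⊕ Fin d) ℝ}
      {Jc : (PhaseIdx d n → ℂ) → Matrix (Fin d ⊕ Fin d) (Fin d ⊕ Fin d) ℂ}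
      {f : (PhaseIdx d n → ℝ) → (PhaseIdx d n → ℝ)}
      {F : (PhaseIdx d n → ℂ) → (PhaseIdx d n → ℂ)}
      {K : (AngleIdx d n → ℂ) → (PhaseIdx d n → ℂ)},
      TorusHyp γ σ ρ r Cf CDK CN CJ ω J Jc f F K → ∀ θ ∈ openStrip d n ρ,
        EntriesLE (matM Jc K θ) C₂ ∧ EntriesLE (TorusHyp.frameV Jc K θ) C₃ :=
    ⟨_, _, fun H θ hθ =>
      have hX := (H.entriesLE_XV hθ).transpose.mul (H.extJ.bound _ (H.K_mem hθ))
      have hJY := (H.extJ.bound_inv _ (H.K_mem hθ)).mul (H.entriesLE_YV hθ)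
      ⟨(((H.DK_le θ hθ).submatrix Sum.inl Sum.inl).fromCols hJY).fromBlocks
        ((H.DK_le θ hθ).submatrix Sum.inl Sum.inr)
        (((H.DK_le θ hθ).submatrix Sum.inr Sum.inl).fromCols .zero)
        ((H.DK_le θ hθ).submatrix Sum.inr Sum.inr),
      ((H.entriesLE_YV hθ).transpose.sub
        (((H.entriesLE_YV hθ).transpose.mul hJY).mul hX)).fromRows hX⟩⟩
  obtain ⟨C₂, C₃, h⟩ := h
  exact ⟨max (max C₂ C₃) 1, by positivity, fun H θ hθ =>
    ⟨(h H θ hθ).1.mono (by simp), (h H θ hθ).2.mono (by simp)⟩⟩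

namespace TorusHyp

variable {γ σ ρ r Cf CDK CN CJ : ℝ} {ω : AngleIdx d n → ℝ}
  {J : (PhaseIdx d n → ℝ) → Matrix (Fin d ⊕ Fin d) (Fin d ⊕ Fin d) ℝ}
  {Jc : (PhaseIdx d n → ℂ) → Matrix (Fin d ⊕ Fin d) (Fin d ⊕ Fin d) ℂ}
  {f : (PhaseIdx d n → ℝ) → (PhaseIdx d n → ℝ)}
  {F : (PhaseIdx d n → ℂ) → (PhaseIdx d n → ℂ)}
  {K : (AngleIdx d n → ℂ) → (PhaseIdx d n → ℂ)} {θ : AngleIdx d n → ℂ}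

/-! ### The slope of the projected torus -/

/-- The slope `Y_Vᵀ Z_V` of the projected torus is invariant under the rotation. -/
theorem slope_shift (H : TorusHyp γ σ ρ r Cf CDK CN CJ ω J Jc f F K)
    (hθ : θ ∈ openStrip d n ρ) :
    (YV K (shift ω θ))ᵀ * ZV K (shift ω θ) = (YV K θ)ᵀ * ZV K θ := by
  have hθ' := (shift_mem_openStrip ω).mpr hθ
  have hfun : ∀ φ ∈ openStrip d n ρ, (fullJY Jc K φ)ᵀ *
      (tildeJ (Jc (K φ)) : Matrix (PhaseIdx d n) (PhaseIdx d n) ℂ) * fullZ K φ =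
      -((YV K φ)ᵀ * ZV K φ) := by
    intro φ hφ
    have h : (tildeJ (Jc (K φ)) : Matrix (PhaseIdx d n) (PhaseIdx d n) ℂ) =
        Matrix.fromCols (Matrix.fromRows (Jc (K φ)) 0) 0 := by
      ext i j
      rcases i with i | i <;> rcases j with j | j <;> rfl
    rw [h, fullJY, Matrix.transpose_fromRows, Matrix.mul_fromCols, Matrix.fromCols_mul_fromRows,
      Matrix.mul_zero, Matrix.mul_zero, add_zero, H.JY_transpose_mul_J hφ, fullZ,
      Matrix.fromCols_mul_fromRows, Matrix.zero_mul, add_zero, Matrix.neg_mul]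
  have hiso := H.isotropic hθ'
  rw [jac_eq_fromCols, Matrix.transpose_fromCols, Matrix.fromRows_mul,
    Matrix.fromRows_mul_fromCols, ← Matrix.fromBlocks_zero, Matrix.fromBlocks_inj] at hiso
  obtain ⟨-, hXZ, -, hZZ⟩ := hiso
  have h1 := hfun θ hθ
  rw [← H.presymplectic hθ] at h1
  have h2 : (fullJY Jc K θ)ᵀ * ((jac ℂ F (K θ))ᵀ *
      (tildeJ (Jc (K (shift ω θ))) : Matrix (PhaseIdx d n) (PhaseIdx d n) ℂ) *
      jac ℂ F (K θ)) * fullZ K θ = (jac ℂ F (K θ) * fullJY Jc K θ)ᵀ *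
      (tildeJ (Jc (K (shift ω θ))) : Matrix (PhaseIdx d n) (PhaseIdx d n) ℂ) *
      (jac ℂ F (K θ) * fullZ K θ) := by
    rw [Matrix.transpose_mul]; simp only [Matrix.mul_assoc]
  rw [h2, H.P_mul_fullJY hθ, (H.P_mul_fullX hθ).2, Matrix.transpose_add, Matrix.transpose_add,
    Matrix.transpose_mul, Matrix.transpose_mul, Matrix.add_mul, Matrix.add_mul, Matrix.add_mul,
    Matrix.add_mul, hfun _ hθ', Matrix.mul_assoc _ (fullX _ _)ᵀ, Matrix.mul_assoc _ _ (fullZ _ _),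
    hXZ, Matrix.mul_assoc _ (fullZ _ _)ᵀ, Matrix.mul_assoc _ _ (fullZ _ _), hZZ] at h1
  simpa using h1

/-- By ergodicity, the slope of the projected torus is a constant real matrix. -/
theorem exists_slope (H : TorusHyp γ σ ρ r Cf CDK CN CJ ω J Jc f F K) :
    ∃ B : Matrix (Fin d) (Fin n) ℝ, ∀ θ ∈ openStrip d n ρ,
      (YV K θ)ᵀ * ZV K θ = B.map fun x => (x : ℂ) := by
  have hB := H.torusMat_YV.transpose.mul H.torusMat_ZV
  have hc : ∀ θ ∈ openStrip d n ρ, ∀ i j, ((YV K θ)ᵀ * ZV K θ) i j =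
      torusMean fun θ => ((YV K θ)ᵀ * ZV K θ) i j := fun θ hθ i j =>
    eq_torusMean_of_invariant H.γ_pos H.dioph (hB.holo i j) (hB.periodicOn i j)
      (fun φ hφ => by rw [H.slope_shift hφ]) H.ρ_pos hθ
  refine ⟨Matrix.of fun i j => (((YV K (toC 0))ᵀ * ZV K (toC 0)) i j).re, fun θ hθ => ?_⟩
  ext i j
  rw [hc θ hθ, ← hc _ (toC_mem_openStrip H.ρ_pos 0)]
  exact (hB.ofReal_re i j 0).symm

end TorusHyp

end

/-! ### The determinant of the frame is bounded below -/

section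

variable {d n : ℕ}

/-- The real torus with its `V`-part replaced by the rectifying angles `t_x + B t_z`, where `B` is
the slope. -/
noncomputable def straightened (B : Matrix (Fin d) (Fin n) ℝ)
    (K : (AngleIdx d n → ℂ) → (PhaseIdx d n → ℂ)) (t : AngleIdx d n → ℝ) : AngleIdx d n → ℝ :=
  Sum.elim ((fun i => t (Sum.inl i)) + B *ᵥ fun j => t (Sum.inr j))
    fun j => realTorus K t (Sum.inr j)

/-- The Jacobian matrix of `straightened`. -/
noncomputable def straightenedJac (B : Matrix (Fin d) (Fin n) ℝ)
    (K : (AngleIdx d n → ℂ) → (PhaseIdx d n → ℂ)) (t : AngleIdx d n → ℝ) :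
    Matrix (AngleIdx d n) (AngleIdx d n) ℝ :=
  Matrix.fromBlocks 1 B (jac ℝ (realTorus K) t).toBlocks₂₁ (jac ℝ (realTorus K) t).toBlocks₂₂

namespace TorusHyp

variable {γ σ ρ r Cf CDK CN CJ : ℝ} {ω : AngleIdx d n → ℝ}
  {J : (PhaseIdx d n → ℝ) → Matrix (Fin d ⊕ Fin d) (Fin d ⊕ Fin d) ℝ}
  {Jc : (PhaseIdx d n → ℂ) → Matrix (Fin d ⊕ Fin d) (Fin d ⊕ Fin d) ℂ}
  {f : (PhaseIdx d n → ℝ) → (PhaseIdx d n → ℝ)}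
  {F : (PhaseIdx d n → ℂ) → (PhaseIdx d n → ℂ)}
  {K : (AngleIdx d n → ℂ) → (PhaseIdx d n → ℂ)} {θ : AngleIdx d n → ℂ}
  {B : Matrix (Fin d) (Fin n) ℝ}

theorem differentiableAt_realTorus (H : TorusHyp γ σ ρ r Cf CDK CN CJ ω J Jc f F K)
    (t : AngleIdx d n → ℝ) : DifferentiableAt ℝ (realTorus K) t :=
  (hasFDerivAt_of_toC (c := 0) (H.differentiableAt_K (toC_mem_openStrip H.ρ_pos t))
    (Eventually.of_forall fun s => by rw [H.torus.toC_realTorus]; ext; simp [toC])).1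

theorem contDiff_straightened (H : TorusHyp γ σ ρ r Cf CDK CN CJ ω J Jc f F K) :
    ContDiff ℝ 1 (straightened B K) := by
  refine contDiff_pi.mpr fun i => ?_
  rcases i with i | i
  · simp only [straightened, Sum.elim_inl, Pi.add_apply, mulVec, dotProduct]
    fun_prop
  · simp only [straightened, Sum.elim_inr, realTorus]
    exact Complex.reCLM.contDiff.comp
      (restrict_real H.ρ_pos (differentiableOn_pi.mp H.torus.holomorphic (Sum.inr i)) 1).1

theorem hasFDerivAt_straightened (H : TorusHyp γ σ ρ r Cf CDK CN CJ ω J Jc f F K)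
    (t : AngleIdx d n → ℝ) : HasFDerivAt (straightened B K)
      (LinearMap.toContinuousLinearMap (Matrix.toLin' (straightenedJac B K t))) t := by
  refine hasFDerivAt_pi'.mpr fun i => ?_
  rcases i with i | i
  · set L : (AngleIdx d n → ℝ) →L[ℝ] ℝ := (ContinuousLinearMap.proj (Sum.inl i)).comp
      (LinearMap.toContinuousLinearMap (Matrix.toLin' (straightenedJac B K t))) with hL
    have : (fun t => straightened B K t (Sum.inl i)) = L := by
      ext s
      simp [hL, straightened, straightenedJac, Matrix.toLin'_apply, Matrix.fromBlocks_mulVec]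
      rfl
    rw [this]
    exact L.hasFDerivAt
  · have h1 := hasFDerivAt_pi'.mp (H.differentiableAt_realTorus t).hasFDerivAt (Sum.inr i)
    refine h1.congr_fderiv ?_
    ext v
    change fderiv ℝ (realTorus K) t v (Sum.inr i) = (straightenedJac B K t *ᵥ v) (Sum.inr i)
    rw [← jac_mulVec, ← Matrix.fromBlocks_toBlocks (jac ℝ (realTorus K) t), straightenedJac,
      Matrix.fromBlocks_mulVec, Matrix.fromBlocks_mulVec]
    simp

theorem det_straightenedJac (H : TorusHyp γ σ ρ r Cf CDK CN CJ ω J Jc f F K)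
    (hB : ∀ θ ∈ openStrip d n ρ, (YV K θ)ᵀ * ZV K θ = B.map fun x => (x : ℂ))
    (t : AngleIdx d n → ℝ) : ((straightenedJac B K t).det : ℂ) =
      (frameV Jc K (toC t)).det * (matM Jc K (toC t)).det := by
  have ht := toC_mem_openStrip (d := d) (n := n) H.ρ_pos t
  rw [H.det_frameV_mul_det_matM ht, hB _ ht, straightenedJac, Matrix.det_fromBlocks_one₁₁, ZN, XN,
    H.jac_K_map]
  refine (Complex.ofRealHom.map_det _).trans ?_
  congr 1
  ext i j
  simp [Matrix.mul_apply, Matrix.toBlocks₂₁, Matrix.toBlocks₂₂]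

/-- The `V`-part of the torus is constant along the direction `(-B s, s)`. -/
theorem K_inl_add_slope (H : TorusHyp γ σ ρ r Cf CDK CN CJ ω J Jc f F K)
    (hB : ∀ θ ∈ openStrip d n ρ, (YV K θ)ᵀ * ZV K θ = B.map fun x => (x : ℂ))
    (t : AngleIdx d n → ℝ) (s : Fin n → ℝ) (i : Fin d ⊕ Fin d) :
    K (toC (t + Sum.elim (-(B *ᵥ s)) s)) (Sum.inl i) = K (toC t) (Sum.inl i) := by
  set v : AngleIdx d n → ℝ := Sum.elim (-(B *ᵥ s)) s with hv
  have hvC : (toC v : AngleIdx d n → ℂ) =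
      Sum.elim (-((B.map fun x => (x : ℂ)) *ᵥ toC s)) (toC s) := by
    ext j
    rcases j with j | j
    · simp [hv, toC, mulVec, dotProduct]
    · simp [hv, toC]
  have hder : ∀ x : ℝ, HasDerivAt (fun x : ℝ => K (toC (t + x • v)) (Sum.inl i)) 0 x := by
    intro x
    have hx := toC_mem_openStrip (d := d) (n := n) H.ρ_pos (t + x • v)
    have h1 := restrict_real H.ρ_pos (differentiableOn_pi.mp H.torus.holomorphic (Sum.inl i)) 1
    have h2 : HasFDerivAt (fun t => K (toC t) (Sum.inl i)) _ (t + x • v) :=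
      (h1.1.differentiable (by norm_num) _).hasFDerivAt
    have h3 : HasDerivAt (fun x : ℝ => t + x • v) v x := by
      simpa using ((hasDerivAt_id x).smul_const v).const_add t
    have h4 := h2.comp_hasDerivAt x h3
    rw [h1.2] at h4
    have h5 : fderiv ℂ (fun z => K z (Sum.inl i)) (toC (t + x • v)) (toC v) = 0 := by
      have h6 := (hasFDerivAt_pi'.mp (H.differentiableAt_K hx).hasFDerivAt (Sum.inl i)).fderiv
      rw [h6]
      change fderiv ℂ K (toC (t + x • v)) (toC v) (Sum.inl i) = 0
      rw [← jac_mulVec, jac_eq_fromBlocks, hvC, Matrix.fromBlocks_mulVec]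
      simp only [Sum.elim_inl]
      have h7 := H.ZV_eq hx
      rw [hB _ hx] at h7
      rw [h7]
      simp only [Function.comp_def, Sum.elim_inl, Sum.elim_inr]
      change ((XV K (toC (t + x • v)) *ᵥ -((B.map fun x => (x : ℂ)) *ᵥ toC s)) +
        (XV K (toC (t + x • v)) * B.map fun x => (x : ℂ)) *ᵥ toC s) i = 0
      rw [Matrix.mulVec_neg, Matrix.mulVec_mulVec, neg_add_cancel, Pi.zero_apply]
    rwa [h5] at h4
  have h := is_const_of_deriv_eq_zero (fun x => (hder x).differentiableAt)
    (fun x => (hder x).deriv) 1 0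
  simpa using h

end TorusHyp

/-- The translations of the straightened torus that come from deck transformations are zero or
bounded away from zero. -/
theorem exists_translation_separation (d n : ℕ) (ρ CDK CN : ℝ) (hρ : 0 < ρ) :
    ∃ η : ℝ, 0 < η ∧ ∀ {γ σ r Cf CJ : ℝ} {ω : AngleIdx d n → ℝ}
      {J : (PhaseIdx d n → ℝ) → Matrix (Fin d ⊕ Fin d) (Fin d ⊕ Fin d) ℝ}
      {Jc : (PhaseIdx d n → ℂ) → Matrix (Fin d ⊕ Fin d) (Fin d ⊕ Fin d) ℂ}
      {f : (PhaseIdx d n → ℝ) → (PhaseIdx d n → ℝ)}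
      {F : (PhaseIdx d n → ℂ) → (PhaseIdx d n → ℂ)}
      {K : (AngleIdx d n → ℂ) → (PhaseIdx d n → ℂ)} {B : Matrix (Fin d) (Fin n) ℝ},
      TorusHyp γ σ ρ r Cf CDK CN CJ ω J Jc f F K →
      (∀ θ ∈ openStrip d n ρ, (YV K θ)ᵀ * ZV K θ = B.map fun x => (x : ℂ)) →
      ∀ (l : AngleIdx d n → ℤ) (k : PhaseIdx d n → ℤ),
        (∀ θ ∈ strip d n ρ, K (fun j => θ j + (l j : ℂ)) = K θ + fun j => (k j : ℂ)) →
        ∀ lam : AngleIdx d n → ℝ, lam = Sum.elim ((fun i => (l (Sum.inl i) : ℝ)) +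
          B *ᵥ fun j => (l (Sum.inr j) : ℝ)) (fun j => (k (Sum.inr j) : ℝ)) →
        lam ≠ 0 → η ≤ ‖lam‖ := by
  set D : ℝ := ((Fintype.card (AngleIdx d n) : ℕ) : ℝ) with hD
  set D2 : ℝ := ((Fintype.card (Fin d ⊕ Fin d) : ℕ) : ℝ) with hD2
  set CY : ℝ := Fintype.card (Fin d) * (|CDK| * |CN|) with hCY
  set C₁ : ℝ := D * |CDK| with hC₁
  set C₂ : ℝ := D2 * |CY| * (D * (16 * |CDK| / ρ)) with hC₂
  have hC₁0 : 0 ≤ C₁ := by positivity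
  have hC₂0 : 0 ≤ C₂ := by positivity
  refine ⟨1 / (1 + C₁ + C₂), by positivity, ?_⟩
  intro γ σ r Cf CJ ω J Jc f F K B H hB l k hk lam hlam hne
  by_contra! hlt
  apply hne
  have hlt1 : ‖lam‖ < 1 := hlt.trans_le (by rw [div_le_one (by positivity)]; linarith)
  set e : Fin d → ℝ := (fun i => (l (Sum.inl i) : ℝ)) + B *ᵥ fun j => (l (Sum.inr j) : ℝ) with he
  have hkN : ∀ j, k (Sum.inr j) = 0 := by
    intro j
    have h1 := (norm_le_pi_norm lam (Sum.inr j)).trans_lt hlt1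
    rw [hlam, Sum.elim_inr, Real.norm_eq_abs] at h1
    exact Int.abs_lt_one_iff.mp (by exact_mod_cast h1)
  set E : AngleIdx d n → ℝ := Sum.elim e 0 with hE
  have hEe : ‖E‖ = ‖e‖ := by
    refine le_antisymm ?_ ?_
    · refine (pi_norm_le_iff_of_nonneg (norm_nonneg _)).mpr fun i => ?_
      rcases i with i | i
      · exact norm_le_pi_norm e i
      · simp [hE]
    · exact (pi_norm_le_iff_of_nonneg (norm_nonneg _)).mpr fun i => norm_le_pi_norm E (Sum.inl i)
  have helam : ‖e‖ ≤ ‖lam‖ := by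
    refine (pi_norm_le_iff_of_nonneg (norm_nonneg _)).mpr fun i => ?_
    have := norm_le_pi_norm lam (Sum.inl i)
    rw [hlam] at this ⊢
    exact this
  -- moving by the deck transformation or by `E` has the same effect on the `V`-part
  have hKE : ∀ i, K (toC E) (Sum.inl i) = K (toC 0) (Sum.inl i) + (k (Sum.inl i) : ℂ) := by
    intro i
    have h1 := congrFun (hk (toC 0) (toC_mem_strip hρ.le 0)) (Sum.inl i)
    have h2 := H.K_inl_add_slope hB E (fun j => (l (Sum.inr j) : ℝ)) i
    have h3 : (toC (E + Sum.elim (-(B *ᵥ fun j => (l (Sum.inr j) : ℝ)))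
        (fun j => (l (Sum.inr j) : ℝ))) : AngleIdx d n → ℂ) =
        fun j => toC (0 : AngleIdx d n → ℝ) j + (l j : ℂ) := by
      ext j
      rcases j with j | j
      · simp [toC, hE, he]
      · simp [toC, hE]
    rw [h3, h1] at h2
    exact h2.symm
  have h0 := toC_mem_openStrip (d := d) (n := n) hρ 0
  have hk0 : ∀ i, k (Sum.inl i) = 0 := by
    intro i
    have h1 := H.norm_K_sub_le h0 (toC_mem_openStrip hρ E)
    have h2 := norm_le_pi_norm (K (toC E) - K (toC 0)) (Sum.inl i)
    rw [Pi.sub_apply, hKE, add_sub_cancel_left, Complex.norm_intCast] at h2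
    have h3 : (toC E - toC 0 : AngleIdx d n → ℂ) = toC E := by ext; simp [toC]
    rw [h3, norm_toC, hEe] at h1
    have h4 : C₁ * ‖e‖ < 1 := by
      have h5 : ‖e‖ < 1 / (1 + C₁ + C₂) := helam.trans_lt hlt
      rw [lt_div_iff₀ (by positivity)] at h5
      nlinarith [norm_nonneg e]
    exact Int.abs_lt_one_iff.mp (by exact_mod_cast h2.trans_lt (h1.trans_lt h4))
  -- so `X_V e` is quadratically small, and `e = Y_Vᵀ X_V e`
  have he0 : e = 0 := by
    have h1 := H.norm_taylor_le (θ := toC 0) (toC_mem_strip (by positivity) 0) E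
    have h2 : shift E (toC 0) = toC E := by ext; simp [shift, toC]
    rw [h2, hEe] at h1
    set w : Fin d ⊕ Fin d → ℂ := XV K (toC 0) *ᵥ toC e with hw
    have h3 : ‖w‖ ≤ D * (16 * |CDK| / ρ) * ‖e‖ ^ 2 := by
      refine le_trans ?_ h1
      refine (pi_norm_le_iff_of_nonneg (norm_nonneg _)).mpr fun i => ?_
      have h4 := norm_le_pi_norm (K (toC E) - K (toC 0) - jac ℂ K (toC 0) *ᵥ toC E) (Sum.inl i)
      have h5 : (jac ℂ K (toC 0) *ᵥ toC E) (Sum.inl i) = w i := by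
        have h6 : (toC E : AngleIdx d n → ℂ) = Sum.elim (toC e) 0 := by
          ext j
          rcases j with j | j <;> simp [hE, toC]
        rw [h6, jac_eq_fromBlocks, Matrix.fromBlocks_mulVec]
        simp only [Sum.elim_inl]
        change (XV K (toC 0) *ᵥ toC e + ZV K (toC 0) *ᵥ 0) i = w i
        rw [Matrix.mulVec_zero, add_zero]
      rw [Pi.sub_apply, Pi.sub_apply, hKE, hk0, h5] at h4
      simpa using h4
    have h6 : (YV K (toC 0))ᵀ *ᵥ w = toC e := by
      rw [hw, Matrix.mulVec_mulVec, H.YV_transpose_mul_XV h0, Matrix.one_mulVec]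
    have h7 := (H.entriesLE_YV h0).transpose.norm_mulVec_le (v := w)
    rw [h6, norm_toC] at h7
    have h8 : ‖e‖ ≤ C₂ * ‖e‖ ^ 2 :=
      h7.trans ((mul_le_mul_of_nonneg_left h3 (by positivity)).trans (le_of_eq (by rw [hC₂]; ring)))
    by_contra hne0
    have hpos : 0 < ‖e‖ := norm_pos_iff.mpr hne0
    have h5 : ‖e‖ < 1 / (1 + C₁ + C₂) := helam.trans_lt hlt
    rw [lt_div_iff₀ (by positivity)] at h5
    nlinarith
  rw [hlam, he0]
  ext j
  rcases j with j | j
  · rfl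
  · simp [hkN j]

/-- The inverse frame `M⁻¹` of a non-degenerate torus is bounded in terms of the bounds for the
torus: nondegeneracy is automatically quantitative. Along the real torus `det M` is, up to a
bounded factor, the Jacobian of an equivariant local diffeomorphism, so it is not small everywhere;
off the real torus Harnack's inequality applies to the zero-free function `det M`. -/
theorem exists_entriesLE_matM_inv (d n : ℕ) (ρ r Cf CDK CN CJ : ℝ) (hρ : 0 < ρ) :
    ∃ C : ℝ, 0 < C ∧ ∀ {γ σ : ℝ} {ω : AngleIdx d n → ℝ}
      {J : (PhaseIdx d n → ℝ) → Matrix (Fin d ⊕ Fin d) (Fin d ⊕ Fin d) ℝ}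
      {Jc : (PhaseIdx d n → ℂ) → Matrix (Fin d ⊕ Fin d) (Fin d ⊕ Fin d) ℂ}
      {f : (PhaseIdx d n → ℝ) → (PhaseIdx d n → ℝ)}
      {F : (PhaseIdx d n → ℂ) → (PhaseIdx d n → ℂ)}
      {K : (AngleIdx d n → ℂ) → (PhaseIdx d n → ℂ)},
      TorusHyp γ σ ρ r Cf CDK CN CJ ω J Jc f F K → ∀ θ ∈ strip d n (7 * ρ / 8),
        EntriesLE (matM Jc K θ)⁻¹ C := by
  obtain ⟨C₁, hC₁, hfr⟩ := exists_entriesLE_matM d n ρ r Cf CDK CN CJ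
  obtain ⟨η, hη, hsep⟩ := exists_translation_separation d n ρ CDK CN hρ
  set D := Fintype.card (AngleIdx d n)
  set CV : ℝ := (Fintype.card (Fin d ⊕ Fin d)).factorial * |C₁| ^ Fintype.card (Fin d ⊕ Fin d)
    with hCV
  set CM : ℝ := (Fintype.card (PhaseIdx d n)).factorial * |C₁| ^ Fintype.card (PhaseIdx d n)
    with hCM
  have hCV0 : 0 < CV := by positivity
  have hCM0 : 0 < CM := by positivity
  obtain ⟨c, hc, hlow⟩ := exists_lower_bound_of_nonvanishing d n (ρ := ρ) (ρ' := 7 * ρ / 8)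
    (C := CM) (c₀ := η ^ D / 2 / CV) (by positivity) (by linarith) hCM0 (by positivity)
  refine ⟨c⁻¹ * ((Fintype.card (PhaseIdx d n)).factorial *
    (max |C₁| 1) ^ Fintype.card (PhaseIdx d n)), by positivity, ?_⟩
  intro γ σ ω J Jc f F K H θ hθ
  have hθ' : θ ∈ openStrip d n ρ := strip_subset_openStrip (by linarith) hθ
  refine (hfr H θ hθ').1.inv hc ?_
  refine hlow (fun θ => (matM Jc K θ).det) (differentiableOn_det H.torusMat_matM.holo)
    (fun θ hθ l => by simp only [H.torusMat_matM.per θ hθ l])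
    (fun θ hθ => (H.isUnit_matM hθ).ne_zero) (fun θ hθ => (hfr H θ hθ).1.norm_det_le) ?_ θ hθ
  obtain ⟨B, hB⟩ := H.exists_slope
  choose k hk0 hk using fun l => H.torus.exists_period l
  have hdet : ∀ t, (straightenedJac B K t).det ≠ 0 := by
    intro t h0
    have h1 := H.det_straightenedJac hB t
    have ht := toC_mem_openStrip (d := d) (n := n) H.ρ_pos t
    have h2 : (TorusHyp.frameV Jc K (toC t)).det ≠ 0 := by
      have h3 := congrArg Matrix.det (H.frameV_mul ht)
      rw [Matrix.det_mul, Matrix.det_one] at h3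
      exact left_ne_zero_of_mul_eq_one h3
    rw [h0, Complex.ofReal_zero] at h1
    exact mul_ne_zero h2 (H.isUnit_matM ht).ne_zero h1.symm
  obtain ⟨t, ht⟩ := exists_le_abs_det hη (H.contDiff_straightened (B := B))
    H.hasFDerivAt_straightened hdet
    (lam := fun l => Sum.elim ((fun i => (l (Sum.inl i) : ℝ)) +
          B *ᵥ fun j => (l (Sum.inr j) : ℝ)) (fun j => (k l (Sum.inr j) : ℝ))) (by
      intro t l
      ext j
      rcases j with j | j
      · simp only [straightened, Sum.elim_inl, Pi.add_apply, mulVec, dotProduct, mul_add,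
          Finset.sum_add_distrib]
        ring
      · simp only [straightened, Sum.elim_inr, Pi.add_apply, realTorus]
        have h1 := congrFun (hk l (toC t) (toC_mem_strip hρ.le t)) (Sum.inr j)
        have h2 : (toC (fun j => t j + (l j : ℝ)) : AngleIdx d n → ℂ) =
            fun j => toC t j + (l j : ℂ) := by ext; simp [toC]
        rw [h2, h1]
        simp)
    (fun l hl => hsep H hB l (k l) (hk l) _ rfl hl)
  refine ⟨t, ?_⟩
  rw [div_le_iff₀ hCV0]
  refine ht.trans ?_
  rw [← Real.norm_eq_abs, ← Complex.norm_real, H.det_straightenedJac hB, norm_mul, mul_comm]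
  exact mul_le_mul_of_nonneg_left (hfr H _ (toC_mem_openStrip hρ t)).2.norm_det_le (norm_nonneg _)

end

/-! ### The reduced cohomological equations -/

section

section Mean

variable {d n : ℕ} {ρ : ℝ} {κ μ ν : Type*}

/-- The entrywise mean value of a matrix function over the real torus. -/
noncomputable def meanMat (A : (AngleIdx d n → ℂ) → Matrix κ μ ℂ) : Matrix κ μ ℂ :=
  Matrix.of fun i j => torusMean fun θ => A θ i j

theorem TorusMat.mono {A : (AngleIdx d n → ℂ) → Matrix κ μ ℂ} {ρ' : ℝ} (hA : TorusMat ρ A)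
    (h : ρ' ≤ ρ) : TorusMat ρ' A where
  holo i j := (hA.holo i j).mono (openStrip_mono h)
  per θ hθ l := hA.per θ (openStrip_mono h hθ) l
  real := hA.real

theorem TorusMat.integrableOn {A : (AngleIdx d n → ℂ) → Matrix κ μ ℂ} (hA : TorusMat ρ A)
    (hρ : 0 < ρ) (i : κ) (j : μ) :
    IntegrableOn (fun t => A (toC t) i j) (Icc (0 : AngleIdx d n → ℝ) 1) := by
  refine Continuous.integrableOn_Icc ?_
  exact (hA.holo i j).continuousOn.comp_continuous continuous_toC
    fun t => toC_mem_openStrip hρ t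

theorem meanMat_add {A B : (AngleIdx d n → ℂ) → Matrix κ μ ℂ} (hA : TorusMat ρ A)
    (hB : TorusMat ρ B) (hρ : 0 < ρ) :
    meanMat (fun θ => A θ + B θ) = meanMat A + meanMat B := by
  ext i j
  exact integral_add (hA.integrableOn hρ i j) (hB.integrableOn hρ i j)

theorem meanMat_mul_const [Fintype μ] {A : (AngleIdx d n → ℂ) → Matrix κ μ ℂ}
    (hA : TorusMat ρ A) (hρ : 0 < ρ) (B : Matrix μ ν ℂ) :
    meanMat (fun θ => A θ * B) = meanMat A * B := by
  ext i j
  simp only [meanMat, torusMean, Matrix.of_apply, Matrix.mul_apply]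
  rw [integral_finsetSum _ fun k _ => (hA.integrableOn hρ i k).mul_const _]
  exact Finset.sum_congr rfl fun k _ => integral_mul_const _ _

theorem meanMat_shift {A : (AngleIdx d n → ℂ) → Matrix κ μ ℂ} (hA : TorusMat ρ A)
    (hρ : 0 < ρ) (ω : AngleIdx d n → ℝ) : meanMat (fun θ => A (shift ω θ)) = meanMat A := by
  ext i j
  exact torusMean_shift (fun t => toC_mem_openStrip hρ t) (hA.periodicOn i j) ω

theorem meanMat_congr {A B : (AngleIdx d n → ℂ) → Matrix κ μ ℂ}
    (h : ∀ t, A (toC t) = B (toC t)) : meanMat A = meanMat B := by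
  ext i j
  simp only [meanMat, torusMean, Matrix.of_apply, h]

theorem entriesLE_meanMat {A : (AngleIdx d n → ℂ) → Matrix κ μ ℂ} {C : ℝ}
    (h : ∀ t, EntriesLE (A (toC t)) C) : EntriesLE (meanMat A) C := by
  intro i j
  have h1 := norm_setIntegral_le_of_norm_le_const (μ := volume)
    (s := Icc (0 : AngleIdx d n → ℝ) 1) (f := fun t => A (toC t) i j) (C := C)
    (isCompact_Icc.measure_lt_top) fun t _ => h t i j
  simpa [meanMat, torusMean, Measure.real, Real.volume_Icc_pi] using h1

/-- The mean value of a matrix function that is real at real angles is real. -/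
theorem meanMat_eq_map {A : (AngleIdx d n → ℂ) → Matrix κ μ ℂ} (hA : TorusMat ρ A) :
    meanMat A = (Matrix.of fun i j => ∫ t in Icc (0 : AngleIdx d n → ℝ) 1,
      (A (toC t) i j).re).map fun x => (x : ℂ) := by
  ext i j
  simp only [meanMat, torusMean, Matrix.of_apply, Matrix.map_apply]
  rw [← integral_complex_ofReal]
  simp only [hA.ofReal_re]

end Mean

/-- Quantitative solution of the linearized conjugacy equation in the adapted frame: the transverse
component `y` satisfies a cohomological equation, which determines it up to its mean value, and the
mean value is determined by solvability of the equation for the tangential components `q`, through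
the left inverse `L` of the averaged twist `S`. -/
theorem exists_reduced_bound (d n : ℕ) (σ CS CL : ℝ) :
    ∃ (C : ℝ) (k : ℕ), 0 < C ∧ ∀ {γ a δ E : ℝ} {ω : AngleIdx d n → ℝ}
      {S : (AngleIdx d n → ℂ) → Matrix (AngleIdx d n) (Fin d) ℂ}
      {q Rq : (AngleIdx d n → ℂ) → Matrix (AngleIdx d n) Unit ℂ}
      {y Ry : (AngleIdx d n → ℂ) → Matrix (Fin d) Unit ℂ}
      {L : Matrix (Fin d) (AngleIdx d n) ℂ},
      0 < γ → γ ≤ 1 → Diophantine γ σ ω → 0 < δ → δ ≤ 1 → 2 * δ < a → 0 ≤ E →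
      TorusMat a S → TorusMat a q → TorusMat a y → TorusMat a Rq → TorusMat a Ry →
      (∀ θ ∈ openStrip d n a, EntriesLE (S θ) CS) →
      (∀ θ ∈ openStrip d n a, EntriesLE (Rq θ) E) → (∀ θ ∈ openStrip d n a, EntriesLE (Ry θ) E) →
      (∀ θ ∈ openStrip d n a, y (shift ω θ) = y θ + Ry θ) →
      (∀ θ ∈ openStrip d n a, q (shift ω θ) = q θ + (S θ * y θ + Rq θ)) →
      L * meanMat S = 1 → EntriesLE L CL →
      ∀ θ ∈ openStrip d n (a - 2 * δ), EntriesLE (y θ) (C / (γ ^ 2 * δ ^ k) * E) ∧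
        EntriesLE (q θ - meanMat q) (C / (γ ^ 2 * δ ^ k) * E) := by
  obtain ⟨C₀, k, hC₀, hcoh⟩ := exists_cohomological_bound d n σ
  set D : ℝ := ((Fintype.card (AngleIdx d n) : ℕ) : ℝ) with hD
  set D' : ℝ := ((Fintype.card (Fin d) : ℕ) : ℝ) with hD'
  set c₂ : ℝ := C₀ + D * (|CL| * (D' * (|CS| * C₀) + 1)) with hc₂
  set c₃ : ℝ := D' * (|CS| * c₂) + 1 with hc₃
  have hc₂0 : 0 < c₂ := by positivity
  have hc₃0 : 0 < c₃ := by positivity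
  refine ⟨c₂ + C₀ * c₃, 2 * k, by positivity, ?_⟩
  intro γ a δ E ω S q Rq y Ry L hγ hγ1 hω hδ hδ1 hδa hE hS hq hy hRq hRy hSb hRqb hRyb hyeq hqeq hL
    hLb
  have ha : 0 < a := by linarith
  set Q : ℝ := 1 / (γ * δ ^ k) with hQ
  have hQ1 : 1 ≤ Q := by
    rw [hQ, le_div_iff₀ (by positivity), one_mul]
    exact mul_le_one₀ hγ1 (by positivity) (pow_le_one₀ hδ.le hδ1)
  have hEQ : E ≤ Q * E := le_mul_of_one_le_left hE hQ1
  have hQE : 0 ≤ Q * E := by positivity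
  -- the transverse component, up to its mean value
  have h1 : ∀ θ ∈ openStrip d n (a - δ), EntriesLE (y θ - meanMat y) (C₀ * (Q * E)) := by
    intro θ hθ i j
    have := hcoh γ ω hγ hω a δ E (fun θ => y θ i j) (fun θ => Ry θ i j) hδ (hy.holo i j)
      (hRy.holo i j) (hy.periodicOn i j) (fun θ hθ => by rw [hyeq θ hθ]; rfl)
      (fun θ hθ => hRyb θ hθ i j) θ hθ
    refine this.trans (le_of_eq ?_)
    rw [hQ]; ring
  have hreal : ∀ t : AngleIdx d n → ℝ, toC t ∈ openStrip d n (a - δ) :=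
    fun t => toC_mem_openStrip (by linarith) t
  have hreal' : ∀ t : AngleIdx d n → ℝ, toC t ∈ openStrip d n a := fun t => toC_mem_openStrip ha t
  -- the mean value of the transverse component
  have hyc : TorusMat (d := d) (n := n) a fun _ => meanMat y :=
    .const (by rw [meanMat_eq_map hy, map_ofReal_map_conj])
  have h2 : meanMat S * meanMat y =
      -(meanMat (fun θ => S θ * (y θ - meanMat y)) + meanMat Rq) := by
    have e1 := meanMat_shift hq ha ω
    rw [meanMat_congr (B := fun θ => q θ + (S θ * y θ + Rq θ)) fun t => hqeq _ (hreal' t),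
      meanMat_add hq ((hS.mul hy).add hRq) ha, add_eq_left, meanMat_add (hS.mul hy) hRq ha] at e1
    have e2 : meanMat (fun θ => S θ * y θ) =
        meanMat (fun θ => S θ * (y θ - meanMat y)) + meanMat S * meanMat y := by
      rw [← meanMat_mul_const hS ha, ← meanMat_add (hS.mul (hy.sub hyc)) (hS.mul hyc) ha]
      simp only [← Matrix.mul_add, sub_add_cancel]
    rw [e2] at e1
    rw [eq_neg_iff_add_eq_zero, ← e1]
    abel
  have h3 : EntriesLE (meanMat y) (D * (|CL| * (D' * (|CS| * C₀) + 1)) * (Q * E)) := by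
    have e1 : meanMat y = L * (meanMat S * meanMat y) := by
      rw [← Matrix.mul_assoc, hL, Matrix.one_mul]
    have e2 : EntriesLE (meanMat (fun θ => S θ * (y θ - meanMat y)) + meanMat Rq)
        ((D' * (|CS| * C₀) + 1) * (Q * E)) := by
      intro i j
      refine (norm_add_le _ _).trans ?_
      have e3 := entriesLE_meanMat (A := fun θ => S θ * (y θ - meanMat y))
        (fun t => (hSb _ (hreal' t)).mul (h1 _ (hreal t))) i j
      have e4 := entriesLE_meanMat (fun t => hRqb _ (hreal' t)) i j
      rw [abs_of_nonneg (by positivity : 0 ≤ C₀ * (Q * E))] at e3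
      refine (add_le_add e3 (e4.trans hEQ)).trans (le_of_eq ?_)
      rw [hD']; ring
    rw [e1, h2]
    have e5 := hLb.mul e2.neg
    rw [abs_of_nonneg (by positivity : 0 ≤ (D' * (|CS| * C₀) + 1) * (Q * E))] at e5
    exact e5.mono (le_of_eq (by rw [hD]; ring))
  have h4 : ∀ θ ∈ openStrip d n (a - δ), EntriesLE (y θ) (c₂ * (Q * E)) := by
    intro θ hθ i j
    have e1 : y θ i j = (y θ - meanMat y) i j + meanMat y i j := by simp
    rw [e1]
    refine (norm_add_le _ _).trans ((add_le_add (h1 θ hθ i j) (h3 i j)).trans (le_of_eq ?_))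
    rw [hc₂]; ring
  have h5 : ∀ θ ∈ openStrip d n (a - δ), EntriesLE (S θ * y θ + Rq θ) (c₃ * (Q * E)) := by
    intro θ hθ i j
    have hθ' : θ ∈ openStrip d n a := openStrip_mono (by linarith) hθ
    have e1 := (hSb θ hθ').mul (h4 θ hθ) i j
    rw [abs_of_nonneg (by positivity : 0 ≤ c₂ * (Q * E))] at e1
    refine (norm_add_le _ _).trans ((add_le_add e1 ((hRqb θ hθ' i j).trans hEQ)).trans
      (le_of_eq ?_))
    rw [hc₃, hD']; ring
  have hsub : openStrip d n (a - δ) ⊆ openStrip d n a := openStrip_mono (by linarith)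
  have hfin : (c₂ + C₀ * c₃) / (γ ^ 2 * δ ^ (2 * k)) * E = (c₂ + C₀ * c₃) * (Q * (Q * E)) := by
    rw [hQ, pow_mul' δ 2 k]; field_simp
  have hQQ : Q * E ≤ Q * (Q * E) := le_mul_of_one_le_left hQE hQ1
  intro θ hθ
  rw [hfin]
  constructor
  · refine (h4 θ (openStrip_mono (by linarith) hθ)).mono ?_
    calc c₂ * (Q * E) ≤ c₂ * (Q * (Q * E)) := by gcongr
      _ ≤ (c₂ + C₀ * c₃) * (Q * (Q * E)) := by gcongr; linarith [mul_pos hC₀ hc₃0]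
  · intro i j
    have := hcoh γ ω hγ hω (a - δ) δ (c₃ * (Q * E)) (fun θ => q θ i j)
      (fun θ => (S θ * y θ + Rq θ) i j) hδ ((hq.holo i j).mono hsub)
      ((((hS.mul hy).add hRq).holo i j).mono hsub) (fun θ hθ l => hq.periodicOn i j θ (hsub hθ) l)
      (fun θ hθ => by rw [hqeq θ (hsub hθ)]; rfl)
      (fun θ hθ => h5 θ hθ i j) θ (openStrip_mono (by linarith) hθ)
    refine this.trans ?_
    have e1 : C₀ / (γ * δ ^ k) * (c₃ * (Q * E)) = C₀ * c₃ * (Q * (Q * E)) := by rw [hQ]; ring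
    rw [e1]
    gcongr
    linarith

end

/-! ### Invariant tori close to a given one -/

section

variable {d n : ℕ}

/-- The properties of an invariant torus that are used for the torus `K₂` and its translates. -/
structure IsAnalyticInvariant (a : ℝ) (F : (PhaseIdx d n → ℂ) → (PhaseIdx d n → ℂ))
    (ω : AngleIdx d n → ℝ) (G : (AngleIdx d n → ℂ) → (PhaseIdx d n → ℂ)) : Prop where
  holo : DifferentiableOn ℂ G (openStrip d n a)
  per : ∀ θ ∈ openStrip d n a, ∀ l : AngleIdx d n → ℤ, SameInM (G fun j => θ j + l j) (G θ)
  real : ∀ t : AngleIdx d n → ℝ, ∃ u : PhaseIdx d n → ℝ, G (toC t) = toC u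
  inv : ∀ θ ∈ openStrip d n a, SameInM (F (G θ)) (G (shift ω θ))

theorem shift_shift (s t : AngleIdx d n → ℝ) (θ : AngleIdx d n → ℂ) :
    shift s (shift t θ) = shift (t + s) θ := by
  simp [shift, toC_add, add_assoc]

theorem shift_zero (θ : AngleIdx d n → ℂ) : shift 0 θ = θ := by
  ext; simp [shift, toC]

theorem shift_add_int (τ : AngleIdx d n → ℝ) (θ : AngleIdx d n → ℂ) (l : AngleIdx d n → ℤ) :
    shift τ (fun j => θ j + (l j : ℂ)) = fun j => shift τ θ j + (l j : ℂ) := by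
  ext j; simp [shift]; ring

theorem IsAnalyticInvariant.mono {a b : ℝ} {F : (PhaseIdx d n → ℂ) → (PhaseIdx d n → ℂ)}
    {ω : AngleIdx d n → ℝ} {G : (AngleIdx d n → ℂ) → (PhaseIdx d n → ℂ)}
    (hG : IsAnalyticInvariant a F ω G) (h : b ≤ a) : IsAnalyticInvariant b F ω G where
  holo := hG.holo.mono (openStrip_mono h)
  per θ hθ := hG.per θ (openStrip_mono h hθ)
  real := hG.real
  inv θ hθ := hG.inv θ (openStrip_mono h hθ)

theorem IsAnalyticInvariant.comp_shift {a : ℝ} {F : (PhaseIdx d n → ℂ) → (PhaseIdx d n → ℂ)}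
    {ω : AngleIdx d n → ℝ} {G : (AngleIdx d n → ℂ) → (PhaseIdx d n → ℂ)}
    (hG : IsAnalyticInvariant a F ω G) (τ : AngleIdx d n → ℝ) :
    IsAnalyticInvariant a F ω fun θ => G (shift τ θ) where
  holo := by
    refine hG.holo.comp ?_ fun θ hθ => (shift_mem_openStrip τ).mpr hθ
    unfold shift; fun_prop
  per θ hθ l := by
    rw [shift_add_int]
    exact hG.per _ ((shift_mem_openStrip τ).mpr hθ) l
  real t := by
    rw [shift, ← toC_add]; exact hG.real _
  inv θ hθ := by
    have := hG.inv _ ((shift_mem_openStrip τ).mpr hθ)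
    rwa [shift_shift, add_comm, ← shift_shift] at this

/-- The twist `(S₁; A)` is bounded in terms of the bounds for the torus. -/
theorem exists_entriesLE_twist (d n : ℕ) (ρ r Cf CDK CN CJ : ℝ) (hρ : 0 < ρ) :
    ∃ C : ℝ, ∀ {γ σ : ℝ} {ω : AngleIdx d n → ℝ}
      {J : (PhaseIdx d n → ℝ) → Matrix (Fin d ⊕ Fin d) (Fin d ⊕ Fin d) ℝ}
      {Jc : (PhaseIdx d n → ℂ) → Matrix (Fin d ⊕ Fin d) (Fin d ⊕ Fin d) ℂ}
      {f : (PhaseIdx d n → ℝ) → (PhaseIdx d n → ℝ)}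
      {F : (PhaseIdx d n → ℂ) → (PhaseIdx d n → ℂ)}
      {K : (AngleIdx d n → ℂ) → (PhaseIdx d n → ℂ)},
      TorusHyp γ σ ρ r Cf CDK CN CJ ω J Jc f F K → ∀ θ ∈ strip d n (7 * ρ / 8),
        EntriesLE (Matrix.fromRows (matS1 Jc F ω K θ) (matA Jc F ω K θ)) C := by
  obtain ⟨C₁, -, h1⟩ := exists_entriesLE_matM d n ρ r Cf CDK CN CJ
  obtain ⟨C₂, -, h2⟩ := exists_entriesLE_matM_inv d n ρ r Cf CDK CN CJ hρ
  have hsub : strip d n (7 * ρ / 8) ⊆ openStrip d n ρ := strip_subset_openStrip (by linarith)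
  refine ⟨?C, ?_⟩
  rotate_left
  · intro γ σ ω J Jc f F K H θ hθ
    have hθ' := (shift_mem_strip ω).mpr hθ
    have hJY : ∀ φ ∈ strip d n (7 * ρ / 8), EntriesLE (fullJY Jc K φ) C₁ := fun φ hφ => by
      have := (h1 H φ (hsub hφ)).1.submatrix id (fun j : Fin d => Sum.inl (Sum.inr j))
      rwa [matM_eq_fromCols] at this
    have hP : EntriesLE (jac ℂ F (K θ)) Cf := fun i j => by
      rw [jac_apply]
      refine (norm_le_pi_norm _ i).trans ((ContinuousLinearMap.le_opNorm _ _).trans ?_)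
      rw [← norm_iteratedFDeriv_one]
      refine le_trans ?_ (H.extF.bound_one _ (H.K_mem (hsub hθ)))
      simp [Pi.norm_single]
    have hQ := (hP.mul (hJY θ hθ)).sub (hJY _ hθ')
    have hA := ((h2 H _ hθ').submatrix Sum.inr id).mul hQ
    have hZ : EntriesLE (fullZ K (shift ω θ)) C₁ := by
      have := (h1 H _ (hsub hθ')).1.submatrix id (fun j : Fin n => Sum.inr j)
      rwa [matM_eq_fromCols] at this
    exact (((H.entriesLE_YV (hsub hθ')).transpose.fromCols .zero).mul
      (hQ.sub (hZ.mul hA))).fromRows hA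

namespace TorusHyp

variable {γ σ ρ r Cf CDK CN CJ : ℝ} {ω : AngleIdx d n → ℝ}
  {J : (PhaseIdx d n → ℝ) → Matrix (Fin d ⊕ Fin d) (Fin d ⊕ Fin d) ℝ}
  {Jc : (PhaseIdx d n → ℂ) → Matrix (Fin d ⊕ Fin d) (Fin d ⊕ Fin d) ℂ}
  {f : (PhaseIdx d n → ℝ) → (PhaseIdx d n → ℝ)}
  {F : (PhaseIdx d n → ℂ) → (PhaseIdx d n → ℂ)}
  {K G : (AngleIdx d n → ℂ) → (PhaseIdx d n → ℂ)} {θ : AngleIdx d n → ℂ} {a ε : ℝ}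

theorem ball_subset (_ : TorusHyp γ σ ρ r Cf CDK CN CJ ω J Jc f F K)
    (hθ : θ ∈ openStrip d n ρ) : Metric.ball (K θ) r ⊆ nbhd ρ r K :=
  ball_subset_nbhd (openStrip_subset_strip ρ hθ) (SameInM.refl _)

theorem norm_F_sub_le (H : TorusHyp γ σ ρ r Cf CDK CN CJ ω J Jc f F K)
    (hθ : θ ∈ openStrip d n ρ) {z : PhaseIdx d n → ℂ} (hz : ‖z - K θ‖ < r) :
    ‖F z - F (K θ)‖ ≤ |Cf| * ‖z - K θ‖ := by
  refine (convex_ball (K θ) r).norm_image_sub_le_of_norm_fderiv_le (𝕜 := ℂ)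
    (fun x hx => H.differentiableAt_F (H.ball_subset hθ hx)) (fun x hx => ?_)
    (Metric.mem_ball_self H.r_pos) (mem_ball_iff_norm.mpr hz)
  rw [← norm_iteratedFDeriv_one]
  exact (H.extF.bound_one _ (H.ball_subset hθ hx)).trans (le_abs_self _)

theorem norm_F_taylor_le (H : TorusHyp γ σ ρ r Cf CDK CN CJ ω J Jc f F K)
    (hθ : θ ∈ openStrip d n ρ) {z : PhaseIdx d n → ℂ} (hz : ‖z - K θ‖ < r) :
    ‖F z - F (K θ) - jac ℂ F (K θ) *ᵥ (z - K θ)‖ ≤ |Cf| * ‖z - K θ‖ ^ 2 := by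
  have hC2 : ContDiffOn ℂ 2 F (nbhd ρ r K) :=
    contDiffOn_pi_of_differentiableOn isOpen_nbhd H.extF.holomorphic 2
  have hK := Metric.mem_ball_self (x := K θ) H.r_pos
  have hzb : z ∈ Metric.ball (K θ) r := mem_ball_iff_norm.mpr hz
  have hseg : segment ℝ (K θ) z ⊆ Metric.ball (K θ) r := (convex_ball _ _).segment_subset hK hzb
  have hlip : ∀ x ∈ segment ℝ (K θ) z, ‖fderiv ℂ F x - fderiv ℂ F (K θ)‖ ≤ |Cf| * ‖z - K θ‖ := by
    intro x hx
    have h1 := (convex_ball (K θ) r).norm_image_sub_le_of_norm_fderiv_le (𝕜 := ℂ)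
      (f := fderiv ℂ F) (C := |Cf|) (fun x hx => ?_) (fun x hx => ?_) hK (hseg hx)
    · refine h1.trans ?_
      gcongr
      exact norm_sub_le_of_mem_segment hx
    · have h2 : ContDiffAt ℂ 2 F x := hC2.contDiffAt (isOpen_nbhd.mem_nhds (H.ball_subset hθ hx))
      exact (h2.fderiv_right (m := 1) (by norm_num)).differentiableAt one_ne_zero
    · rw [← norm_iteratedFDeriv_one, norm_iteratedFDeriv_fderiv]
      exact (H.extF.bound_two _ (H.ball_subset hθ hx)).trans (le_abs_self _)
  have h := (convex_segment (K θ) z).norm_image_sub_le_of_norm_fderiv_le' (𝕜 := ℂ) (f := F)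
    (φ := fderiv ℂ F (K θ)) (fun x hx => H.differentiableAt_F (H.ball_subset hθ (hseg hx)))
    hlip (left_mem_segment ℝ _ _) (right_mem_segment ℝ _ _)
  rw [jac_mulVec]
  exact h.trans (le_of_eq (by ring))

/-- The difference of two close tori is periodic. -/
theorem sub_periodic (H : TorusHyp γ σ ρ r Cf CDK CN CJ ω J Jc f F K) (ha : a ≤ ρ)
    (hG : IsAnalyticInvariant a F ω G) (hε : ∀ θ ∈ openStrip d n a, ‖G θ - K θ‖ ≤ ε)
    (hε1 : 2 * ε < 1) (hθ : θ ∈ openStrip d n a) (l : AngleIdx d n → ℤ) :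
    G (fun j => θ j + l j) - K (fun j => θ j + l j) = G θ - K θ := by
  obtain ⟨k, -, hk⟩ := hG.per θ hθ l
  obtain ⟨k', -, hk'⟩ := H.torus.exists_period l
  have h1 : G (fun j => θ j + l j) - K (fun j => θ j + l j) =
      G θ - K θ + fun j => (((k - k') j : ℤ) : ℂ) := by
    ext j
    rw [hk' θ (openStrip_subset_strip ρ (openStrip_mono ha hθ))]
    simp only [Pi.sub_apply, Pi.add_apply, hk j]
    push_cast; ring
  have h2 : k - k' = 0 := by
    refine eq_of_int_norm_lt_one (lt_of_le_of_lt ?_ hε1)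
    rw [← add_sub_cancel_left (G θ - K θ) fun j => (((k - k') j : ℤ) : ℂ), ← h1]
    refine (norm_sub_le _ _).trans ?_
    linarith [hε θ hθ, hε _ (add_int_mem_openStrip hθ l)]
  rw [h1, h2]
  ext j; simp

/-- The difference of two close invariant tori is carried along by the map. -/
theorem F_sub_F (H : TorusHyp γ σ ρ r Cf CDK CN CJ ω J Jc f F K) (ha : a ≤ ρ)
    (hG : IsAnalyticInvariant a F ω G) (hε : ∀ θ ∈ openStrip d n a, ‖G θ - K θ‖ ≤ ε)
    (hεr : ε < r) (hε1 : (|Cf| + 1) * ε < 1) (hθ : θ ∈ openStrip d n a) :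
    F (G θ) - F (K θ) = G (shift ω θ) - K (shift ω θ) := by
  have hθρ := openStrip_mono ha hθ
  obtain ⟨k, -, hk⟩ := hG.inv θ hθ
  obtain ⟨k', hk'⟩ := H.exists_conj
  have h1 : F (G θ) - F (K θ) = G (shift ω θ) - K (shift ω θ) + fun j => (((k - k') j : ℤ) : ℂ) := by
    ext j
    rw [hk' θ (openStrip_subset_strip ρ hθρ)]
    simp only [Pi.sub_apply, Pi.add_apply, hk j]
    push_cast; ring
  have h2 : k - k' = 0 := by
    refine eq_of_int_norm_lt_one (lt_of_le_of_lt ?_ hε1)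
    rw [← add_sub_cancel_left (G (shift ω θ) - K (shift ω θ)) fun j => (((k - k') j : ℤ) : ℂ),
      ← h1]
    refine (norm_sub_le _ _).trans ?_
    have h3 := H.norm_F_sub_le hθρ ((hε θ hθ).trans_lt hεr)
    have h4 := mul_le_mul_of_nonneg_left (hε θ hθ) (abs_nonneg Cf)
    linarith [hε _ ((shift_mem_openStrip ω).mpr hθ)]
  rw [h1, h2]
  ext j; simp

end TorusHyp

end

/-! ### The Newton step -/

section

variable {d n : ℕ}

theorem leftInverse_mul {κ ι : Type*} [Fintype κ] [Fintype ι] [DecidableEq ι]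
    {A : Matrix κ ι ℝ} (h : A.rank = Fintype.card ι) : leftInverse A * A = 1 := by
  have h1 : (Aᵀ * A).rank = Fintype.card ι := by rw [Matrix.rank_transpose_mul_self, h]
  have h2 : IsUnit (Aᵀ * A) := by
    rw [← Matrix.mulVec_surjective_iff_isUnit]
    have h3 : LinearMap.range (Aᵀ * A).mulVecLin = ⊤ :=
      Submodule.eq_top_of_finrank_eq (by rw [← Matrix.rank, h1, Module.finrank_fintype_fun_eq_card])
    exact LinearMap.range_eq_top.mp h3
  rw [leftInverse, Matrix.mul_assoc, Matrix.nonsing_inv_mul _ ((Matrix.isUnit_iff_isUnit_det _).mp h2)]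

theorem entriesLE_replicateCol {κ : Type*} [Fintype κ] {v : κ → ℂ} {C : ℝ} (h : ‖v‖ ≤ C) :
    EntriesLE (Matrix.replicateCol Unit v) C := fun i _ => (norm_le_pi_norm v i).trans h


/-- The coordinate `y` transverse to the torus of a vector in the adapted frame. -/
def transversePart (ξ : Matrix (PhaseIdx d n) Unit ℂ) : Matrix (Fin d) Unit ℂ :=
  ξ.submatrix (fun i => Sum.inl (Sum.inr i)) id

/-- The coordinates `(x, z)` tangent to the torus of a vector in the adapted frame. -/
def tangentPart (ξ : Matrix (PhaseIdx d n) Unit ℂ) : Matrix (AngleIdx d n) Unit ℂ :=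
  ξ.submatrix (Sum.elim (fun i => Sum.inl (Sum.inl i)) Sum.inr) id

/-- The vector in the adapted frame with the given tangential coordinates and no transverse one. -/
def ofTangent (q : Matrix (AngleIdx d n) Unit ℂ) : Matrix (PhaseIdx d n) Unit ℂ :=
  Matrix.of fun i u => Sum.elim (Sum.elim (fun i => q (Sum.inl i) u) fun _ => 0)
    (fun j => q (Sum.inr j) u) i

/-- The matrix of the linearized dynamics in the adapted frame. -/
def unipotent (S : Matrix (Fin d) (Fin d) ℂ) (A : Matrix (Fin n) (Fin d) ℂ) :
    Matrix (PhaseIdx d n) (PhaseIdx d n) ℂ :=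
  Matrix.fromBlocks (Matrix.fromBlocks 1 S 0 1) 0 (Matrix.fromCols 0 A) 1

theorem transversePart_unipotent_mul (S : Matrix (Fin d) (Fin d) ℂ) (A : Matrix (Fin n) (Fin d) ℂ)
    (ξ R : Matrix (PhaseIdx d n) Unit ℂ) :
    transversePart (unipotent S A * ξ + R) = transversePart ξ + transversePart R := by
  ext i u
  simp [transversePart, unipotent, Matrix.mul_apply, Fintype.sum_sum_type, Matrix.one_apply]

theorem tangentPart_unipotent_mul (S : Matrix (Fin d) (Fin d) ℂ) (A : Matrix (Fin n) (Fin d) ℂ)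
    (ξ R : Matrix (PhaseIdx d n) Unit ℂ) :
    tangentPart (unipotent S A * ξ + R) =
      tangentPart ξ + (Matrix.fromRows S A * transversePart ξ + tangentPart R) := by
  ext i u
  rcases i with i | i
  · simp [tangentPart, transversePart, unipotent, Matrix.mul_apply, Fintype.sum_sum_type,
      Matrix.one_apply, add_assoc]
  · simp [tangentPart, transversePart, unipotent, Matrix.mul_apply, Fintype.sum_sum_type,
      Matrix.one_apply]
    ring

theorem matM_mul_ofTangent (Jc : (PhaseIdx d n → ℂ) → Matrix (Fin d ⊕ Fin d) (Fin d ⊕ Fin d) ℂ)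
    (K : (AngleIdx d n → ℂ) → (PhaseIdx d n → ℂ)) (θ : AngleIdx d n → ℂ)
    (q : Matrix (AngleIdx d n) Unit ℂ) : matM Jc K θ * ofTangent q = jac ℂ K θ * q := by
  ext i u
  simp [matM_eq_fromCols, jac_eq_fromCols, ofTangent, Matrix.mul_apply, Fintype.sum_sum_type]

/-- The Newton step: an invariant torus `G` at distance `ε` from `K` is at distance of order `ε²`
from a translate of `K`, on a smaller strip. -/
theorem exists_newton_step (d n : ℕ) (σ ρ r Cf CDK CN CJ CΘ : ℝ) (hρ : 0 < ρ) (hr : 0 < r) :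
    ∃ (C : ℝ) (k : ℕ), 1 ≤ C ∧ ∀ {γ a δ ε : ℝ} {ω : AngleIdx d n → ℝ}
      {J : (PhaseIdx d n → ℝ) → Matrix (Fin d ⊕ Fin d) (Fin d ⊕ Fin d) ℝ}
      {Jc : (PhaseIdx d n → ℂ) → Matrix (Fin d ⊕ Fin d) (Fin d ⊕ Fin d) ℂ}
      {f : (PhaseIdx d n → ℝ) → (PhaseIdx d n → ℝ)}
      {F : (PhaseIdx d n → ℂ) → (PhaseIdx d n → ℂ)}
      {K G : (AngleIdx d n → ℂ) → (PhaseIdx d n → ℂ)},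
      TorusHyp γ σ ρ r Cf CDK CN CJ ω J Jc f F K → (matTheta Jc F ω K).rank = d →
      EntriesLE (leftInverse (matTheta Jc F ω K)) CΘ → γ ≤ 1 → a ≤ 7 * ρ / 8 → 0 < δ → δ ≤ 1 →
      2 * δ < a → IsAnalyticInvariant a F ω G → (∀ θ ∈ openStrip d n a, ‖G θ - K θ‖ ≤ ε) →
      C * ε < 1 →
      ∃ τ : AngleIdx d n → ℝ, ‖τ‖ ≤ C * ε ∧ ∀ θ ∈ openStrip d n (a - 2 * δ),
        ‖G θ - K (shift τ θ)‖ ≤ C / (γ ^ 2 * δ ^ k) * ε ^ 2 := by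
  obtain ⟨CM, hCM0, hM⟩ := exists_entriesLE_matM d n ρ r Cf CDK CN CJ
  obtain ⟨CI, hCI0, hI⟩ := exists_entriesLE_matM_inv d n ρ r Cf CDK CN CJ hρ
  obtain ⟨CS, hS⟩ := exists_entriesLE_twist d n ρ r Cf CDK CN CJ hρ
  obtain ⟨C₀, k, hC₀, hred⟩ := exists_reduced_bound d n σ CS CΘ
  set m : ℝ := ((Fintype.card (PhaseIdx d n) : ℕ) : ℝ) with hm
  set T : ℝ := Fintype.card (AngleIdx d n) * (16 * |CDK| / ρ) with hT
  set c₁ : ℝ := m * CM * (C₀ * (m * (CI * |Cf|))) with hc₁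
  set c₂ : ℝ := T * (m * CI) ^ 2 with hc₂
  have hT0 : 0 ≤ T := by positivity
  have hm0 : 0 ≤ m := by positivity
  have hc₁0 : 0 ≤ c₁ := by positivity
  have hc₂0 : 0 ≤ c₂ := by positivity
  have hmCI : 0 ≤ m * CI := by positivity
  have hr' : 0 < 1 / r := by positivity
  refine ⟨2 + m * CI + c₁ + c₂ + 1 / r + |Cf|, k, by linarith [abs_nonneg Cf], ?_⟩
  set C : ℝ := 2 + m * CI + c₁ + c₂ + 1 / r + |Cf| with hC
  intro γ a δ ε ω J Jc f F K G H hrank hΘ hγ1 haρ hδ hδ1 hδa hG hε hCε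
  have ha : 0 < a := by linarith
  have ha' : a ≤ ρ := by linarith
  have hε0 : 0 ≤ ε := (norm_nonneg _).trans (hε _ (toC_mem_openStrip ha 0))
  have hle : ∀ x, x ≤ C → x * ε < 1 := fun x hx => (mul_le_mul_of_nonneg_right hx hε0).trans_lt hCε
  have hε1 : 2 * ε < 1 := hle 2 (by linarith [abs_nonneg Cf])
  have hε2 : (|Cf| + 1) * ε < 1 := hle _ (by linarith)
  have hεr : ε < r := by
    have := hle (1 / r) (by linarith [abs_nonneg Cf])
    rwa [div_mul_eq_mul_div, one_mul, div_lt_one hr] at this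
  have hsub : openStrip d n a ⊆ openStrip d n ρ := openStrip_mono ha'
  have hsub' : openStrip d n a ⊆ strip d n (7 * ρ / 8) := fun θ hθ j => (hθ j).le.trans haρ
  -- the displacement, the quadratic remainder, and their coordinates in the adapted frame
  set Δ : (AngleIdx d n → ℂ) → Matrix (PhaseIdx d n) Unit ℂ :=
    fun θ => Matrix.replicateCol Unit (G θ - K θ) with hΔ
  have hΔt : TorusMat a Δ :=
    { holo := fun i _ => (differentiableOn_pi.mp hG.holo i).sub
        (differentiableOn_pi.mp (H.torus.holomorphic.mono hsub) i)
      per := fun θ hθ l => by rw [hΔ]; simp only [H.sub_periodic ha' hG hε hε1 hθ l]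
      real := fun t => by
        obtain ⟨u, hu⟩ := hG.real t
        ext i _
        simp [hΔ, hu, ← H.torus.toC_realTorus, toC] }
  set P : (AngleIdx d n → ℂ) → Matrix (PhaseIdx d n) (PhaseIdx d n) ℂ :=
    fun θ => jac ℂ F (K θ) with hP
  set R : (AngleIdx d n → ℂ) → Matrix (PhaseIdx d n) Unit ℂ :=
    fun θ => Δ (shift ω θ) - P θ * Δ θ with hR
  have hRt : TorusMat a R := (hΔt.shift ω).sub ((H.torusMat_P.mono ha').mul hΔt)
  have hRb : ∀ θ ∈ openStrip d n a, EntriesLE (R θ) (|Cf| * ε ^ 2) := by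
    intro θ hθ
    have h1 : R θ = Matrix.replicateCol Unit
        (F (G θ) - F (K θ) - jac ℂ F (K θ) *ᵥ (G θ - K θ)) := by
      rw [H.F_sub_F ha' hG hε hεr hε2 hθ]
      ext i u
      rfl
    rw [h1]
    refine entriesLE_replicateCol ((H.norm_F_taylor_le (hsub hθ)
      ((hε θ hθ).trans_lt hεr)).trans ?_)
    gcongr
    exact hε θ hθ
  set ξ : (AngleIdx d n → ℂ) → Matrix (PhaseIdx d n) Unit ℂ :=
    fun θ => (matM Jc K θ)⁻¹ * Δ θ with hξ
  have hξt : TorusMat a ξ := (H.torusMat_matM_inv.mono ha').mul hΔt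
  set R' : (AngleIdx d n → ℂ) → Matrix (PhaseIdx d n) Unit ℂ :=
    fun θ => (matM Jc K (shift ω θ))⁻¹ * R θ with hR'
  have hR't : TorusMat a R' := ((H.torusMat_matM_inv.mono ha').shift ω).mul hRt
  set E : ℝ := m * (CI * |Cf|) * ε ^ 2 with hE
  have hE0 : 0 ≤ E := by positivity
  have hR'b : ∀ θ ∈ openStrip d n a, EntriesLE (R' θ) E := by
    intro θ hθ
    refine ((hI H _ (hsub' ((shift_mem_openStrip ω).mpr hθ))).mul (hRb θ hθ)).mono (le_of_eq ?_)
    rw [abs_of_pos hCI0, abs_of_nonneg (by positivity), hE]; ring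
  have hMξ : ∀ θ ∈ openStrip d n a, matM Jc K θ * ξ θ = Δ θ := fun θ hθ => by
    rw [hξ]; simp only
    rw [← Matrix.mul_assoc, Matrix.mul_nonsing_inv _ (H.isUnit_matM (hsub hθ)), Matrix.one_mul]
  have hξeq : ∀ θ ∈ openStrip d n a, ξ (shift ω θ) =
      unipotent (matS1 Jc F ω K θ) (matA Jc F ω K θ) * ξ θ + R' θ := by
    intro θ hθ
    have hu := H.isUnit_matM (hsub ((shift_mem_openStrip ω).mpr hθ))
    have h1 : Δ (shift ω θ) = matM Jc K (shift ω θ) *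
        (unipotent (matS1 Jc F ω K θ) (matA Jc F ω K θ) * ξ θ) + R θ := by
      rw [← Matrix.mul_assoc, unipotent, ← H.P_mul_matM (hsub hθ), Matrix.mul_assoc, hMξ θ hθ]
      simp [hR, hP]
    change (matM Jc K (shift ω θ))⁻¹ * Δ (shift ω θ) = _
    rw [h1, Matrix.mul_add, ← Matrix.mul_assoc _ (matM Jc K (shift ω θ)),
      Matrix.nonsing_inv_mul _ hu, Matrix.one_mul]
  have hmain := hred (S := fun θ => Matrix.fromRows (matS1 Jc F ω K θ) (matA Jc F ω K θ))
    (q := fun θ => tangentPart (ξ θ)) (y := fun θ => transversePart (ξ θ))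
    (Rq := fun θ => tangentPart (R' θ)) (Ry := fun θ => transversePart (R' θ))
    (L := (leftInverse (matTheta Jc F ω K)).map fun x => (x : ℂ))
    H.γ_pos hγ1 H.dioph hδ hδ1 hδa hE0
    ((H.torusMat_matS1.fromRows H.torusMat_matA).mono ha') (hξt.submatrix _ _)
    (hξt.submatrix _ _) (hR't.submatrix _ _) (hR't.submatrix _ _)
    (fun θ hθ => hS H θ (hsub' hθ)) (fun θ hθ => (hR'b θ hθ).submatrix _ _)
    (fun θ hθ => (hR'b θ hθ).submatrix _ _)
    (fun θ hθ => by rw [hξeq θ hθ, transversePart_unipotent_mul])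
    (fun θ hθ => by rw [hξeq θ hθ, tangentPart_unipotent_mul])
    (by
      rw [meanMat_eq_map (H.torusMat_matS1.fromRows H.torusMat_matA)]
      have h1 := congrArg (fun B => B.map fun x : ℝ => (x : ℂ))
        (leftInverse_mul (A := matTheta Jc F ω K) (by rw [hrank, Fintype.card_fin]))
      refine (Matrix.map_mul (f := Complex.ofRealHom)).symm.trans (h1.trans ?_)
      ext i j
      simp [Matrix.one_apply, apply_ite])
    (fun i j => by simpa using hΘ i j)
  -- the translation is the mean value of the tangential part
  set qm := meanMat fun θ => tangentPart (ξ θ) with hqm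
  have hξb : ∀ θ ∈ openStrip d n a, EntriesLE (ξ θ) (m * CI * ε) := by
    intro θ hθ
    refine ((hI H _ (hsub' hθ)).mul (entriesLE_replicateCol (hε θ hθ))).mono (le_of_eq ?_)
    rw [abs_of_pos hCI0, abs_of_nonneg hε0]; ring
  obtain ⟨τ, hτ⟩ : ∃ τ : AngleIdx d n → ℝ, qm = Matrix.replicateCol Unit (toC τ) := by
    have h1 := meanMat_eq_map (A := fun θ => tangentPart (ξ θ)) (hξt.submatrix _ _)
    exact ⟨fun i => ∫ t in Icc (0 : AngleIdx d n → ℝ) 1, (tangentPart (ξ (toC t)) i ()).re, h1⟩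
  have hτb : ‖τ‖ ≤ m * CI * ε := by
    rw [← norm_toC]
    refine (pi_norm_le_iff_of_nonneg (by positivity)).mpr fun i => ?_
    have h1 : EntriesLE qm (m * CI * ε) := entriesLE_meanMat fun t =>
      (hξb _ (toC_mem_openStrip ha t)).submatrix _ _
    rw [hτ] at h1
    exact h1 i ()
  refine ⟨τ, hτb.trans (mul_le_mul_of_nonneg_right (by linarith [abs_nonneg Cf]) hε0), ?_⟩
  intro θ hθ
  have hθa : θ ∈ openStrip d n a := openStrip_mono (by linarith) hθ
  obtain ⟨hy, hq⟩ := hmain θ hθ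
  set Q : ℝ := 1 / (γ ^ 2 * δ ^ k) with hQ
  have hQ1 : 1 ≤ Q := by
    have := H.γ_pos
    rw [hQ, le_div_iff₀ (by positivity), one_mul]
    exact mul_le_one₀ (pow_le_one₀ H.γ_pos.le hγ1) (by positivity) (pow_le_one₀ hδ.le hδ1)
  have hb : EntriesLE (ξ θ - ofTangent qm) (C₀ / (γ ^ 2 * δ ^ k) * E) := by
    rintro ((i | i) | i) u
    · exact hq (Sum.inl i) u
    · have h1 := hy i u
      simpa [ofTangent, transversePart] using h1
    · exact hq (Sum.inr i) u
  have hγ := H.γ_pos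
  have h1 : ‖(G θ - K θ) - jac ℂ K θ *ᵥ toC τ‖ ≤ c₁ * Q * ε ^ 2 := by
    have h2 : Matrix.replicateCol Unit ((G θ - K θ) - jac ℂ K θ *ᵥ toC τ) =
        matM Jc K θ * (ξ θ - ofTangent qm) := by
      rw [Matrix.mul_sub, hMξ θ hθa, matM_mul_ofTangent, hτ, ← Matrix.replicateCol_mulVec]
      rfl
    have h3 := ((hM H θ (hsub hθa)).1).mul hb
    rw [← h2] at h3
    refine (pi_norm_le_iff_of_nonneg (by positivity)).mpr fun i => (h3 i ()).trans (le_of_eq ?_)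
    rw [abs_of_pos hCM0, abs_of_nonneg (by positivity), hc₁, hQ, hE, hm]
    ring
  have h2 := H.norm_taylor_le (hsub' hθa) τ
  have h3 : T * ‖τ‖ ^ 2 ≤ c₂ * Q * ε ^ 2 := by
    calc T * ‖τ‖ ^ 2 ≤ T * (m * CI * ε) ^ 2 := by gcongr
      _ = c₂ * ε ^ 2 * 1 := by rw [hc₂]; ring
      _ ≤ c₂ * ε ^ 2 * Q := by gcongr
      _ = _ := by ring
  have h4 : G θ - K (shift τ θ) = ((G θ - K θ) - jac ℂ K θ *ᵥ toC τ) -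
      (K (shift τ θ) - K θ - jac ℂ K θ *ᵥ toC τ) := by abel
  rw [h4]
  refine (_root_.norm_sub_le _ _).trans ((add_le_add h1 (h2.trans h3)).trans ?_)
  have h5 : C / (γ ^ 2 * δ ^ k) * ε ^ 2 = C * Q * ε ^ 2 := by rw [hQ]; ring
  rw [h5, ← add_mul, ← add_mul]
  gcongr
  linarith [abs_nonneg Cf]

end

/-! ### Convergence of the iteration -/

section

/-- Iterating the Newton step: an invariant torus sufficiently close to `K` is a translate of `K`. -/
theorem exists_translate_eq (d n : ℕ) (σ ρ r Cf CDK CN CJ CΘ : ℝ) (hρ : 0 < ρ) (hr : 0 < r) :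
    ∃ c : ℝ, 0 < c ∧ ∀ {γ : ℝ} {ω : AngleIdx d n → ℝ}
      {J : (PhaseIdx d n → ℝ) → Matrix (Fin d ⊕ Fin d) (Fin d ⊕ Fin d) ℝ}
      {Jc : (PhaseIdx d n → ℂ) → Matrix (Fin d ⊕ Fin d) (Fin d ⊕ Fin d) ℂ}
      {f : (PhaseIdx d n → ℝ) → (PhaseIdx d n → ℝ)}
      {F : (PhaseIdx d n → ℂ) → (PhaseIdx d n → ℂ)}
      {K G : (AngleIdx d n → ℂ) → (PhaseIdx d n → ℂ)},
      TorusHyp γ σ ρ r Cf CDK CN CJ ω J Jc f F K → (matTheta Jc F ω K).rank = d →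
      EntriesLE (leftInverse (matTheta Jc F ω K)) CΘ → γ ≤ 1 →
      IsAnalyticInvariant (3 * ρ / 4) F ω G →
      (∀ θ ∈ openStrip d n (3 * ρ / 4), ‖G θ - K θ‖ ≤ c * γ ^ 2) →
      ∃ τ : AngleIdx d n → ℝ, ∀ θ ∈ strip d n (ρ / 2), G θ = K (shift τ θ) := by
  obtain ⟨C, k, hC, hstep⟩ := exists_newton_step d n σ ρ r Cf CDK CN CJ CΘ hρ hr
  set s : ℝ := min ρ 1 with hs
  have hs0 : 0 < s := lt_min hρ one_pos
  have hs1 : s ≤ 1 := min_le_right _ _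
  have hsρ : s ≤ ρ := min_le_left _ _
  have hC0 : 0 < C := by linarith
  set B : ℝ := 2 * 2 ^ k with hB
  have hB2 : 2 ≤ B := by
    rw [hB]
    have : (1 : ℝ) ≤ 2 ^ k := one_le_pow₀ (by norm_num)
    linarith
  have hB0 : 0 < B := by linarith
  refine ⟨s ^ k / (C * 2 ^ (5 * k) * B), by positivity, ?_⟩
  intro γ ω J Jc f F K G H hrank hΘ hγ1 hG hclose
  have hγ := H.γ_pos
  -- widths `a`, losses `δ` and errors `e` of the iteration
  set A : ℝ := C * 2 ^ (5 * k) / (γ ^ 2 * s ^ k) with hA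
  have hA0 : 0 < A := by positivity
  have hCA : C ≤ A := by
    rw [hA, le_div_iff₀ (by positivity)]
    refine mul_le_mul_of_nonneg_left ?_ hC0.le
    have h1 : γ ^ 2 * s ^ k ≤ 1 :=
      mul_le_one₀ (pow_le_one₀ hγ.le hγ1) (by positivity) (pow_le_one₀ hs0.le hs1)
    exact h1.trans (one_le_pow₀ (by norm_num))
  set a : ℕ → ℝ := fun m => ρ / 2 + ρ / 4 / 2 ^ m with ha
  set δ : ℕ → ℝ := fun m => s / (2 ^ 5 * 2 ^ m) with hδ
  set e : ℕ → ℝ := fun m => 1 / (A * B ^ (m + 1)) with he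
  have he0 : ∀ m, 0 < e m := fun m => by positivity
  have hCe : ∀ m, C * e m ≤ (1 / 2) ^ m / 2 := by
    intro m
    have h1 : C * e m ≤ 1 / B ^ (m + 1) := by
      calc C * e m ≤ A * e m := mul_le_mul_of_nonneg_right hCA (he0 m).le
        _ = 1 / B ^ (m + 1) := by simp only [he]; field_simp
    refine h1.trans ?_
    calc 1 / B ^ (m + 1) ≤ 1 / 2 ^ (m + 1) := by gcongr
      _ = (1 / 2) ^ m / 2 := by rw [pow_succ, div_pow, one_pow]; field_simp
  have hrec : ∀ m, C / (γ ^ 2 * δ m ^ k) * e m ^ 2 ≤ e (m + 1) := by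
    intro m
    have h1 : C / (γ ^ 2 * δ m ^ k) = A * (2 ^ m) ^ k := by
      simp only [hδ, hA, div_pow, mul_pow]
      rw [← pow_mul 2 5 k]; field_simp
    have h2 : e (m + 1) = e m ^ 2 * (A * B ^ m) := by
      simp only [he]; field_simp; ring
    have h3 : B ^ m = 2 ^ m * (2 ^ m) ^ k := by
      rw [hB, mul_pow, ← pow_mul, ← pow_mul, mul_comm k m]
    rw [h1, h2, h3, mul_comm]
    have h4 : (1 : ℝ) ≤ 2 ^ m := one_le_pow₀ (by norm_num)
    have h5 : (2 ^ m) ^ k ≤ (2 : ℝ) ^ m * (2 ^ m) ^ k := le_mul_of_one_le_left (by positivity) h4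
    gcongr
  have hδ0 : ∀ m, 0 < δ m := fun m => by positivity
  have hpow : ∀ m, (1 : ℝ) ≤ 2 ^ m := fun m => one_le_pow₀ (by norm_num)
  have hδ1 : ∀ m, δ m ≤ 1 := fun m => by
    simp only [hδ]
    rw [div_le_one (by positivity)]
    nlinarith [hpow m]
  have hδρ : ∀ m, 2 * δ m ≤ ρ / 8 / 2 ^ m := fun m => by
    have h1 : 2 * δ m = s / 16 / 2 ^ m := by simp only [hδ]; field_simp; norm_num
    rw [h1]
    gcongr
    linarith
  have haa : ∀ m, a (m + 1) ≤ a m - 2 * δ m := fun m => by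
    have h1 := hδρ m
    have h2 : ρ / 4 / 2 ^ (m + 1) = ρ / 4 / 2 ^ m - ρ / 8 / 2 ^ m := by
      rw [pow_succ]; field_simp; norm_num
    simp only [ha]
    linarith
  have haρ : ∀ m, a m ≤ 3 * ρ / 4 := fun m => by
    have : ρ / 4 / 2 ^ m ≤ ρ / 4 := div_le_self (by positivity) (hpow m)
    simp only [ha]; linarith
  have ha2 : ∀ m, ρ / 2 < a m := fun m => by
    have : 0 < ρ / 4 / 2 ^ m := by positivity
    simp only [ha]; linarith
  have hδa : ∀ m, 2 * δ m < a m := fun m => by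
    have h1 : ρ / 8 / 2 ^ m ≤ ρ / 8 := div_le_self (by positivity) (hpow m)
    linarith [hδρ m, ha2 m]
  -- the property kept by the iteration, and one step
  set Good : ℕ → (AngleIdx d n → ℝ) → Prop := fun m T =>
    ∀ θ ∈ openStrip d n (a m), ‖G θ - K (shift T θ)‖ ≤ e m with hGood
  have hgood0 : Good 0 0 := by
    intro θ hθ
    rw [shift_zero]
    refine (hclose θ (openStrip_mono (haρ 0) hθ)).trans (le_of_eq ?_)
    simp only [he, hA]
    field_simp
    simp
  have hgood : ∀ m T, Good m T → ∃ T', ‖T' - T‖ ≤ (1 / 2) ^ m / 2 ∧ Good (m + 1) T' := by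
    intro m T hT
    have hCe1 : C * e m < 1 := by
      refine (hCe m).trans_lt ?_
      have : ((1 : ℝ) / 2) ^ m ≤ 1 := pow_le_one₀ (by norm_num) (by norm_num)
      linarith
    obtain ⟨τ, hτ, hτ'⟩ := hstep (G := fun θ => G (shift (-T) θ)) H hrank hΘ hγ1
      ((haρ m).trans (by linarith)) (hδ0 m) (hδ1 m) (hδa m)
      ((hG.mono (haρ m)).comp_shift (-T)) (fun θ hθ => by
        have h1 := hT _ ((shift_mem_openStrip (-T)).mpr hθ)
        rwa [shift_shift, neg_add_cancel, shift_zero] at h1) hCe1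
    refine ⟨T + τ, ?_, fun θ hθ => ?_⟩
    · rw [add_sub_cancel_left]
      exact hτ.trans (hCe m)
    · have h1 := hτ' (shift T θ) ((shift_mem_openStrip T).mpr (openStrip_mono (haa m) hθ))
      rw [shift_shift, shift_shift, add_neg_cancel, shift_zero] at h1
      exact h1.trans (hrec m)
  choose! next hnext1 hnext2 using hgood
  set T : ℕ → (AngleIdx d n → ℝ) := fun m => Nat.rec 0 next m with hT
  have hTgood : ∀ m, Good m (T m) := by
    intro m
    induction m with
    | zero => exact hgood0
    | succ m ih => exact hnext2 m _ ih
  have hTc : CauchySeq T := cauchySeq_of_le_geometric (1 / 2) (1 / 2) (by norm_num) fun m => by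
    rw [dist_comm, dist_eq_norm]
    refine (hnext1 m (T m) (hTgood m)).trans (le_of_eq (by ring))
  obtain ⟨τ, hτ⟩ := cauchySeq_tendsto_of_complete hTc
  refine ⟨τ, fun θ hθ => ?_⟩
  have hθρ : shift τ θ ∈ openStrip d n ρ :=
    (shift_mem_openStrip τ).mpr (strip_subset_openStrip (by linarith) hθ)
  have h1 : Tendsto (fun m => K (shift (T m) θ)) atTop (𝓝 (K (shift τ θ))) := by
    refine (H.differentiableAt_K hθρ).continuousAt.tendsto.comp ?_
    unfold shift
    exact ((continuous_toC.tendsto τ).comp hτ).const_add θ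
  have he_lim : Tendsto e atTop (𝓝 0) := by
    have h2 : Tendsto (fun m : ℕ => ((1 : ℝ) / 2) ^ m / 2) atTop (𝓝 (0 / 2)) :=
      (tendsto_pow_atTop_nhds_zero_of_lt_one (by norm_num) (by norm_num)).div_const 2
    rw [zero_div] at h2
    refine squeeze_zero (fun m => (he0 m).le) (fun m => ?_) h2
    exact (le_mul_of_one_le_left (he0 m).le hC).trans (hCe m)
  have h3 : Tendsto (fun m => G θ - K (shift (T m) θ)) atTop (𝓝 0) :=
    squeeze_zero_norm (fun m => hTgood m θ (strip_subset_openStrip (ha2 m) hθ)) he_lim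
  have h4 := tendsto_nhds_unique h3 (h1.const_sub (G θ))
  exact (sub_eq_zero.mp h4.symm)

/-- A Diophantine constant is at most `1`. -/
theorem Diophantine.le_one {d n : ℕ} {γ σ : ℝ} {ω : AngleIdx d n → ℝ} (h : Diophantine γ σ ω)
    (j : AngleIdx d n) : γ ≤ 1 := by
  have h1 := h (Pi.single j 1) (by simp) (round (ω j))
  have h2 : ∑ i, |((Pi.single j 1 : AngleIdx d n → ℤ) i : ℝ)| = 1 := by
    rw [Finset.sum_eq_single j] <;> simp +contextual
  have h3 : ∑ i, ((Pi.single j 1 : AngleIdx d n → ℤ) i : ℝ) * ω i = ω j := by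
    rw [Finset.sum_eq_single j] <;> simp +contextual
  rw [h2, h3, Real.one_rpow, mul_one] at h1
  exact h1.trans ((abs_sub_round _).trans (by norm_num))

end

end PresymplecticKAM
theorem theorem3p2 (d n : ℕ) (σ ρ r Cf CDK CN CJ CΘ : ℝ)
    (hσ : (d : ℝ) + (n : ℝ) ≤ σ) (hρ : 0 < ρ) (hr : 0 < r) :
    ∃ c : ℝ, 0 < c ∧
      ∀ (γ : ℝ) (ω : AngleIdx d n → ℝ)
        (J : (PhaseIdx d n → ℝ) → Matrix (Fin d ⊕ Fin d) (Fin d ⊕ Fin d) ℝ)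
        (Jc : (PhaseIdx d n → ℂ) → Matrix (Fin d ⊕ Fin d) (Fin d ⊕ Fin d) ℂ)
        (f : (PhaseIdx d n → ℝ) → (PhaseIdx d n → ℝ))
        (F : (PhaseIdx d n → ℂ) → (PhaseIdx d n → ℂ))
        (K₁ K₂ : (AngleIdx d n → ℂ) → (PhaseIdx d n → ℂ)),
        0 < γ → Diophantine γ σ ω →
        IsExactPresymplectic J → IsPresymplecticDiffeo J f →
        IsTorusMap ρ K₁ → IsTorusMap ρ K₂ →
        ExtendsForm J Jc (nbhd ρ r K₁) CJ →
        ExtendsMap f F (nbhd ρ r K₁) Cf →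
        (∀ θ ∈ strip d n ρ, K₂ θ ∈ nbhd ρ r K₁) →
        IsNondegenerate Jc K₁ ρ → IsNondegenerate Jc K₂ ρ →
        IsInvariantTorus F ω K₁ ρ → IsInvariantTorus F ω K₂ ρ →
        (∀ θ ∈ openStrip d n ρ, EntriesLE (jac ℂ K₁ θ) CDK) →
        (∀ θ ∈ openStrip d n ρ, EntriesLE (matN K₁ θ) CN) →
        (matTheta Jc F ω K₁).rank = d →
        EntriesLE (leftInverse (matTheta Jc F ω K₁)) CΘ →
        (∀ θ ∈ strip d n ρ, CloseInM (c * γ ^ 2 * (ρ / 8) ^ (2 * σ)) (K₁ θ) (K₂ θ)) →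
        ∃ τ : AngleIdx d n → ℝ,
          ∀ θ ∈ strip d n (ρ / 2), SameInM (K₁ (shift τ θ)) (K₂ θ) := by
  obtain ⟨c₀, hc₀, hmain⟩ := exists_translate_eq d n σ ρ r Cf CDK CN CJ CΘ hρ hr
  have hpow : 0 < (ρ / 8) ^ (2 * σ) := Real.rpow_pos_of_pos (by positivity) _
  refine ⟨min c₀ (1 / 4) / (ρ / 8) ^ (2 * σ), by positivity, ?_⟩
  intro γ ω J Jc f F K₁ K₂ hγ hω hJ hf hK₁ hK₂ hJc hF hK₂mem hnd₁ _ hinv₁ hinv₂ hDK hN hrank hΘ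
    hclose
  rcases isEmpty_or_nonempty (AngleIdx d n) with hempty | ⟨⟨j₀⟩⟩
  · -- no angles: the phase space is a point
    have hP : IsEmpty (PhaseIdx d n) := by
      refine ⟨fun j => ?_⟩
      rcases j with (j | j) | j
      · exact hempty.false (Sum.inl j)
      · exact hempty.false (Sum.inl j)
      · exact hempty.false (Sum.inr j)
    exact ⟨0, fun θ _ => ⟨0, fun _ => rfl, fun j => hP.elim j⟩⟩
  have hγ1 : γ ≤ 1 := hω.le_one j₀
  have H : TorusHyp γ σ ρ r Cf CDK CN CJ ω J Jc f F K₁ :=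
    ⟨hρ, hr, hγ, hω, hJ, hf, hK₁, hJc, hF, hnd₁, hinv₁, hDK, hN⟩
  have hε : min c₀ (1 / 4) / (ρ / 8) ^ (2 * σ) * γ ^ 2 * (ρ / 8) ^ (2 * σ) =
      min c₀ (1 / 4) * γ ^ 2 := by field_simp
  rw [hε] at hclose
  have hγ2 : γ ^ 2 ≤ 1 := pow_le_one₀ hγ.le hγ1
  have hε4 : min c₀ (1 / 4) * γ ^ 2 ≤ 1 / 4 := by
    calc min c₀ (1 / 4) * γ ^ 2 ≤ 1 / 4 * 1 := by gcongr; exact min_le_right _ _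
      _ = 1 / 4 := by norm_num
  -- the integer vector relating the lifts of the two tori is constant
  choose! w hw hwε using hclose
  choose! k hk0 hk using hw
  set k₀ := k (toC 0) with hk₀
  have h0 := toC_mem_strip (d := d) (n := n) hρ.le 0
  have hkc : ∀ θ ∈ strip d n ρ, k θ = k₀ := fun θ hθ =>
    int_eq_of_norm_sub_lt (convex_strip ρ).isPreconnected (hK₁.continuousOn.sub hK₂.continuousOn)
      (fun θ hθ => by
        refine lt_of_eq_of_lt ?_ ((hwε θ hθ).trans_le hε4)
        congr 1
        ext j
        simp [hk θ hθ j]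
        ring) hθ h0
  set G : (AngleIdx d n → ℂ) → (PhaseIdx d n → ℂ) := fun θ => K₂ θ + fun j => (k₀ j : ℂ) with hGdef
  have hsame : ∀ θ, SameInM (G θ) (K₂ θ) := fun θ => ⟨k₀, hk0 _ h0, fun j => rfl⟩
  have hsub : openStrip d n (3 * ρ / 4) ⊆ strip d n ρ := fun θ hθ j => (hθ j).le.trans (by linarith)
  have hG : IsAnalyticInvariant (3 * ρ / 4) F ω G :=
    { holo := (hK₂.holomorphic.mono (openStrip_mono (by linarith))).add_const _
      per := fun θ hθ l => ((hsame _).trans (hK₂.periodic θ (hsub hθ) l)).trans (hsame _).symm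
      real := fun t => by
        obtain ⟨u, hu⟩ := hK₂.real t
        exact ⟨u + fun j => (k₀ j : ℝ), by ext j; simp [hGdef, hu, toC]⟩
      inv := fun θ hθ => ((hF.descends _ ((hsame θ).mem_nbhd (hK₂mem θ (hsub hθ))) _
        (hK₂mem θ (hsub hθ)) (hsame θ)).trans (hinv₂ θ (hsub hθ))).trans (hsame _).symm }
  obtain ⟨τ, hτ⟩ := hmain H hrank hΘ hγ1 hG fun θ hθ => by
    have h1 : G θ = w θ := by
      ext j
      rw [hk θ (hsub hθ) j, hkc θ (hsub hθ)]
      rfl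
    rw [h1, norm_sub_rev]
    refine (hwε θ (hsub hθ)).le.trans ?_
    gcongr
    exact min_le_left _ _
  exact ⟨τ, fun θ hθ => (hτ θ hθ) ▸ hsame θ⟩
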